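/- Let $n\ge 3$, let $I_1,I_n,B_n\in\mathbb R$ with $I_1+I_n>0$, and let $I=\mathrm{diag}(I_1,\dots,I_1,I_n)$ (mass tensor), $J(\Omega)=I\Omega+\Omega I$ for $\Omega\in so(n)$ (inertia tensor), and $V(\Gamma)=B_n\Gamma_n$ (homogeneous gravitational field, centre of mass on the axis of dynamical symmetry $e_n$). Let $\langle X,Y\rangle=-\frac12\operatorname{tr}(XY)$ on $so(n)$, let $a^{ij}=E_{ij}-E_{ji}$, so that the constraints $\Omega_{ij}=0$, $i,j\le n-1$, read $\langle a^{ij},\Omega\rangle=0$ for $i<j\le n-1$, and let $D\subset so(n)$ be the space of all $\Omega$ that satisfy them. The multidimensional Lagrange case of the Suslov problem is the system $$\dot M=[M,\Omega]+\frac{\partial V}{\partial\Gamma}\wedge\Gamma+\sum_{i<j\le n-1}\lambda_{ij}a^{ij},\qquad \dot\Gamma=-\Omega\Gamma,\qquad \Omega\in D,\qquad M=J(\Omega),$$ where $x\wedge y=xy^t-yx^t$ and the $\lambda_{ij}$ are Lagrange multipliers, on the phase space $\mathcal M=D\{\Omega\}\times S^{n-1}\{\Gamma\}$. On the whole phase space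 $\mathcal D=\{(g,\Omega): g\in SO(n),\ \Omega\in D\}\subset TSO(n)$ (left trivialization) it consists of the same equation for $M$, in which $\Gamma=g^{-1}\Gamma_0$ for a fixed unit vector $\Gamma_0\in\mathbb R^n$, and of $\dot g=g\Omega$. This system is completely integrable, both on $\mathcal M$ and, for every unit vector $\Gamma_0$, on $\mathcal D$: almost all of the phase space is foliated by invariant tori with dynamics that is quasi-periodic after a change of time. That is, let $S$ be the phase space and $d$ its dimension, so $d=2(n-1)$ for $\mathcal M$ and $d=\binom n2+n-1$ for $\mathcal D$. Then there are integers $k,l\ge 0$ with $k+l=d$ and a family of pairwise disjoint subsets of $S$ (the tori) whose union has a complement in $S$ of $d$-dimensional surface measure zero, such that every point of the union has a neighbourhood, open in $S$, that is diffeomorphic to $\mathbb T^k\times W$ for some open $W\subset\mathbb R^l$ in such a way that every $\mathbb T^k\times\{w\}$ is one of the tori and is invariant, and the solutions on it are exactly the solutions of $$\dot\varphi_i=\frac{\omega_i(w)}{\Phi(\varphi_1,\dots,\varphi_k,w)},\qquad i=1,\dots,k,$$ where $\omega:W\to\mathbb R^k$ and $\Phi:\mathbb T^k\times W\to(0,\infty)$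 are smooth; in the new time $d\tau=\Phi^{-1}dt$ these are $d\varphi_i/d\tau=\omega_i$. -/

import Mathlib

open scoped ContDiff Matrix
open MeasureTheory

attribute [local instance] Matrix.normedAddCommGroup Matrix.normedSpace

noncomputable section

namespace Suslov

/-! ## Foliations by invariant tori with quasi-periodic dynamics after a change of time -/

/-- The equations `dφᵢ/dt = ωᵢ / Φ(φ₁, …, φₖ)` on the torus `(ℝ / 2πℤ)ᵏ`, for a lifted curve
`φ` in `ℝᵏ` and times in `J`. In the new time `dτ = dt / Φ` they read `dφᵢ/dτ = ωᵢ`. -/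
def IsTorusMotion {k : ℕ} (freq : Fin k → ℝ) (Φ : (Fin k → ℝ) → ℝ) (J : Set ℝ)
    (φ : ℝ → Fin k → ℝ) : Prop :=
  ∀ t ∈ J, HasDerivAt φ (fun i => freq i / Φ (φ t)) t

/-- Translation of the angles by the period lattice `2πℤᵏ`. -/
def shift {k : ℕ} (φ : Fin k → ℝ) (N : Fin k → ℤ) : Fin k → ℝ :=
  fun i => φ i + 2 * Real.pi * (N i : ℝ)

/-- Let `S` be a submanifold of `E` (the phase space) and let `Sol J x` say that the curve `x`
is a solution, on the set of times `J`, of a system on `S`.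
`IsTorusChart S Sol V ι freq Φ` (`ω = freq`) says that `ι` induces a diffeomorphism of `𝕋ᵏ × V`
(`V` an open subset of `ℝˡ`) onto an open subset of `S`, that every torus `𝕋ᵏ × {v}` is
invariant, and that the system on it is `dφᵢ/dt = ωᵢ(v) / Φ(φ, v)` with `Φ > 0`. -/
structure IsTorusChart {E : Type*} [NormedAddCommGroup E] [NormedSpace ℝ E]
    (S : Set E) (Sol : Set ℝ → (ℝ → E) → Prop) {k l : ℕ} (V : Set (Fin l → ℝ))
    (ι : (Fin k → ℝ) × (Fin l → ℝ) → E) (freq : (Fin l → ℝ) → Fin k → ℝ)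
    (Φ : (Fin k → ℝ) × (Fin l → ℝ) → ℝ) : Prop where
  isOpen_base : IsOpen V
  /-- `ι` is smooth, -/
  contDiffOn : ContDiffOn ℝ ∞ ι (Set.univ ×ˢ V)
  /-- it is well defined and injective on `𝕋ᵏ × V`, -/
  eq_iff : ∀ φ ψ : Fin k → ℝ, ∀ v ∈ V, ∀ w ∈ V,
    ι (φ, v) = ι (ψ, w) ↔ v = w ∧ ∃ N : Fin k → ℤ, ψ = shift φ N
  /-- it is an immersion, -/
  immersion : ∀ φ : Fin k → ℝ, ∀ v ∈ V, Function.Injective (fderiv ℝ ι (φ, v))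
  /-- and its image is an open subset of `S`. -/
  isOpen_image : ∃ O : Set E, IsOpen O ∧ ι '' (Set.univ ×ˢ V) = S ∩ O
  /-- The frequencies depend smoothly on the torus, and `Φ` is a smooth positive function
  on `𝕋ᵏ × V`. -/
  contDiffOn_freq : ContDiffOn ℝ ∞ freq V
  contDiffOn_density : ContDiffOn ℝ ∞ Φ (Set.univ ×ˢ V)
  density_pos : ∀ φ : Fin k → ℝ, ∀ v ∈ V, 0 < Φ (φ, v)
  density_periodic : ∀ φ : Fin k → ℝ, ∀ N : Fin k → ℤ, ∀ v ∈ V, Φ (shift φ N, v) = Φ (φ, v)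
  /-- Motions on the tori are solutions of the system, -/
  solution_of_motion : ∀ v ∈ V, ∀ J : Set ℝ, IsOpen J → J.OrdConnected →
    ∀ φ : ℝ → Fin k → ℝ, IsTorusMotion (freq v) (fun ψ => Φ (ψ, v)) J φ →
      Sol J (fun t => ι (φ t, v))
  /-- and every solution that meets one of the tori stays on it and is such a motion. -/
  motion_of_solution : ∀ v ∈ V, ∀ J : Set ℝ, IsOpen J → J.OrdConnected →
    ∀ x : ℝ → E, Sol J x → ∀ t₀ ∈ J, ∀ φ₀ : Fin k → ℝ, x t₀ = ι (φ₀, v) →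
      ∃ φ : ℝ → Fin k → ℝ, φ t₀ = φ₀ ∧ IsTorusMotion (freq v) (fun ψ => Φ (ψ, v)) J φ ∧
        ∀ t ∈ J, x t = ι (φ t, v)

/-- The `d`-dimensional surface (Hausdorff) measure on a normed space with its Borel sets. -/
def surfaceMeasure {E : Type*} [NormedAddCommGroup E] (d : ℕ) : @Measure E (borel E) :=
  letI : MeasurableSpace E := borel E
  haveI : BorelSpace E := ⟨rfl⟩
  Measure.hausdorffMeasure (d : ℝ)

/-- Complete integrability of the system `Sol` on the `d`-dimensional submanifold `S` of `E`:
almost all of `S` (with respect to the `d`-dimensional surface measure) is foliated by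
invariant tori of some dimension `k`, with dynamics that is quasi-periodic after a change of
time. The leaves are the members of `𝓕`; they are pairwise disjoint, and near each of its
points the foliation is a product `𝕋ᵏ × V` with `V` open in `ℝˡ`, `k + l = d`. -/
def IsCompletelyIntegrable {E : Type*} [NormedAddCommGroup E] [NormedSpace ℝ E]
    (S : Set E) (d : ℕ) (Sol : Set ℝ → (ℝ → E) → Prop) : Prop :=
  ∃ (k l : ℕ) (𝓕 : Set (Set E)), k + l = d ∧ 𝓕.PairwiseDisjoint id ∧
    surfaceMeasure d (S \ ⋃₀ 𝓕) = 0 ∧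
    ∀ p ∈ ⋃₀ 𝓕, ∃ (V : Set (Fin l → ℝ)) (ι : (Fin k → ℝ) × (Fin l → ℝ) → E)
      (freq : (Fin l → ℝ) → Fin k → ℝ) (Φ : (Fin k → ℝ) × (Fin l → ℝ) → ℝ),
      IsTorusChart S Sol V ι freq Φ ∧ p ∈ ι '' (Set.univ ×ˢ V) ∧
        ∀ v ∈ V, ι '' (Set.univ ×ˢ {v}) ∈ 𝓕

/-! ## The Suslov problem for a rigid body in `ℝⁿ` with a potential force -/

section General

variable {n : ℕ} {κ : Type*} [Fintype κ]

/-- The invariant scalar product `⟨X, Y⟩ = -½ tr(XY)` on `so(n)`. -/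
def scalar (X Y : Matrix (Fin n) (Fin n) ℝ) : ℝ := -(1 / 2) * (X * Y).trace

/-- The inertia tensor `J(Ω) = IΩ + ΩI` of a body with mass tensor `I`. -/
def inertia (I Ω : Matrix (Fin n) (Fin n) ℝ) : Matrix (Fin n) (Fin n) ℝ := I * Ω + Ω * I

/-- `x ∧ y = x yᵗ - y xᵗ`. -/
def wedge (x y : Fin n → ℝ) : Matrix (Fin n) (Fin n) ℝ :=
  Matrix.vecMulVec x y - Matrix.vecMulVec y x

/-- The gradient `∂V/∂Γ`. -/
def grad (U : (Fin n → ℝ) → ℝ) (Γ : Fin n → ℝ) : Fin n → ℝ :=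
  fun i => fderiv ℝ U Γ (Pi.single i 1)

/-- The admissible angular velocities: `Ω ∈ so(n)` with `⟨aⁱ, Ω⟩ = 0` for all `i`. -/
def admissible (a : κ → Matrix (Fin n) (Fin n) ℝ) : Set (Matrix (Fin n) (Fin n) ℝ) :=
  {Ω | Ωᵀ = -Ω ∧ ∀ i, scalar (a i) Ω = 0}

/-- The balance of momentum `dM/dt = [M, Ω] + ∂V/∂Γ ∧ Γ + ∑ᵢ cᵢ aⁱ`, `M = J(Ω)`, with
Lagrange multipliers `cᵢ`, along the curves `Ω` and `Γ`, for times in `T`. -/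
def MomentumEquation (I : Matrix (Fin n) (Fin n) ℝ) (U : (Fin n → ℝ) → ℝ)
    (a : κ → Matrix (Fin n) (Fin n) ℝ) (T : Set ℝ)
    (Ω : ℝ → Matrix (Fin n) (Fin n) ℝ) (Γ : ℝ → Fin n → ℝ) : Prop :=
  ∃ c : ℝ → κ → ℝ, ∀ t ∈ T,
    HasDerivAt (fun s => inertia I (Ω s))
      (⁅inertia I (Ω t), Ω t⁆ + wedge (grad U (Γ t)) (Γ t) + ∑ i, c t i • a i) t

/-- The phase space `ℳ = D{Ω} × Sⁿ⁻¹{Γ}`. -/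
def phaseSpace (a : κ → Matrix (Fin n) (Fin n) ℝ) :
    Set (Matrix (Fin n) (Fin n) ℝ × (Fin n → ℝ)) :=
  {x | x.1 ∈ admissible a ∧ x.2 ⬝ᵥ x.2 = 1}

/-- `x = (Ω, Γ)` is a solution, for times in `T`, of the Suslov problem on `ℳ`: the momentum
equation together with `dΓ/dt = -ΩΓ` and the constraints. -/
def IsSolution (I : Matrix (Fin n) (Fin n) ℝ) (U : (Fin n → ℝ) → ℝ)
    (a : κ → Matrix (Fin n) (Fin n) ℝ) (T : Set ℝ)
    (x : ℝ → Matrix (Fin n) (Fin n) ℝ × (Fin n → ℝ)) : Prop :=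
  (∀ t ∈ T, x t ∈ phaseSpace a) ∧
  MomentumEquation I U a T (fun t => (x t).1) (fun t => (x t).2) ∧
  ∀ t ∈ T, HasDerivAt (fun s => (x s).2) (-((x t).1 *ᵥ (x t).2)) t

/-- The whole phase space: the left-invariant distribution `𝒟 ⊆ TSO(n)`, in the left
trivialization, a tangent vector `gΩ` at `g` being written as the pair `(g, Ω)`. -/
def fullPhaseSpace (a : κ → Matrix (Fin n) (Fin n) ℝ) :
    Set (Matrix (Fin n) (Fin n) ℝ × Matrix (Fin n) (Fin n) ℝ) :=
  {x | x.1 ∈ Matrix.specialOrthogonalGroup (Fin n) ℝ ∧ x.2 ∈ admissible a}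

/-- `x = (g, Ω)` is a solution, for times in `T`, of the Suslov problem on `𝒟`: the momentum
equation, in which `Γ = g⁻¹Γ₀` is the body representation of the unit vector `Γ₀` fixed in
space, together with the kinematic equation `dg/dt = gΩ` and the constraints. -/
def IsFullSolution (I : Matrix (Fin n) (Fin n) ℝ) (U : (Fin n → ℝ) → ℝ)
    (a : κ → Matrix (Fin n) (Fin n) ℝ) (Γ₀ : Fin n → ℝ) (T : Set ℝ)
    (x : ℝ → Matrix (Fin n) (Fin n) ℝ × Matrix (Fin n) (Fin n) ℝ) : Prop :=
  (∀ t ∈ T, x t ∈ fullPhaseSpace a) ∧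
  MomentumEquation I U a T (fun t => (x t).2) (fun t => (x t).1ᵀ *ᵥ Γ₀) ∧
  ∀ t ∈ T, HasDerivAt (fun s => (x s).1) ((x t).1 * (x t).2) t

end General

/-! ## The multidimensional Lagrange case, `n = m + 1` -/

/-- The index set of the constraints: pairs `i < j ≤ n - 1` (`n` itself is `Fin.last m`). -/
abbrev ConstraintIndex (m : ℕ) : Type :=
  {q : Fin (m + 1) × Fin (m + 1) // q.1 < q.2 ∧ q.2 ≠ Fin.last m}

/-- The matrices `aⁱʲ = Eᵢⱼ - Eⱼᵢ`, `i < j ≤ n - 1`; the constraints `⟨aⁱʲ, Ω⟩ = 0` are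
`Ωᵢⱼ = 0`. -/
def constraint (m : ℕ) (q : ConstraintIndex m) : Matrix (Fin (m + 1)) (Fin (m + 1)) ℝ :=
  Matrix.single q.1.1 q.1.2 1 - Matrix.single q.1.2 q.1.1 1

/-- The mass tensor `diag(I₁, …, I₁, Iₙ)`. -/
def massTensor (m : ℕ) (I₁ Iₙ : ℝ) : Matrix (Fin (m + 1)) (Fin (m + 1)) ℝ :=
  Matrix.diagonal (fun i => if i = Fin.last m then Iₙ else I₁)

/-- The potential `V(Γ) = Bₙ Γₙ` of a homogeneous gravitational field, the centre of mass
lying on the axis of dynamical symmetry. -/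
def potential (m : ℕ) (Bₙ : ℝ) (Γ : Fin (m + 1) → ℝ) : ℝ := Bₙ * Γ (Fin.last m)

end Suslov

end

noncomputable section

namespace Suslov

open Set Filter Topology

/-! ## Ordinary differential equations and parametric integrals -/

/-! On `D` every `Ω` is `v ∧ eₙ` with `vₙ = 0`, and `J` acts there as multiplication by `I₁ + Iₙ`.
Hence `[M, Ω] = 0`; since the torque of the field also lies in `D`, the multipliers drop out. With
`b = Bₙ / (I₁ + Iₙ)`, `z = Γₙ` and `γ = Γ - z eₙ` the equations read `v' = -b γ`, `γ' = -z v`, `z' =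
v ⬝ Γ`. The span of `v` and `γ` is therefore constant, and everything happens in the
three-dimensional space spanned by `v`, `γ`, `eₙ`, as for a spherical pendulum.

There are two integrals: the energy `h = v² / 2 + b z` and the Gram determinant `P = v² (1 - z²) -
(v ⬝ Γ)²` of `v` and `γ`. They give `z'² = 2 (h - b z) (1 - z²) - P`. If `P > 0` and this cubic is
positive somewhere in `(-1, 1)`, it has exactly two roots `s ± a` there, both simple. Put `z = s - a
cos u`; then `u' = q > 0`, where `q²` is the remaining linear factor. With `p = √P` and an
orthonormal frame adapted to `γ`, `v`, `eₙ`, the frame turns about `eₙ` at the rate `p z / (1 -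
z²)`, while its nodal line turns in space about `Γ₀` at the rate `p / (1 - z²)`. As functions of `u`
these rates, divided by `q`, are `2π`-periodic, so each angle is a multiple of `u` plus a periodic
term. Subtracting the periodic term (`increment`) gives angles that are linear in `u`, and in the
time `dτ = q dt` the motion is linear on `𝕋²` (for `ℳ`) or `𝕋³` (for `𝒟`).

The angles are organized as free torus actions, `torusAction` and `fullTorusAction`; their algebra
is proved on explicit states (`IsState.flow` and its companions), the equations of motion in
`hasDerivAt_rotZ_levelDir`, `hasDerivAt_rotZ_levelVel` and `hasDerivAt_attitude`.
`isCompletelyIntegrable_of_action` turns such an action into the required foliation, the charts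
coming from slices (`exists_slice`) and the converse direction from uniqueness for differential
equations. Finally, the states left out have `Γ` vertical, or `v ⬝ Γ = 0`, or `v` parallel to `γ`;
in charts of the phase space these are null sets, by Fubini and `volume_irregular_eq_zero`. This is
where `n ≥ 3` enters: in a single horizontal dimension `v` is always parallel to `γ`. -/

theorem exists_Icc_subset_of_mem {J : Set ℝ} (hJ : IsOpen J) (hc : J.OrdConnected) {s t : ℝ}
    (hs : s ∈ J) (ht : t ∈ J) :
    ∃ a b, s ∈ Ioo a b ∧ t ∈ Ioo a b ∧ Icc a b ⊆ J := by
  obtain ⟨ε, hε, h1⟩ := Metric.isOpen_iff.1 hJ _ hs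
  obtain ⟨δ, hδ, h2⟩ := Metric.isOpen_iff.1 hJ _ ht
  rw [Real.ball_eq_Ioo] at h1 h2
  set η := min ε δ / 2 with hη
  have hη0 : 0 < η := by positivity
  have h3 : η < ε := by
    have := min_le_left ε δ
    have := lt_min hε hδ
    linarith
  have h4 : η < δ := by
    have := min_le_right ε δ
    have := lt_min hε hδ
    linarith
  have hmin : min s t - η ∈ J := by
    rcases min_choice s t with h | h <;> rw [h]
    · exact h1 ⟨by linarith, by linarith⟩
    · exact h2 ⟨by linarith, by linarith⟩
  have hmax : max s t + η ∈ J := by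
    rcases max_choice s t with h | h <;> rw [h]
    · exact h1 ⟨by linarith, by linarith⟩
    · exact h2 ⟨by linarith, by linarith⟩
  refine ⟨min s t - η, max s t + η, ⟨?_, ?_⟩, ⟨?_, ?_⟩, hc.out hmin hmax⟩
  · linarith [min_le_left s t]
  · linarith [le_max_left s t]
  · linarith [min_le_right s t]
  · linarith [le_max_right s t]

/-- Two solutions of `x' = X x` on an interval that agree at one time agree. -/
theorem eqOn_of_hasDerivAt_of_contDiff {E : Type*} [NormedAddCommGroup E] [NormedSpace ℝ E]
    [FiniteDimensional ℝ E] {X : E → E} (hX : ContDiff ℝ 1 X) {J : Set ℝ} (hJ : IsOpen J)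
    (hc : J.OrdConnected) {x y : ℝ → E} (hx : ∀ t ∈ J, HasDerivAt x (X (x t)) t)
    (hy : ∀ t ∈ J, HasDerivAt y (X (y t)) t) {t₀ : ℝ} (ht₀ : t₀ ∈ J) (h : x t₀ = y t₀) :
    EqOn x y J := by
  intro t ht
  obtain ⟨a, b, h0, h1, hab⟩ := exists_Icc_subset_of_mem hJ hc ht₀ ht
  have cx : ContinuousOn x (Icc a b) := fun s hs => (hx s (hab hs)).continuousAt.continuousWithinAt
  have cy : ContinuousOn y (Icc a b) := fun s hs => (hy s (hab hs)).continuousAt.continuousWithinAt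
  have := FiniteDimensional.proper ℝ E
  -- Both arcs are compact, so one ball contains them, and on a ball a `C¹` field is Lipschitz.
  obtain ⟨R, hR⟩ := ((isCompact_Icc.image_of_continuousOn cx).isBounded.union
    (isCompact_Icc.image_of_continuousOn cy).isBounded).subset_closedBall 0
  obtain ⟨K, hK⟩ := (hX.contDiffOn (s := Metric.closedBall (0 : E) R)).exists_lipschitzOnWith
    (by simp) (convex_closedBall 0 R) (isCompact_closedBall 0 R)
  exact ODE_solution_unique_of_mem_Ioo (v := fun _ => X) (s := fun _ => Metric.closedBall 0 R)
    (fun _ _ => hK) h0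
    (fun s hs => ⟨hx s (hab (Ioo_subset_Icc_self hs)),
      hR (Or.inl (mem_image_of_mem _ (Ioo_subset_Icc_self hs)))⟩)
    (fun s hs => ⟨hy s (hab (Ioo_subset_Icc_self hs)),
      hR (Or.inr (mem_image_of_mem _ (Ioo_subset_Icc_self hs)))⟩) h h1

/-- Global solutions of the scalar equation `τ' = 1 / Ψ(τ)`. -/
theorem exists_hasDerivAt_one_div {Ψ : ℝ → ℝ} (hΨ : Continuous Ψ) {c : ℝ} (hc : 0 < c)
    (h : ∀ x, c ≤ Ψ x) (t₀ : ℝ) :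
    ∃ τ : ℝ → ℝ, τ t₀ = 0 ∧ ∀ t, HasDerivAt τ (1 / Ψ (τ t)) t := by
  -- `T x` is the time at which the position `x` is reached. Since `T' = Ψ ≥ c > 0`, it is a
  -- bijection of the line, and its inverse is the solution.
  set T : ℝ → ℝ := fun x => t₀ + ∫ s in (0 : ℝ)..x, Ψ s with hT
  have hd : ∀ x, HasDerivAt T (Ψ x) x := fun x =>
    ((hΨ.integral_hasStrictDerivAt 0 x).hasDerivAt).const_add t₀
  have hmono : StrictMono T := strictMono_of_deriv_pos fun x => by
    rw [(hd x).deriv]; exact hc.trans_le (h x)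
  have hcont : Continuous T := continuous_iff_continuousAt.2 fun x => (hd x).continuousAt
  have hm2 : Monotone fun x => T x - c * x := by
    have hdiff : ∀ x, HasDerivAt (fun x => T x - c * x) (Ψ x - c) x := fun x => by
      simpa [Function.comp_def] using! (hd x).sub ((hasDerivAt_id x).const_mul c)
    refine monotone_of_deriv_nonneg (fun x => (hdiff x).differentiableAt) fun x => ?_
    rw [(hdiff x).deriv]; linarith [h x]
  have htop : Tendsto T atTop atTop := by
    refine tendsto_atTop_mono' _ (f₁ := fun x => c * x + T 0) ?_
      (tendsto_atTop_add_const_right _ _ (tendsto_id.const_mul_atTop hc))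
    filter_upwards [eventually_ge_atTop 0] with x hx
    have := hm2 hx
    simp only [mul_zero, sub_zero] at this
    linarith
  have hbot : Tendsto T atBot atBot := by
    refine tendsto_atBot_mono' _ (f₁ := fun x => c * x + T 0) ?_
      (tendsto_atBot_add_const_right _ _ (tendsto_id.const_mul_atBot hc))
    filter_upwards [eventually_le_atBot 0] with x hx
    have := hm2 hx
    simp only [mul_zero, sub_zero] at this
    linarith
  have hsurj : Function.Surjective T := hcont.surjective htop hbot
  let e := (hmono.orderIsoOfSurjective T hsurj).toHomeomorph
  have he : ∀ t, T (e.symm t) = t := fun t => e.apply_symm_apply t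
  refine ⟨e.symm, ?_, fun t => ?_⟩
  · have : e 0 = t₀ := by
      change T 0 = t₀
      simp [hT]
    rw [← this, e.symm_apply_apply]
  · rw [one_div]
    exact HasDerivAt.of_local_left_inverse e.symm.continuous.continuousAt (hd _)
      (hc.trans_le (h _)).ne' (Eventually.of_forall he)

/-- Integrals over `[0, 1]` depend smoothly on parameters (finite order). -/
theorem contDiffAt_integral_nat {W : Type} [NormedAddCommGroup W] [NormedSpace ℝ W] (n : ℕ) :
    ∀ {G : Type} [NormedAddCommGroup G] [NormedSpace ℝ G] {H : W × ℝ → G} {w₀ : W},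
      (∀ t ∈ Icc (0 : ℝ) 1, ContDiffAt ℝ (n + 1) H (w₀, t)) →
      ContDiffAt ℝ n (fun w => ∫ t in (0 : ℝ)..1, H (w, t)) w₀ := by
  -- Differentiation under the integral sign: compactness of `[0, 1]` yields one neighbourhood and
  -- one bound of the derivative valid for all `t`. One order of smoothness is spent, which is
  -- harmless for smooth integrands.
  have key : ∀ {G : Type} [NormedAddCommGroup G] [NormedSpace ℝ G] {H : W × ℝ → G} {w₀ : W}
      {n : ℕ}, (∀ t ∈ Icc (0 : ℝ) 1, ContDiffAt ℝ (n + 1) H (w₀, t)) →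
      ∃ u ∈ 𝓝 w₀, ∀ w ∈ u, (∀ t ∈ Icc (0 : ℝ) 1, ContDiffAt ℝ (n + 1) H (w, t)) ∧
        HasFDerivAt (fun w => ∫ t in (0 : ℝ)..1, H (w, t))
          (∫ t in (0 : ℝ)..1, (fderiv ℝ H (w, t)).comp (ContinuousLinearMap.inl ℝ W ℝ)) w := by
    intro G _ _ H w₀ n hH
    have h1 : ∀ t ∈ Icc (0 : ℝ) 1, ∀ᶠ p in 𝓝 (w₀, t), ContDiffAt ℝ (n + 1) H p ∧
        ‖fderiv ℝ H p‖ < ‖fderiv ℝ H (w₀, t)‖ + 1 := fun t ht => by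
      refine ((hH t ht).eventually (by exact_mod_cast WithTop.coe_ne_top)).and ?_
      have hc : ContinuousAt (fderiv ℝ H) (w₀, t) :=
        ((hH t ht).fderiv_right (m := n) le_rfl).continuousAt
      exact hc.norm.eventually (gt_mem_nhds (by linarith))
    -- uniform neighbourhood and bound
    have h2 : ∃ C : ℝ, ∀ᶠ w in 𝓝 w₀, ∀ t ∈ Icc (0 : ℝ) 1, ContDiffAt ℝ (n + 1) H (w, t) ∧
        ‖fderiv ℝ H (w, t)‖ ≤ C := by
      have hcont : ContinuousOn (fun t => fderiv ℝ H (w₀, t)) (Icc (0 : ℝ) 1) := fun t ht =>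
        (ContinuousAt.comp (f := fun t : ℝ => (w₀, t)) (g := fderiv ℝ H)
          ((hH t ht).fderiv_right (m := n) le_rfl).continuousAt
          (by fun_prop)).continuousWithinAt
      obtain ⟨C, hC⟩ := (isCompact_Icc.image_of_continuousOn hcont).isBounded.exists_norm_le
      refine ⟨C + 1, ?_⟩
      have := isCompact_Icc.eventually_forall_of_forall_eventually (x₀ := w₀)
        (K := Icc (0 : ℝ) 1)
        (P := fun w t => ContDiffAt ℝ (n + 1) H (w, t) ∧ ‖fderiv ℝ H (w, t)‖ ≤ C + 1)
        (fun t ht => by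
          filter_upwards [h1 t ht] with p hp
          refine ⟨hp.1, hp.2.le.trans ?_⟩
          have := hC _ (mem_image_of_mem _ ht)
          linarith)
      exact this
    obtain ⟨C, hC⟩ := h2
    obtain ⟨u, hu, huo, hwu⟩ := eventually_nhds_iff.1 hC
    refine ⟨u, huo.mem_nhds hwu, fun w hw => ⟨fun t ht => (hu w hw t ht).1, ?_⟩⟩
    have hcontH : ∀ w ∈ u, ContinuousOn (fun t => H (w, t)) (Icc (0 : ℝ) 1) := fun w hw t ht =>
      (ContinuousAt.comp (f := fun t : ℝ => (w, t)) (g := H) (hu w hw t ht).1.continuousAt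
          (by fun_prop)).continuousWithinAt
    have hcontH' : ContinuousOn (fun t => (fderiv ℝ H (w, t)).comp
        (ContinuousLinearMap.inl ℝ W ℝ)) (Icc (0 : ℝ) 1) := fun t ht => by
      have : ContinuousAt (fun t : ℝ => fderiv ℝ H (w, t)) t :=
        (ContinuousAt.comp (f := fun t : ℝ => (w, t)) (g := fderiv ℝ H)
          ((hu w hw t ht).1.fderiv_right (m := n) le_rfl).continuousAt (by fun_prop))
      exact (this.clm_comp continuousAt_const).continuousWithinAt
    have hI : uIoc (0 : ℝ) 1 ⊆ Icc 0 1 := by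
      rw [uIoc_of_le zero_le_one]; exact Ioc_subset_Icc_self
    have hIm : MeasurableSet (uIoc (0 : ℝ) 1) := measurableSet_uIoc
    refine intervalIntegral.hasFDerivAt_integral_of_dominated_of_fderiv_le
      (F := fun w t => H (w, t))
      (F' := fun w t => (fderiv ℝ H (w, t)).comp (ContinuousLinearMap.inl ℝ W ℝ))
      (bound := fun _ => C * ‖ContinuousLinearMap.inl ℝ W ℝ‖)
      (huo.mem_nhds hw) ?_ ?_ ?_ ?_ ?_ ?_
    · filter_upwards [huo.mem_nhds hw] with w' hw'
      exact ((hcontH w' hw').mono hI).aestronglyMeasurable hIm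
    · exact (hcontH w hw).intervalIntegrable_of_Icc zero_le_one
    · exact (hcontH'.mono hI).aestronglyMeasurable hIm
    · refine Eventually.of_forall fun t ht w' hw' => ?_
      refine (ContinuousLinearMap.opNorm_comp_le _ _).trans ?_
      exact mul_le_mul_of_nonneg_right (hu w' hw' t (hI ht)).2 (norm_nonneg _)
    · exact intervalIntegrable_const
    · refine Eventually.of_forall fun t ht w' hw' => ?_
      have hd := ((hu w' hw' t (hI ht)).1.differentiableAt (by simp)).hasFDerivAt
      exact hd.comp w' ((hasFDerivAt_id w').prodMk (hasFDerivAt_const t w'))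
  induction n with
  | zero =>
    intro G _ _ H w₀ hH
    obtain ⟨u, hu, h⟩ := key hH
    rw [Nat.cast_zero, contDiffAt_zero]
    exact ⟨u, hu, fun w hw => (h w hw).2.continuousAt.continuousWithinAt⟩
  | succ n ih =>
    intro G _ _ H w₀ hH
    obtain ⟨u, hu, h⟩ := key hH
    have : ((n + 1 : ℕ) : WithTop ℕ∞) = n + 1 := by push_cast; rfl
    rw [this, contDiffAt_succ_iff_hasFDerivAt]
    refine ⟨_, ⟨u, hu, fun w hw => (h w hw).2⟩, ?_⟩
    -- The derivative is again a parametric integral, now with values in `W →L[ℝ] G`; for this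
    -- reason the induction is uniform in the target space.
    refine ih (H := fun p => (fderiv ℝ H p).comp (ContinuousLinearMap.inl ℝ W ℝ)) fun t ht => ?_
    exact ((hH t ht).fderiv_right (m := n + 1) (by push_cast; rfl)).clm_comp contDiffAt_const

/-- Integrals over `[0, 1]` depend smoothly on parameters. -/
theorem contDiffAt_integral {W G : Type} [NormedAddCommGroup W] [NormedSpace ℝ W]
    [NormedAddCommGroup G] [NormedSpace ℝ G] {H : W × ℝ → G} {w₀ : W}
    (hH : ∀ t ∈ Icc (0 : ℝ) 1, ContDiffAt ℝ ∞ H (w₀, t)) :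
    ContDiffAt ℝ ∞ (fun w => ∫ t in (0 : ℝ)..1, H (w, t)) w₀ :=
  contDiffAt_infty.2 fun n => contDiffAt_integral_nat n fun t ht =>
    (hH t ht).of_le (by exact_mod_cast le_top)

/-- A simple zero of a smooth function of one variable depends smoothly on parameters. -/
theorem exists_contDiffAt_implicit {W : Type*} [NormedAddCommGroup W] [NormedSpace ℝ W]
    [CompleteSpace W] {f : W × ℝ → ℝ} {w₀ : W} {z₀ f' : ℝ} (hf : ContDiffAt ℝ ∞ f (w₀, z₀))
    (h0 : f (w₀, z₀) = 0) (hd : HasDerivAt (fun z => f (w₀, z)) f' z₀) (hf' : f' ≠ 0) :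
    ∃ ζ : W → ℝ, ContDiffAt ℝ ∞ ζ w₀ ∧ ζ w₀ = z₀ ∧ ∀ᶠ w in 𝓝 w₀, f (w, ζ w) = 0 := by
  have hfd := (hf.differentiableAt (by simp)).hasFDerivAt
  have hcomp := hfd.comp_hasDerivAt z₀ ((hasDerivAt_const z₀ w₀).prodMk (hasDerivAt_id z₀))
  have hval : fderiv ℝ f (w₀, z₀) (0, 1) = f' := hcomp.unique hd
  have hinv : (fderiv ℝ f (w₀, z₀) ∘L .inr ℝ W ℝ).IsInvertible := by
    refine ⟨ContinuousLinearEquiv.unitsEquivAut ℝ (Units.mk0 f' hf'), ?_⟩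
    ext
    simp [hval]
  refine ⟨hf.implicitFunction (by simp) hinv, hf.contDiffAt_implicitFunction (by simp) hinv,
    hf.implicitFunction_apply_self (by simp) hinv, ?_⟩
  filter_upwards [hf.eventually_apply_implicitFunction (by simp) hinv] with w hw
  rw [hw, h0]

/-! ## Free torus actions and their slices -/

section Slice

variable {E : Type*} [NormedAddCommGroup E] [NormedSpace ℝ E]
  {F : Type*} [NormedAddCommGroup F] [NormedSpace ℝ F]

/-- A smooth free action of the torus `(ℝ / 2πℤ)ᵏ` on a relatively open subset `Q` of `S`. -/
structure IsFreeTorusAction (S Q : Set E) {k : ℕ} (A : (Fin k → ℝ) → E → E) : Prop where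
  isOpen : ∃ O : Set E, IsOpen O ∧ Q = S ∩ O
  mapsTo : ∀ φ, ∀ x ∈ Q, A φ x ∈ Q
  zero : ∀ x ∈ Q, A 0 x = x
  add : ∀ φ ψ, ∀ x ∈ Q, A φ (A ψ x) = A (φ + ψ) x
  fixed_iff : ∀ φ, ∀ x ∈ Q, A φ x = x ↔ ∃ N : Fin k → ℤ, φ = fun i => 2 * Real.pi * (N i : ℝ)
  smooth : ∀ φ, ∀ x ∈ Q, ContDiffAt ℝ ∞ (fun p : (Fin k → ℝ) × E => A p.1 p.2) (φ, x)
  infinitesimal : ∀ x ∈ Q, ∀ ξ, HasDerivAt (fun t : ℝ => A (t • ξ) x) 0 0 → ξ = 0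

/-- `σ : U → S ∩ O` is a local parametrization of `S` with smooth inverse `τ`. -/
structure IsLocalParam (S : Set E) (σ : F → E) (τ : E → F) (U : Set F) (O : Set E) : Prop where
  isOpen_source : IsOpen U
  isOpen_target : IsOpen O
  contDiffAt : ∀ y ∈ U, ContDiffAt ℝ ∞ σ y
  contDiffAt_inv : ∀ x ∈ S ∩ O, ContDiffAt ℝ ∞ τ x
  mapsTo : ∀ y ∈ U, σ y ∈ S ∩ O
  mapsTo_inv : ∀ x ∈ S ∩ O, τ x ∈ U
  left_inv : ∀ y ∈ U, τ (σ y) = y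
  right_inv : ∀ x ∈ S ∩ O, σ (τ x) = x

/-- The fundamental domain `[-π, π]ᵏ` of the period lattice. -/
def periodBox (k : ℕ) : Set (Fin k → ℝ) := Icc (fun _ => -Real.pi) (fun _ => Real.pi)

theorem exists_shift_mem_periodBox {k : ℕ} (φ : Fin k → ℝ) :
    ∃ N : Fin k → ℤ, shift φ N ∈ periodBox k := by
  have hpi := Real.pi_pos
  refine ⟨fun i => -round (φ i / (2 * Real.pi)), ?_, ?_⟩ <;> intro i <;>
    have h := abs_le.1 (abs_sub_round (φ i / (2 * Real.pi))) <;>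
    have h2 : φ i / (2 * Real.pi) * (2 * Real.pi) = φ i := by field_simp
  · have := mul_le_mul_of_nonneg_right h.1 (by positivity : 0 ≤ 2 * Real.pi)
    simp only [shift]; push_cast; nlinarith
  · have := mul_le_mul_of_nonneg_right h.2 (by positivity : 0 ≤ 2 * Real.pi)
    simp only [shift]; push_cast; nlinarith

/-- The closed box contains opposite faces and so represents some classes more than once, but `0` is
its only lattice point, since `|2πN| ≤ π` forces `N = 0`. -/
theorem eq_zero_of_mem_periodBox {k : ℕ} {φ : Fin k → ℝ} (h : φ ∈ periodBox k) (N : Fin k → ℤ)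
    (hN : φ = fun i => 2 * Real.pi * (N i : ℝ)) : φ = 0 := by
  have hpi := Real.pi_pos
  have : ∀ i, N i = 0 := fun i => by
    have h1 := h.1 i
    have h2 := h.2 i
    rw [hN] at h1 h2
    simp only at h1 h2
    have h3 : (-1 : ℝ) < N i := by nlinarith
    have h4 : (N i : ℝ) < 1 := by nlinarith
    have h3' : -1 < N i := by exact_mod_cast h3
    have h4' : N i < 1 := by exact_mod_cast h4
    omega
  rw [hN]; ext i; simp [this i]

theorem shift_eq {k : ℕ} (φ : Fin k → ℝ) (N : Fin k → ℤ) :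
    shift φ N = (fun i => 2 * Real.pi * (N i : ℝ)) + φ := by
  ext i; simp [shift, add_comm]

namespace IsFreeTorusAction

variable {S Q : Set E} {k : ℕ} {A : (Fin k → ℝ) → E → E}

theorem shift (hA : IsFreeTorusAction S Q A) {x : E} (hx : x ∈ Q) (φ : Fin k → ℝ)
    (N : Fin k → ℤ) : A (shift φ N) x = A φ x := by
  rw [shift_eq, ← hA.add _ _ x hx, (hA.fixed_iff _ _ (hA.mapsTo φ x hx)).2 ⟨N, rfl⟩]

theorem subset (hA : IsFreeTorusAction S Q A) : Q ⊆ S := by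
  obtain ⟨O, -, rfl⟩ := hA.isOpen
  exact inter_subset_left

theorem neg_apply (hA : IsFreeTorusAction S Q A) {x : E} (hx : x ∈ Q) (φ : Fin k → ℝ) :
    A (-φ) (A φ x) = x := by
  rw [hA.add _ _ x hx, neg_add_cancel, hA.zero x hx]

theorem apply_neg (hA : IsFreeTorusAction S Q A) {x : E} (hx : x ∈ Q) (φ : Fin k → ℝ) :
    A φ (A (-φ) x) = x := by
  rw [hA.add _ _ x hx, add_neg_cancel, hA.zero x hx]

theorem smooth_right (hA : IsFreeTorusAction S Q A) {x : E} (hx : x ∈ Q) (φ : Fin k → ℝ) :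
    ContDiffAt ℝ ∞ (A φ) x :=
  (hA.smooth φ x hx).comp x (f := fun y : E => (φ, y)) (by fun_prop)

theorem smooth_left (hA : IsFreeTorusAction S Q A) {x : E} (hx : x ∈ Q) (φ : Fin k → ℝ) :
    ContDiffAt ℝ ∞ (fun ψ => A ψ x) φ :=
  (hA.smooth φ x hx).comp φ (f := fun ψ : Fin k → ℝ => (ψ, x)) (by fun_prop)

/-- The orbit map, read in a parametrization, is an immersion. -/
theorem injective_fderiv_orbit (hA : IsFreeTorusAction S Q A) {σ : F → E} {τ : E → F}
    {U : Set F} {O : Set E} (hp : IsLocalParam S σ τ U O) {x : E} (hx : x ∈ Q) (hxO : x ∈ O) :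
    Function.Injective (fderiv ℝ (fun φ => τ (A φ x)) 0) := by
  have hSO : x ∈ S ∩ O := ⟨hA.subset hx, hxO⟩
  have hτ : ContDiffAt ℝ ∞ τ (A 0 x) := by rw [hA.zero x hx]; exact hp.contDiffAt_inv x hSO
  have hd : ContDiffAt ℝ ∞ (fun φ => τ (A φ x)) 0 := hτ.comp 0 (hA.smooth_left hx 0)
  refine (injective_iff_map_eq_zero _).2 fun ξ hξ => hA.infinitesimal x hx ξ ?_
  have hline : HasDerivAt (fun t : ℝ => t • ξ) ξ 0 := by
    simpa using (hasDerivAt_id (0 : ℝ)).smul_const ξ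
  have h1 : HasDerivAt (fun t : ℝ => τ (A (t • ξ) x)) 0 0 := by
    have h := (hd.differentiableAt (by simp)).hasFDerivAt
    rw [← zero_smul ℝ ξ] at h
    have := h.comp_hasDerivAt (0 : ℝ) hline
    simpa [Function.comp_def, hξ] using this
  have h2 : HasDerivAt (fun t : ℝ => σ (τ (A (t • ξ) x))) 0 0 := by
    have h3 : ContDiffAt ℝ ∞ σ (τ (A ((0 : ℝ) • ξ) x)) := by
      rw [zero_smul, hA.zero x hx]
      exact hp.contDiffAt _ (hp.mapsTo_inv x hSO)
    have := (h3.differentiableAt (by simp)).hasFDerivAt.comp_hasDerivAt (0 : ℝ) h1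
    simpa [Function.comp_def] using this
  refine h2.congr_of_eventuallyEq ?_
  have hc : ContinuousAt (fun t : ℝ => A (t • ξ) x) 0 := by
    have : ContinuousAt (fun φ => A φ x) ((0 : ℝ) • ξ) := (hA.smooth_left hx _).continuousAt
    exact ContinuousAt.comp (f := fun t : ℝ => t • ξ) (g := fun φ => A φ x) this (by fun_prop)
  have : ∀ᶠ t : ℝ in 𝓝 0, A (t • ξ) x ∈ O :=
    hc (hp.isOpen_target.mem_nhds (by simpa [hA.zero x hx] using hxO))
  filter_upwards [this] with t ht
  rw [hp.right_inv _ ⟨hA.subset (hA.mapsTo _ x hx), ht⟩]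

/-- Slices of a free torus action. -/
theorem exists_slice [FiniteDimensional ℝ F] (hA : IsFreeTorusAction S Q A) {σ : F → E}
    {τ : E → F} {U : Set F} {O : Set E} (hp : IsLocalParam S σ τ U O) {x : E} (hx : x ∈ Q)
    (hxO : x ∈ O) {l : ℕ} (hkl : k + l = Module.finrank ℝ F) :
    ∃ (V : Set (Fin l → ℝ)) (s : (Fin l → ℝ) → E), IsOpen V ∧ 0 ∈ V ∧ s 0 = x ∧
      (∀ v ∈ V, s v ∈ Q) ∧ (∀ v ∈ V, ContDiffAt ℝ ∞ s v) ∧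
      (∀ φ ψ : Fin k → ℝ, ∀ v ∈ V, ∀ w ∈ V, A φ (s v) = A ψ (s w) → v = w) ∧
      (∀ φ : Fin k → ℝ, ∀ v ∈ V, Function.Injective
        (fderiv ℝ (fun p : (Fin k → ℝ) × (Fin l → ℝ) => A p.1 (s p.2)) (φ, v))) ∧
      ∃ O' : Set E, IsOpen O' ∧
        (fun p : (Fin k → ℝ) × (Fin l → ℝ) => A p.1 (s p.2)) '' (univ ×ˢ V) = S ∩ O' := by
  have hSO : x ∈ S ∩ O := ⟨hA.subset hx, hxO⟩
  obtain ⟨OQ, hOQ, hQ⟩ := hA.isOpen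
  set K₀ := fderiv ℝ (fun φ => τ (A φ x)) 0 with hK₀
  have hK₀i : Function.Injective K₀ := hA.injective_fderiv_orbit hp hx hxO
  -- a complement of the tangent space of the orbit
  obtain ⟨C, hC⟩ := Submodule.exists_isCompl (LinearMap.range (K₀ : (Fin k → ℝ) →ₗ[ℝ] F))
  have hCdim : Module.finrank ℝ C = l := by
    have h1 := Submodule.finrank_add_eq_of_isCompl hC
    have h2 := LinearMap.finrank_range_of_inj
      (f := (K₀ : (Fin k → ℝ) →ₗ[ℝ] F)) hK₀i
    rw [h2] at h1
    simp at h1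
    omega
  let eC : (Fin l → ℝ) ≃ₗ[ℝ] C := LinearEquiv.ofFinrankEq _ _ (by simp [hCdim])
  let L : (Fin l → ℝ) →L[ℝ] F := LinearMap.toContinuousLinearMap (C.subtype ∘ₗ eC.toLinearMap)
  have hLC : ∀ η, L η ∈ C := fun η => (eC η).2
  have hLi : Function.Injective L := fun η η' h => eC.injective (Subtype.ext h)
  -- In the chart the slice is an affine piece through `x`, transverse to the orbit.
  set s : (Fin l → ℝ) → E := fun w => σ (τ x + L w) with hs
  have hs0 : s 0 = x := by simp [hs, hp.right_inv x hSO]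
  set y₀ := τ x with hy₀
  -- the open set where the slice is defined
  have hW : IsOpen {w : Fin l → ℝ | y₀ + L w ∈ U ∧ s w ∈ OQ} := by
    have hcont : ContinuousOn σ U := fun y hy => (hp.contDiffAt y hy).continuousAt.continuousWithinAt
    have := hcont.isOpen_inter_preimage hp.isOpen_source hOQ
    exact this.preimage (f := fun w => y₀ + L w) (by fun_prop)
  set W := {w : Fin l → ℝ | y₀ + L w ∈ U ∧ s w ∈ OQ} with hWdef
  have hW0 : (0 : Fin l → ℝ) ∈ W := by
    have h1 : x ∈ OQ := by rw [hQ] at hx; exact hx.2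
    refine ⟨?_, by rw [hs0]; exact h1⟩
    simpa using hp.mapsTo_inv x hSO
  have hsQ : ∀ w ∈ W, s w ∈ Q := fun w hw => by
    rw [hQ]; exact ⟨(hp.mapsTo _ hw.1).1, hw.2⟩
  have hss : ∀ w ∈ W, ContDiffAt ℝ ∞ s w := fun w hw =>
    (hp.contDiffAt _ hw.1).comp w (f := fun w => y₀ + L w) (by fun_prop)
  set ι : (Fin k → ℝ) × (Fin l → ℝ) → E := fun p => A p.1 (s p.2) with hι
  have hιs : ∀ φ, ∀ w ∈ W, ContDiffAt ℝ ∞ ι (φ, w) := fun φ w hw =>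
    (hA.smooth φ (s w) (hsQ w hw)).comp (φ, w)
      (f := fun p : (Fin k → ℝ) × (Fin l → ℝ) => (p.1, s p.2))
      (contDiffAt_fst.prodMk (ContDiffAt.comp (f := Prod.snd) (g := s) (φ, w)
        (hss w hw) contDiffAt_snd))
  have hι0 : ∀ w ∈ W, ι (0, w) = s w := fun w hw => hA.zero _ (hsQ w hw)
  -- The orbits of the slice read in the chart. At the origin the derivative is `K₀` on the angles
  -- and `L` on the slice, with complementary ranges, hence invertible.
  set κ : (Fin k → ℝ) × (Fin l → ℝ) → F := fun p => τ (ι p) with hκ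
  have hκs : ContDiffAt ℝ ∞ κ (0, 0) :=
    ContDiffAt.comp (g := τ) (0, 0) (by rw [hι0 0 hW0, hs0]; exact hp.contDiffAt_inv x hSO)
      (hιs 0 0 hW0)
  have hκd := (hκs.differentiableAt (by simp)).hasFDerivAt
  have hκ1 : ∀ ξ, fderiv ℝ κ (0, 0) (ξ, 0) = K₀ ξ := fun ξ => by
    have h1 := HasFDerivAt.comp (f := fun φ : Fin k → ℝ => (φ, (0 : Fin l → ℝ))) (g := κ)
      (0 : Fin k → ℝ) hκd ((hasFDerivAt_id _).prodMk (hasFDerivAt_const _ _))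
    have h2 : (κ ∘ fun φ : Fin k → ℝ => (φ, (0 : Fin l → ℝ))) = fun φ => τ (A φ x) := by
      ext1 φ; simp [hκ, hι, hs0]
    rw [h2] at h1
    have := congrArg (fun T => T ξ) h1.fderiv
    simpa [hK₀] using this.symm
  have hκ2 : ∀ η, fderiv ℝ κ (0, 0) (0, η) = L η := fun η => by
    have h1 := HasFDerivAt.comp (f := fun w : Fin l → ℝ => ((0 : Fin k → ℝ), w)) (g := κ)
      (0 : Fin l → ℝ) hκd ((hasFDerivAt_const _ _).prodMk (hasFDerivAt_id _))
    have h2 : (κ ∘ fun w : Fin l → ℝ => ((0 : Fin k → ℝ), w)) =ᶠ[𝓝 0] fun w => y₀ + L w := by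
      filter_upwards [hW.mem_nhds hW0] with w hw
      simp only [Function.comp, hκ]
      rw [hι0 w hw, hs]
      exact hp.left_inv _ hw.1
    have h3 : HasFDerivAt (fun w => y₀ + L w) L 0 := L.hasFDerivAt.const_add y₀
    have := congrArg (fun T => T η) (h1.unique (h3.congr_of_eventuallyEq h2))
    simpa using this
  have hκi : Function.Injective (fderiv ℝ κ (0, 0)) := by
    refine (injective_iff_map_eq_zero _).2 fun p hp0 => ?_
    obtain ⟨ξ, η⟩ := p
    have h1 : ((ξ, η) : (Fin k → ℝ) × (Fin l → ℝ)) = (ξ, 0) + (0, η) := by simp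
    rw [h1, map_add, hκ1, hκ2] at hp0
    have h2 : K₀ ξ = L (-η) := by rw [map_neg]; exact eq_neg_of_add_eq_zero_left hp0
    have h3 : K₀ ξ ∈ LinearMap.range (K₀ : (Fin k → ℝ) →ₗ[ℝ] F) ⊓ C :=
      ⟨⟨ξ, rfl⟩, by rw [h2]; exact hLC _⟩
    rw [hC.inf_eq_bot, Submodule.mem_bot] at h3
    have h4 : ξ = 0 := hK₀i (by rw [h3, map_zero])
    rw [h3] at h2
    have h5 : -η = 0 := hLi (by rw [← h2, map_zero])
    simp [h4, neg_eq_zero.1 h5]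
  have hdim : Module.finrank ℝ ((Fin k → ℝ) × (Fin l → ℝ)) = Module.finrank ℝ F := by
    rw [Module.finrank_prod]; simp [hkl]
  let eκ : ((Fin k → ℝ) × (Fin l → ℝ)) ≃L[ℝ] F :=
    (LinearEquiv.ofInjectiveOfFinrankEq
      (fderiv ℝ κ (0, 0) : ((Fin k → ℝ) × (Fin l → ℝ)) →ₗ[ℝ] F) hκi hdim).toContinuousLinearEquiv
  have heκ : (eκ : ((Fin k → ℝ) × (Fin l → ℝ)) →L[ℝ] F) = fderiv ℝ κ (0, 0) := by
    ext p <;> rfl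
  have hκd' : HasFDerivAt κ (eκ : ((Fin k → ℝ) × (Fin l → ℝ)) →L[ℝ] F) (0, 0) := by
    rw [heκ]; exact hκd
  let e := hκs.toOpenPartialHomeomorph κ hκd' (by simp)
  have hecoe : ∀ p, e p = κ p := fun _ => rfl
  have he0 : ((0, 0) : (Fin k → ℝ) × (Fin l → ℝ)) ∈ e.source :=
    hκs.mem_toOpenPartialHomeomorph_source hκd' (by simp)
  have hev : ∀ᶠ p in 𝓝 ((0, 0) : (Fin k → ℝ) × (Fin l → ℝ)), p ∈ e.source ∧
      Function.Injective (fderiv ℝ κ p) ∧ p.2 ∈ W ∧ ι p ∈ O := by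
    refine Eventually.and (e.open_source.mem_nhds he0) (.and ?_ (.and ?_ ?_))
    · have hc : ContinuousAt (fderiv ℝ κ) (0, 0) :=
        (hκs.fderiv_right (m := 0) (by simp)).continuousAt
      have hn : range ((↑) : (((Fin k → ℝ) × (Fin l → ℝ)) ≃L[ℝ] F) → _) ∈
          𝓝 (fderiv ℝ κ (0, 0)) := by
        rw [← heκ]; exact eκ.nhds
      filter_upwards [hc hn] with p hp
      obtain ⟨T, hT⟩ := hp
      rw [← hT]; exact T.injective
    · exact continuousAt_snd (hW.mem_nhds hW0)
    · have : ι (0, 0) ∈ O := by rw [hι0 0 hW0, hs0]; exact hxO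
      exact (hιs 0 0 hW0).continuousAt (hp.isOpen_target.mem_nhds this)
  obtain ⟨B₁, B₂, hB₁, h0B₁, hB₂, h0B₂, hB⟩ := mem_nhds_prod_iff'.1 hev
  -- the return times to the slice are periods
  have hbox : ∀ᶠ q in 𝓝 ((0, 0) : (Fin l → ℝ) × (Fin l → ℝ)), ∀ φ ∈ periodBox k \ B₁,
      A φ (s q.1) ≠ s q.2 := by
    have hcpt : IsCompact (periodBox k \ B₁) := (isCompact_Icc).diff hB₁
    refine hcpt.eventually_forall_of_forall_eventually (x₀ := ((0, 0) : (Fin l → ℝ) × (Fin l → ℝ)))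
      (P := fun q φ => A φ (s q.1) ≠ s q.2) fun φ hφ => ?_
    have hne : A φ (s 0) ≠ s 0 := fun h => by
      rw [hs0] at h
      obtain ⟨N, hN⟩ := (hA.fixed_iff φ x hx).1 h
      exact hφ.2 (by rw [eq_zero_of_mem_periodBox hφ.1 N hN]; exact h0B₁)
    have c1 : ContinuousAt (fun r : ((Fin l → ℝ) × (Fin l → ℝ)) × (Fin k → ℝ) => A r.2 (s r.1.1))
        ((0, 0), φ) :=
      ContinuousAt.comp (f := fun r : ((Fin l → ℝ) × (Fin l → ℝ)) × (Fin k → ℝ) => (r.2, r.1.1))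
        (g := ι) (hιs φ 0 hW0).continuousAt (by fun_prop)
    have c2 : ContinuousAt (fun r : ((Fin l → ℝ) × (Fin l → ℝ)) × (Fin k → ℝ) => s r.1.2)
        ((0, 0), φ) :=
      ContinuousAt.comp (f := fun r : ((Fin l → ℝ) × (Fin l → ℝ)) × (Fin k → ℝ) => r.1.2)
        (g := s) (hss 0 hW0).continuousAt (by fun_prop)
    exact (c1.ne_iff_eventually_ne c2).1 hne
  obtain ⟨V₁, V₂, hV₁, h0V₁, hV₂, h0V₂, hV⟩ := mem_nhds_prod_iff'.1 hbox
  -- After reduction modulo periods, a passage from one point of the slice over `V` to another takes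
  -- an angle in `B₁`, where `κ` is injective; so an orbit meets this slice only once.
  set V := B₂ ∩ (V₁ ∩ V₂) with hVdef
  have hVo : IsOpen V := hB₂.inter (hV₁.inter hV₂)
  have hVW : ∀ v ∈ V, v ∈ W := fun v hv => (hB (mk_mem_prod h0B₁ hv.1)).2.2.1
  have hVQ : ∀ v ∈ V, s v ∈ Q := fun v hv => hsQ v (hVW v hv)
  refine ⟨V, s, hVo, ⟨h0B₂, h0V₁, h0V₂⟩, hs0, hVQ, fun v hv => hss v (hVW v hv), ?_, ?_, ?_⟩
  · intro φ ψ v hv w hw h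
    obtain ⟨N, hN⟩ := exists_shift_mem_periodBox (φ - ψ)
    have h1 : A (Suslov.shift (φ - ψ) N) (s v) = s w := by
      rw [hA.shift (hVQ v hv), sub_eq_neg_add, ← hA.add _ _ _ (hVQ v hv), h,
        hA.neg_apply (hVQ w hw)]
    by_cases hB' : Suslov.shift (φ - ψ) N ∈ B₁
    · have h2 : κ (Suslov.shift (φ - ψ) N, v) = κ (0, w) := by
        simp only [hκ]
        rw [hι0 w (hVW w hw), ← h1]
      have h3 := e.injOn (hB (mk_mem_prod hB' hv.1)).1 (hB (mk_mem_prod h0B₁ hw.1)).1 h2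
      exact (Prod.ext_iff.1 h3).2
    · exact absurd h1 (hV (mk_mem_prod hv.2.1 hw.2.2) _ ⟨hN, hB'⟩)
  · intro φ v hv
    refine (injective_iff_map_eq_zero _).2 fun ζ hζ => ?_
    have h0v := hB (mk_mem_prod h0B₁ hv.1)
    refine (injective_iff_map_eq_zero _).1 h0v.2.1 ζ ?_
    have hsv : s v ∈ S ∩ O := by
      have := h0v.2.2.2
      rw [hι0 v (hVW v hv)] at this
      exact ⟨hA.subset (hVQ v hv), this⟩
    -- Composition with `A (-φ)` moves the point `(φ, v)` to `(0, v)`, where the derivative of `κ`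
    -- is already known to be injective.
    have hg : ContDiffAt ℝ ∞ (fun y => τ (A (-φ) y)) (ι (φ, v)) := by
      refine ContDiffAt.comp (g := τ) _ ?_ (hA.smooth_right (hA.mapsTo φ _ (hVQ v hv)) (-φ))
      rw [hA.neg_apply (hVQ v hv)]
      exact hp.contDiffAt_inv _ hsv
    have hsh : HasFDerivAt (fun q : (Fin k → ℝ) × (Fin l → ℝ) => q + (φ, 0))
        (ContinuousLinearMap.id ℝ _) (0, v) := (hasFDerivAt_id _).add_const _
    have hpt : ((0, v) : (Fin k → ℝ) × (Fin l → ℝ)) + (φ, 0) = (φ, v) := by simp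
    have d1 := ((hιs φ v (hVW v hv)).differentiableAt (by simp)).hasFDerivAt
    have d2 := (hg.differentiableAt (by simp)).hasFDerivAt
    have d3 := d2.comp (φ, v) d1
    rw [← hpt] at d3
    have d4 := d3.comp (0, v) hsh
    have heq : κ =ᶠ[𝓝 (0, v)] (((fun y => τ (A (-φ) y)) ∘ ι) ∘
        fun q : (Fin k → ℝ) × (Fin l → ℝ) => q + (φ, 0)) := by
      have : ∀ᶠ q in 𝓝 ((0, v) : (Fin k → ℝ) × (Fin l → ℝ)), q.2 ∈ W :=
        continuousAt_snd (hW.mem_nhds (hVW v hv))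
      filter_upwards [this] with q hq
      simp only [Function.comp, hκ, hι, Prod.fst_add, Prod.snd_add, add_zero]
      rw [hA.add _ _ _ (hsQ _ hq), neg_add_cancel_comm_assoc]
    rw [(d4.congr_of_eventuallyEq heq).fderiv]
    simp only [ContinuousLinearMap.comp_id, ContinuousLinearMap.comp_apply]
    rw [hpt]
    rw [hζ, map_zero]
  · have himg : ∀ y ∈ ι '' (univ ×ˢ V), ∃ Oy, IsOpen Oy ∧ y ∈ Oy ∧ S ∩ Oy ⊆ ι '' (univ ×ˢ V) := by
      rintro _ ⟨⟨φ, v⟩, ⟨-, hv⟩, rfl⟩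
      have hv : v ∈ V := hv
      have hyQ : ι (φ, v) ∈ Q := hA.mapsTo φ _ (hVQ v hv)
      have h0v := hB (mk_mem_prod h0B₁ hv.1)
      have hback : A (-φ) (ι (φ, v)) = s v := hA.neg_apply (hVQ v hv) φ
      have hsv : s v ∈ S ∩ O := by
        have := h0v.2.2.2
        rw [hι0 v (hVW v hv)] at this
        exact ⟨hA.subset (hVQ v hv), this⟩
      have c1 : ContinuousAt (A (-φ)) (ι (φ, v)) := (hA.smooth_right hyQ (-φ)).continuousAt
      have c2 : ContinuousAt (fun y => τ (A (-φ) y)) (ι (φ, v)) := by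
        refine ContinuousAt.comp (g := τ) ?_ c1
        rw [hback]
        exact (hp.contDiffAt_inv _ hsv).continuousAt
      have hopen : IsOpen (e '' (B₁ ×ˢ V)) :=
        e.isOpen_image_of_subset_source (hB₁.prod hVo) fun q hq =>
          (hB (mk_mem_prod hq.1 hq.2.1)).1
      have e1 : ∀ᶠ y in 𝓝 (ι (φ, v)), A (-φ) y ∈ O :=
        c1 (hp.isOpen_target.mem_nhds (by rw [hback]; exact hsv.2))
      have e2 : ∀ᶠ y in 𝓝 (ι (φ, v)), τ (A (-φ) y) ∈ e '' (B₁ ×ˢ V) := by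
        refine c2 (hopen.mem_nhds ⟨(0, v), ⟨h0B₁, hv⟩, ?_⟩)
        rw [hecoe]
        simp only [hκ]
        rw [hback, hι0 v (hVW v hv)]
      have e3 : ∀ᶠ y in 𝓝 (ι (φ, v)), y ∈ OQ :=
        hOQ.mem_nhds (by rw [hQ] at hyQ; exact hyQ.2)
      obtain ⟨Oy, hOy, hOyo, hyO⟩ := eventually_nhds_iff.1 (e1.and (e2.and e3))
      refine ⟨Oy, hOyo, hyO, fun y hy => ?_⟩
      obtain ⟨f1, ⟨⟨ξ, w⟩, ⟨hξ, hw⟩, f2⟩, f3⟩ := hOy y hy.2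
      have hyQ' : y ∈ Q := by rw [hQ]; exact ⟨hy.1, f3⟩
      have hw : w ∈ V := hw
      have g1 : A (-φ) y ∈ S ∩ O := ⟨hA.subset (hA.mapsTo _ _ hyQ'), f1⟩
      have g2 : ι (ξ, w) ∈ S ∩ O :=
        ⟨hA.subset (hA.mapsTo _ _ (hVQ w hw)), (hB (mk_mem_prod hξ hw.1)).2.2.2⟩
      have g3 : ι (ξ, w) = A (-φ) y := by
        rw [← hp.right_inv _ g1, ← f2, hecoe, hκ]
        exact (hp.right_inv _ g2).symm
      refine ⟨(φ + ξ, w), ⟨mem_univ _, hw⟩, ?_⟩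
      change A (φ + ξ) (s w) = y
      rw [← hA.add _ _ _ (hVQ w hw)]
      change A φ (ι (ξ, w)) = y
      rw [g3, hA.apply_neg hyQ']
    choose! Oy h1 h2 h3 using himg
    refine ⟨⋃ y ∈ ι '' (univ ×ˢ V), Oy y, isOpen_biUnion fun y hy => h1 y hy, ?_⟩
    refine Subset.antisymm (fun y hy => ⟨?_, mem_biUnion hy (h2 y hy)⟩) ?_
    · obtain ⟨⟨φ, v⟩, ⟨-, hv⟩, rfl⟩ := hy
      exact hA.subset (hA.mapsTo _ _ (hVQ v hv))
    · rintro y ⟨hyS, hyO⟩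
      obtain ⟨y', hy', hy''⟩ := mem_iUnion₂.1 hyO
      exact h3 y' hy' ⟨hyS, hy''⟩

end IsFreeTorusAction

end Slice

/-! ## Complete integrability of systems with a free torus action -/

/-- On `Fin d → ℝ` the Hausdorff measure of the sup norm is Lebesgue measure. A linear isomorphism
onto it carries Haar measures to Haar measures, and its inverse is Lipschitz. -/
theorem hausdorffMeasure_eq_zero_of_addHaar {F : Type*} [NormedAddCommGroup F] [NormedSpace ℝ F]
    [FiniteDimensional ℝ F] [MeasurableSpace F] [BorelSpace F] (μ : Measure F)
    [μ.IsAddHaarMeasure] {d : ℕ} (hF : Module.finrank ℝ F = d) {N : Set F} (hN : μ N = 0) :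
    Measure.hausdorffMeasure (d : ℝ) N = 0 := by
  let e : F ≃L[ℝ] (Fin d → ℝ) := ContinuousLinearEquiv.ofFinrankEq (by simp [hF])
  have h1 : (μ.map e) (e '' N) = 0 := by
    have := e.toHomeomorph.toMeasurableEquiv.map_apply (μ := μ) (e '' N)
    change (μ.map e) (e '' N) = μ (e ⁻¹' (e '' N)) at this
    rw [this, e.injective.preimage_image, hN]
  have : (μ.map e).IsAddHaarMeasure := e.isAddHaarMeasure_map μ
  have h2 : (volume : Measure (Fin d → ℝ)) (e '' N) = 0 :=
    Measure.absolutelyContinuous_isAddHaarMeasure volume (μ.map e) h1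
  rw [← hausdorffMeasure_pi_real, Fintype.card_fin] at h2
  have h3 := (e.symm.lipschitz.hausdorffMeasure_image_le (d := (d : ℝ)) (by positivity) (e '' N))
  rw [h2, mul_zero, ← image_comp] at h3
  simpa using h3

/-- A `C¹` map is locally Lipschitz, Lipschitz maps preserve null sets of Hausdorff measure, and
countably many Lipschitz pieces cover `N`. -/
theorem hausdorffMeasure_image_eq_zero {E F : Type*} [NormedAddCommGroup E] [NormedSpace ℝ E]
    [MeasurableSpace E] [BorelSpace E] [NormedAddCommGroup F] [NormedSpace ℝ F]
    [FiniteDimensional ℝ F] [MeasurableSpace F] [BorelSpace F] {d : ℕ} {σ : F → E} {N : Set F}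
    (hσ : ∀ y ∈ N, ContDiffAt ℝ 1 σ y) (hN : Measure.hausdorffMeasure (d : ℝ) N = 0) :
    Measure.hausdorffMeasure (d : ℝ) (σ '' N) = 0 := by
  have hloc : ∀ y ∈ N, ∃ u ∈ 𝓝[N] y, ∃ K, LipschitzOnWith K σ u := fun y hy => by
    obtain ⟨K, u, hu, hK⟩ := (hσ y hy).exists_lipschitzOnWith
    exact ⟨u, mem_nhdsWithin_of_mem_nhds hu, K, hK⟩
  choose! u hu hK using hloc
  have := FiniteDimensional.proper ℝ F
  have : SecondCountableTopology F := inferInstance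
  obtain ⟨t, htN, htc, ht⟩ := TopologicalSpace.countable_cover_nhdsWithin hu
  have hsub : σ '' N ⊆ ⋃ y ∈ t, σ '' (N ∩ u y) := by
    rintro _ ⟨y, hy, rfl⟩
    obtain ⟨z, hz, hyz⟩ := mem_iUnion₂.1 (ht hy)
    exact mem_biUnion hz ⟨y, ⟨hy, hyz⟩, rfl⟩
  refine measure_mono_null hsub ((measure_biUnion_null_iff htc).2 fun y hy => ?_)
  obtain ⟨K, hK⟩ := hK y (htN hy)
  have h1 := (hK.mono (inter_subset_right (s := N))).hausdorffMeasure_image_le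
    (d := (d : ℝ)) (by positivity)
  rw [measure_mono_null inter_subset_left hN, mul_zero] at h1
  exact le_antisymm h1 bot_le

/-- Being null is a local property, so the surface measure can be tested by Haar measure in
parametrizations. -/
theorem surfaceMeasure_eq_zero {E F : Type*} [NormedAddCommGroup E] [NormedSpace ℝ E]
    [FiniteDimensional ℝ E] [NormedAddCommGroup F] [NormedSpace ℝ F]
    [FiniteDimensional ℝ F] [MeasurableSpace F] [BorelSpace F] (μ : Measure F)
    [μ.IsAddHaarMeasure] {d : ℕ} (hF : Module.finrank ℝ F = d) {S Q : Set E}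
    (h : ∀ x ∈ S, ∃ (σ : F → E) (τ : E → F) (U : Set F) (O : Set E),
      IsLocalParam S σ τ U O ∧ x ∈ O ∧ μ (U ∩ σ ⁻¹' Qᶜ) = 0) :
    surfaceMeasure d (S \ Q) = 0 := by
  let _ : MeasurableSpace E := borel E
  have : BorelSpace E := ⟨rfl⟩
  change Measure.hausdorffMeasure (d : ℝ) (S \ Q) = 0
  have := FiniteDimensional.proper ℝ E
  have : SecondCountableTopology E := inferInstance
  refine measure_null_of_locally_null _ fun x hx => ?_
  obtain ⟨σ, τ, U, O, hp, hxO, hμ⟩ := h x hx.1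
  refine ⟨(S \ Q) ∩ O, inter_mem_nhdsWithin _ (hp.isOpen_target.mem_nhds hxO), ?_⟩
  refine measure_mono_null ?_ (hausdorffMeasure_image_eq_zero (σ := σ) (N := U ∩ σ ⁻¹' Qᶜ)
    (fun y hy => (hp.contDiffAt y hy.1).of_le (by exact_mod_cast le_top))
    (hausdorffMeasure_eq_zero_of_addHaar μ hF hμ))
  rintro y ⟨⟨hyS, hyQ⟩, hyO⟩
  have h1 := hp.right_inv y ⟨hyS, hyO⟩
  exact ⟨τ y, ⟨hp.mapsTo_inv y ⟨hyS, hyO⟩, by rw [mem_preimage, h1]; exact hyQ⟩, h1⟩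

/-- A system whose phase space carries, up to a set of measure zero, a free torus action along
which the motions are linear after a change of time is completely integrable. -/
theorem isCompletelyIntegrable_of_action {E F : Type*} [NormedAddCommGroup E] [NormedSpace ℝ E]
    [FiniteDimensional ℝ E] [NormedAddCommGroup F] [NormedSpace ℝ F]
    [FiniteDimensional ℝ F] [MeasurableSpace F] [BorelSpace F] (μ : Measure F)
    [μ.IsAddHaarMeasure] {d k l : ℕ} (hF : Module.finrank ℝ F = d) (hkl : k + l = d)
    {S Q : Set E} {Sol : Set ℝ → (ℝ → E) → Prop} {A : (Fin k → ℝ) → E → E}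
    (hA : IsFreeTorusAction S Q A)
    (hS : ∀ x ∈ S, ∃ (σ : F → E) (τ : E → F) (U : Set F) (O : Set E),
      IsLocalParam S σ τ U O ∧ x ∈ O ∧ μ (U ∩ σ ⁻¹' Qᶜ) = 0)
    {freq : E → Fin k → ℝ} {Φ : E → ℝ} (hfreq : ∀ x ∈ Q, ContDiffAt ℝ ∞ freq x)
    (hΦ : ∀ x ∈ Q, ContDiffAt ℝ ∞ Φ x) (hΦ0 : ∀ x ∈ Q, 0 < Φ x)
    {X : E → E} (hX : ContDiff ℝ 1 X)
    (hSol : ∀ J : Set ℝ, IsOpen J → ∀ x, Sol J x → ∀ t ∈ J, HasDerivAt x (X (x t)) t)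
    (hmot : ∀ x ∈ Q, ∀ J : Set ℝ, IsOpen J → ∀ φ : ℝ → Fin k → ℝ,
      IsTorusMotion (freq x) (fun ψ => Φ (A ψ x)) J φ → Sol J (fun t => A (φ t) x)) :
    IsCompletelyIntegrable S d Sol := by
  set orbit : E → Set E := fun x => range fun φ => A φ x with horbit
  have horb : ∀ x ∈ Q, ∀ y ∈ orbit x, orbit y = orbit x := by
    rintro x hx _ ⟨ψ, rfl⟩
    apply Subset.antisymm
    · rintro _ ⟨φ, rfl⟩
      exact ⟨φ + ψ, (hA.add φ ψ x hx).symm⟩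
    · rintro _ ⟨φ, rfl⟩
      refine ⟨φ - ψ, ?_⟩
      simp only
      rw [hA.add _ _ x hx, sub_add_cancel]
  have hself : ∀ x ∈ Q, x ∈ orbit x := fun x hx => ⟨0, hA.zero x hx⟩
  have hunion : ⋃₀ (orbit '' Q) = Q := by
    apply Subset.antisymm
    · rintro y ⟨_, ⟨x, hx, rfl⟩, ⟨φ, rfl⟩⟩
      exact hA.mapsTo φ x hx
    · exact fun x hx => ⟨orbit x, ⟨x, hx, rfl⟩, hself x hx⟩
  refine ⟨k, l, orbit '' Q, hkl, ?_, ?_, ?_⟩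
  · rintro _ ⟨x, hx, rfl⟩ _ ⟨y, hy, rfl⟩ hne
    refine disjoint_left.2 fun z hzx hzy => hne ?_
    rw [← horb x hx z hzx, ← horb y hy z hzy]
  · rw [hunion]
    exact surfaceMeasure_eq_zero μ hF hS
  · rw [hunion]
    intro x hx
    obtain ⟨σ, τ, U, O, hp, hxO, -⟩ := hS x (hA.subset hx)
    obtain ⟨V, s, hV, h0V, hs0, hsQ, hss, hinj, himm, O', hO', himg⟩ :=
      hA.exists_slice hp hx hxO (hkl.trans hF.symm)
    have hιs : ∀ φ, ∀ v ∈ V,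
        ContDiffAt ℝ ∞ (fun p : (Fin k → ℝ) × (Fin l → ℝ) => A p.1 (s p.2)) (φ, v) :=
      fun φ v hv => (hA.smooth φ (s v) (hsQ v hv)).comp (φ, v)
        (f := fun p : (Fin k → ℝ) × (Fin l → ℝ) => (p.1, s p.2))
        (contDiffAt_fst.prodMk (ContDiffAt.comp (f := Prod.snd) (g := s) (φ, v)
          (hss v hv) contDiffAt_snd))
    refine ⟨V, fun p => A p.1 (s p.2), fun v => freq (s v), fun p => Φ (A p.1 (s p.2)), ?_, ?_, ?_⟩
    · refine ⟨hV, ?_, ?_, himm, ⟨O', hO', himg⟩, ?_, ?_, ?_, ?_, ?_, ?_⟩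
      · rintro ⟨φ, v⟩ ⟨-, hv⟩
        exact (hιs φ v hv).contDiffWithinAt
      · intro φ ψ v hv w hw
        constructor
        · intro h
          have hvw := hinj φ ψ v hv w hw h
          subst hvw
          refine ⟨rfl, ?_⟩
          simp only at h
          have h1 : A (ψ - φ) (s v) = s v := by
            rw [sub_eq_neg_add, ← hA.add _ _ _ (hsQ v hv), ← h, hA.neg_apply (hsQ v hv)]
          obtain ⟨N, hN⟩ := (hA.fixed_iff _ _ (hsQ v hv)).1 h1
          refine ⟨N, ?_⟩
          rw [shift_eq, ← hN, sub_add_cancel]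
        · rintro ⟨rfl, N, rfl⟩
          exact (hA.shift (hsQ v hv) φ N).symm
      · intro v hv
        exact (ContDiffAt.comp (g := freq) v (hfreq _ (hsQ v hv)) (hss v hv)).contDiffWithinAt
      · rintro ⟨φ, v⟩ ⟨-, hv⟩
        exact (ContDiffAt.comp (g := Φ) (φ, v) (hΦ _ (hA.mapsTo φ _ (hsQ v hv)))
          (hιs φ v hv)).contDiffWithinAt
      · exact fun φ v hv => hΦ0 _ (hA.mapsTo φ _ (hsQ v hv))
      · intro φ N v hv
        simp only
        rw [hA.shift (hsQ v hv)]
      · exact fun v hv J hJ _ φ hφ => hmot (s v) (hsQ v hv) J hJ φ hφ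
      · intro v hv J hJ hJc x hx t₀ ht₀ φ₀ hφ₀
        have hcA : Continuous fun φ => Φ (A φ (s v)) := continuous_iff_continuousAt.2 fun φ =>
          ContinuousAt.comp (g := Φ) (hΦ _ (hA.mapsTo φ _ (hsQ v hv))).continuousAt
            (hA.smooth_left (hsQ v hv) φ).continuousAt
        -- By periodicity the minimum over the compact box is the minimum over all angles. This
        -- positive lower bound makes the time change global.
        obtain ⟨ψ, -, hψ⟩ := (isCompact_Icc : IsCompact (periodBox k)).exists_isMinOn
          ⟨0, fun _ => by simpa using Real.pi_pos.le, fun _ => by simpa using Real.pi_pos.le⟩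
          hcA.continuousOn
        have hmin : ∀ φ, Φ (A ψ (s v)) ≤ Φ (A φ (s v)) := fun φ => by
          obtain ⟨N, hN⟩ := exists_shift_mem_periodBox φ
          rw [← hA.shift (hsQ v hv) φ N]
          exact hψ hN
        -- Motions run along straight lines `φ₀ + θ ω`, so only the scalar equation `θ' = 1 / Φ` has
        -- to be solved; uniqueness then identifies the given solution with this motion.
        obtain ⟨θ, hθ0, hθ⟩ := exists_hasDerivAt_one_div
          (Ψ := fun r => Φ (A (φ₀ + r • freq (s v)) (s v))) (hcA.comp (by fun_prop))
          (hΦ0 _ (hA.mapsTo ψ _ (hsQ v hv))) (fun r => hmin _) t₀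
        have hmotion : IsTorusMotion (freq (s v)) (fun ψ => Φ (A ψ (s v))) J
            (fun t => φ₀ + θ t • freq (s v)) := fun t _ => by
          have := ((hθ t).smul_const (freq (s v))).const_add φ₀
          convert! this using 1
          ext i
          simp [div_eq_inv_mul]
        refine ⟨fun t => φ₀ + θ t • freq (s v), by simp [hθ0], hmotion, ?_⟩
        refine eqOn_of_hasDerivAt_of_contDiff hX hJ hJc (hSol J hJ x hx)
          (hSol J hJ _ (hmot (s v) (hsQ v hv) J hJ _ hmotion)) ht₀ ?_
        simpa [hθ0] using hφ₀
    · exact ⟨(0, 0), ⟨mem_univ _, h0V⟩, by simp only; rw [hs0, hA.zero x hx]⟩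
    · intro v hv
      refine ⟨s v, hsQ v hv, ?_⟩
      ext y
      constructor
      · rintro ⟨φ, rfl⟩
        exact ⟨(φ, v), ⟨mem_univ _, rfl⟩, rfl⟩
      · rintro ⟨⟨φ, w⟩, ⟨-, hw⟩, rfl⟩
        have hw : w = v := hw
        subst hw
        exact ⟨φ, rfl⟩

/-! ## The cubic of the reduced system -/

/-- The polynomial `2 (h - b z) (1 - z²) - P`, `D = (h, P)`: along the motions `ż² = cubic z`. -/
def cubic (b : ℝ) (D : ℝ × ℝ) (z : ℝ) : ℝ := 2 * (D.1 - b * z) * (1 - z ^ 2) - D.2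

/-- The values of the integrals for which the reduced motion oscillates between two values. -/
def regularValues (b : ℝ) : Set (ℝ × ℝ) :=
  {D | 0 < D.2 ∧ ∃ z ∈ Ioo (-1 : ℝ) 1, 0 < cubic b D z}

theorem contDiff_cubic (b : ℝ) : ContDiff ℝ ∞ fun p : (ℝ × ℝ) × ℝ => cubic b p.1 p.2 := by
  unfold cubic; fun_prop

theorem isOpen_regularValues (b : ℝ) : IsOpen (regularValues b) := by
  have : regularValues b = {D | 0 < D.2} ∩ ⋃ z ∈ Ioo (-1 : ℝ) 1, {D | 0 < cubic b D z} := by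
    ext D; simp [regularValues]
  rw [this]
  refine (isOpen_lt continuous_const continuous_snd).inter
    (isOpen_biUnion fun z _ => isOpen_lt continuous_const ?_)
  unfold cubic; fun_prop

/-- `T = (s, a)`: the middle and half the distance of the turning points. -/
structure IsTurning (b : ℝ) (D T : ℝ × ℝ) : Prop where
  pos : 0 < T.2
  left : -1 < T.1 - T.2
  right : T.1 + T.2 < 1
  factor : ∀ z, cubic b D z =
    (T.2 ^ 2 - (z - T.1) ^ 2) * (2 * D.1 - 4 * b * T.1 - 2 * b * z)

/-- The product in `IsTurning.factor` agrees with the cubic in degrees three and two, so their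
difference is affine in `z` and vanishes at both roots. For `b ≠ 0` the third root is `h / b - 2 s`;
the linear factor is written without the division so that `b = 0` is covered. -/
theorem isTurning_of_roots {b : ℝ} {D : ℝ × ℝ} {z₁ z₂ : ℝ} (h1 : -1 < z₁) (h : z₁ < z₂)
    (h2 : z₂ < 1) (e1 : cubic b D z₁ = 0) (e2 : cubic b D z₂ = 0) :
    IsTurning b D ((z₁ + z₂) / 2, (z₂ - z₁) / 2) := by
  refine ⟨by simp only; linarith, by simp only; linarith, by simp only; linarith, fun z => ?_⟩
  unfold cubic at *
  have hne : z₁ - z₂ ≠ 0 := by linarith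
  apply mul_left_cancel₀ hne
  simp only
  linear_combination (z - z₂) * e1 - (z - z₁) * e2

theorem exists_isTurning {b : ℝ} {D : ℝ × ℝ} (hD : D ∈ regularValues b) :
    ∃ T, IsTurning b D T := by
  obtain ⟨hP, z, hz, hpos⟩ := hD
  have hc : Continuous (cubic b D) := by unfold cubic; fun_prop
  -- At `z = ±1` the cubic equals `-P`.
  have hm : cubic b D (-1) < 0 := by unfold cubic; norm_num; exact hP
  have hp : cubic b D 1 < 0 := by unfold cubic; norm_num; exact hP
  obtain ⟨z₁, hz₁, e1⟩ := intermediate_value_Ioo hz.1.le hc.continuousOn ⟨hm, hpos⟩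
  obtain ⟨z₂, hz₂, e2⟩ := intermediate_value_Ioo' hz.2.le hc.continuousOn ⟨hp, hpos⟩
  exact ⟨_, isTurning_of_roots hz₁.1 (hz₁.2.trans hz₂.1) hz₂.2 e1 e2⟩

open Classical in
/-- The middle `s` and half the distance `a` of the turning points. -/
def turning (b : ℝ) (D : ℝ × ℝ) : ℝ × ℝ :=
  if hD : D ∈ regularValues b then (exists_isTurning hD).choose else 0

theorem isTurning_turning {b : ℝ} {D : ℝ × ℝ} (hD : D ∈ regularValues b) :
    IsTurning b D (turning b D) := by
  rw [turning, dif_pos hD]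
  exact (exists_isTurning hD).choose_spec

/-- The remaining linear factor of the cubic. -/
def linFactor (b : ℝ) (D : ℝ × ℝ) (z : ℝ) : ℝ :=
  2 * D.1 - 4 * b * (turning b D).1 - 2 * b * z

/-- At `±1` the cubic is `-P < 0` and the quadratic factor is negative, so the linear factor is
positive at both ends and hence between them. Consequently the turning points are the only zeros in
`[-1, 1]`, and they are simple. -/
theorem IsTurning.linear_pos {b : ℝ} {D T : ℝ × ℝ} (h : IsTurning b D T) (hP : 0 < D.2) {z : ℝ}
    (hz : z ∈ Icc (-1 : ℝ) 1) : 0 < 2 * D.1 - 4 * b * T.1 - 2 * b * z := by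
  have h1 := h.factor 1
  have h2 := h.factor (-1)
  have ha := h.pos
  have hl := h.left
  have hr := h.right
  unfold cubic at h1 h2
  norm_num at h1 h2
  have n1 : T.2 ^ 2 - (1 - T.1) ^ 2 < 0 := by nlinarith
  have n2 : T.2 ^ 2 - (-1 - T.1) ^ 2 < 0 := by nlinarith
  have p1 : 0 < 2 * D.1 - 4 * b * T.1 - 2 * b := by
    by_contra hcon
    nlinarith [mul_nonneg_of_nonpos_of_nonpos n1.le (not_lt.1 hcon)]
  have p2 : 0 < 2 * D.1 - 4 * b * T.1 + 2 * b := by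
    by_contra hcon
    nlinarith [mul_nonneg_of_nonpos_of_nonpos n2.le (not_lt.1 hcon)]
  obtain ⟨hz1, hz2⟩ := hz
  nlinarith [mul_nonneg (sub_nonneg.2 hz2) p2.le,
    mul_nonneg (by linarith : 0 ≤ 1 + z) p1.le]

theorem linFactor_pos {b : ℝ} {D : ℝ × ℝ} (hD : D ∈ regularValues b) {z : ℝ}
    (hz : z ∈ Icc (-1 : ℝ) 1) : 0 < linFactor b D z :=
  (isTurning_turning hD).linear_pos hD.1 hz

theorem IsTurning.root {b : ℝ} {D T : ℝ × ℝ} (h : IsTurning b D T) (hP : 0 < D.2) {z : ℝ}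
    (hz : z ∈ Icc (-1 : ℝ) 1) (h0 : cubic b D z = 0) : z = T.1 - T.2 ∨ z = T.1 + T.2 := by
  rw [h.factor] at h0
  rcases mul_eq_zero.1 h0 with h1 | h1
  · have : (z - (T.1 - T.2)) * (z - (T.1 + T.2)) = 0 := by linear_combination -h1
    rcases mul_eq_zero.1 this with h2 | h2
    · left; linarith
    · right; linarith
  · exact absurd h1 (h.linear_pos hP hz).ne'

/-- `turning` is defined by choice; uniqueness is what allows it to be compared with smooth branches
of roots. -/
theorem IsTurning.unique {b : ℝ} {D T T' : ℝ × ℝ} (h : IsTurning b D T) (h' : IsTurning b D T')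
    (hP : 0 < D.2) : T = T' := by
  have ha := h.pos
  have ha' := h'.pos
  have c1 : cubic b D (T'.1 - T'.2) = 0 := by rw [h'.factor]; ring
  have c2 : cubic b D (T'.1 + T'.2) = 0 := by rw [h'.factor]; ring
  have r1 := h.root hP ⟨h'.left.le, by linarith [h'.right]⟩ c1
  have r2 := h.root hP ⟨by linarith [h'.left], h'.right.le⟩ c2
  ext
  · rcases r1 with r1 | r1 <;> rcases r2 with r2 | r2 <;> linarith
  · rcases r1 with r1 | r1 <;> rcases r2 with r2 | r2 <;> linarith

/-- Simple roots continue smoothly in the parameters by the implicit function theorem, and by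
uniqueness the continued roots are those selected by `turning`. -/
theorem contDiffAt_turning {b : ℝ} {D : ℝ × ℝ} (hD : D ∈ regularValues b) :
    ContDiffAt ℝ ∞ (turning b) D := by
  have hT := isTurning_turning hD
  set T := turning b D with hTdef
  have ha := hT.pos
  have hl := hT.left
  have hr := hT.right
  have hder : ∀ z, (z = T.1 - T.2 ∨ z = T.1 + T.2) → ∃ f', f' ≠ 0 ∧
      HasDerivAt (fun z => cubic b D z) f' z := fun z hz => by
    refine ⟨-2 * (z - T.1) * (2 * D.1 - 4 * b * T.1 - 2 * b * z), ?_, ?_⟩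
    · refine mul_ne_zero ?_ (hT.linear_pos hD.1 ?_).ne'
      · rcases hz with rfl | rfl
        · simpa using ha.ne'
        · simpa using ha.ne'
      · rcases hz with rfl | rfl <;> constructor <;> linarith
    · have : (fun z => cubic b D z) = fun z =>
          (T.2 ^ 2 - (z - T.1) ^ 2) * (2 * D.1 - 4 * b * T.1 - 2 * b * z) := funext hT.factor
      rw [this]
      have d1 : HasDerivAt (fun z => T.2 ^ 2 - (z - T.1) ^ 2) (-2 * (z - T.1)) z := by
        convert! (((hasDerivAt_id z).sub_const T.1).pow 2).const_sub (T.2 ^ 2) using 1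
        simp
      have d2 : HasDerivAt (fun z => 2 * D.1 - 4 * b * T.1 - 2 * b * z) (-(2 * b)) z := by
        simpa using ((hasDerivAt_id z).const_mul (2 * b)).const_sub (2 * D.1 - 4 * b * T.1)
      convert! d1.mul d2 using 1
      have : T.2 ^ 2 - (z - T.1) ^ 2 = 0 := by
        rcases hz with rfl | rfl <;> ring
      rw [this]; ring
  have hs : ∀ z, ContDiffAt ℝ ∞ (fun p : (ℝ × ℝ) × ℝ => cubic b p.1 p.2) (D, z) := fun z =>
    (contDiff_cubic b).contDiffAt
  have c1 : cubic b D (T.1 - T.2) = 0 := by rw [hT.factor]; ring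
  have c2 : cubic b D (T.1 + T.2) = 0 := by rw [hT.factor]; ring
  obtain ⟨f₁, hf₁, hd₁⟩ := hder (T.1 - T.2) (Or.inl rfl)
  obtain ⟨f₂, hf₂, hd₂⟩ := hder (T.1 + T.2) (Or.inr rfl)
  obtain ⟨ζ₁, hζ₁, v₁, ev₁⟩ := exists_contDiffAt_implicit (hs _) c1 hd₁ hf₁
  obtain ⟨ζ₂, hζ₂, v₂, ev₂⟩ := exists_contDiffAt_implicit (hs _) c2 hd₂ hf₂
  have hsm : ContDiffAt ℝ ∞ (fun D' => ((ζ₁ D' + ζ₂ D') / 2, (ζ₂ D' - ζ₁ D') / 2)) D :=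
    ((hζ₁.add hζ₂).div_const 2).prodMk ((hζ₂.sub hζ₁).div_const 2)
  refine hsm.congr_of_eventuallyEq ?_
  have o1 : ∀ᶠ D' in 𝓝 D, -1 < ζ₁ D' :=
    hζ₁.continuousAt.eventually (lt_mem_nhds (by rw [v₁]; exact hl))
  have o2 : ∀ᶠ D' in 𝓝 D, ζ₂ D' < 1 :=
    hζ₂.continuousAt.eventually (gt_mem_nhds (by rw [v₂]; exact hr))
  have o3 : ∀ᶠ D' in 𝓝 D, ζ₁ D' < ζ₂ D' :=
    hζ₁.continuousAt.eventually_lt hζ₂.continuousAt (by rw [v₁, v₂]; linarith)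
  filter_upwards [ev₁, ev₂, o1, o2, o3, (isOpen_regularValues b).mem_nhds hD] with D' a1 a2 a3 a4 a5 a6
  exact (isTurning_turning a6).unique (isTurning_of_roots a3 a5 a4 a1 a2) a6.1

/-! ## Increments of quasi-periodic angles -/

/-- The mean value of `ρ (cos t)` over a period. -/
def meanRate (ρ : ℝ × ℝ → ℝ → ℝ) (D : ℝ × ℝ) : ℝ :=
  ∫ t in (0 : ℝ)..1, ρ D (Real.cos (2 * Real.pi * t))

/-- The integral of `ρ (cos t) - meanRate ρ` from `u` to `u + φ`, where `c = cos u`,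
`s = sin u`. -/
def increment (ρ : ℝ × ℝ → ℝ → ℝ) (D : ℝ × ℝ) (c s φ : ℝ) : ℝ :=
  φ * ∫ t in (0 : ℝ)..1, (ρ D (c * Real.cos (φ * t) - s * Real.sin (φ * t)) - meanRate ρ D)

section increment

variable {ρ : ℝ × ℝ → ℝ → ℝ} {D : ℝ × ℝ}

theorem continuous_comp_cos (hρ : ∀ C ∈ Icc (-1 : ℝ) 1, ContDiffAt ℝ ∞ (fun p : (ℝ × ℝ) × ℝ => ρ p.1 p.2) (D, C)) :
    Continuous fun t => ρ D (Real.cos t) :=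
  continuous_iff_continuousAt.2 fun t =>
    ContinuousAt.comp (f := fun t => (D, Real.cos t)) (g := fun p : (ℝ × ℝ) × ℝ => ρ p.1 p.2)
      (hρ _ (Real.cos_mem_Icc t)).continuousAt (by fun_prop)

/-- The definition of `increment` uses a fixed interval and the pair `(cos u, sin u)`, so that it is
a smooth function on phase space, where `u` itself is only defined modulo `2π`. Along an actual
angle it becomes this ordinary integral. -/
theorem increment_cos_sin (u φ : ℝ) :
    increment ρ D (Real.cos u) (Real.sin u) φ =
      ∫ t in u..(u + φ), (ρ D (Real.cos t) - meanRate ρ D) := by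
  have h := intervalIntegral.smul_integral_comp_add_mul
    (f := fun t => ρ D (Real.cos t) - meanRate ρ D) (a := 0) (b := 1) φ u
  rw [mul_zero, mul_one, add_zero] at h
  rw [← h, increment, smul_eq_mul]
  congr 1
  refine intervalIntegral.integral_congr fun t _ => ?_
  simp only [Real.cos_add]

theorem integral_period : ∫ t in (0 : ℝ)..2 * Real.pi, (ρ D (Real.cos t)) =
    2 * Real.pi * meanRate ρ D := by
  have h := intervalIntegral.smul_integral_comp_mul_left
    (f := fun t => ρ D (Real.cos t)) (a := 0) (b := 1) (2 * Real.pi)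
  rw [mul_zero, mul_one] at h
  rw [← h, meanRate, smul_eq_mul]

variable (hρ : ∀ C ∈ Icc (-1 : ℝ) 1, ContDiffAt ℝ ∞ (fun p : (ℝ × ℝ) × ℝ => ρ p.1 p.2) (D, C))

include hρ

/-- This cocycle identity is what makes the corrected angles define an action. -/
theorem increment_add (u φ ψ : ℝ) :
    increment ρ D (Real.cos u) (Real.sin u) (φ + ψ) =
      increment ρ D (Real.cos u) (Real.sin u) ψ +
        increment ρ D (Real.cos (u + ψ)) (Real.sin (u + ψ)) φ := by
  have hc : Continuous fun t => ρ D (Real.cos t) - meanRate ρ D :=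
    (continuous_comp_cos hρ).sub continuous_const
  rw [increment_cos_sin, increment_cos_sin, increment_cos_sin,
    intervalIntegral.integral_add_adjacent_intervals (hc.intervalIntegrable _ _)
      (hc.intervalIntegrable _ _)]
  congr 1; ring

theorem hasDerivAt_increment (u φ : ℝ) :
    HasDerivAt (increment ρ D (Real.cos u) (Real.sin u))
      (ρ D (Real.cos (u + φ)) - meanRate ρ D) φ := by
  have hc : Continuous fun t => ρ D (Real.cos t) - meanRate ρ D :=
    (continuous_comp_cos hρ).sub continuous_const
  have h1 : increment ρ D (Real.cos u) (Real.sin u) =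
      fun φ => ∫ t in u..(u + φ), (ρ D (Real.cos t) - meanRate ρ D) :=
    funext fun φ => increment_cos_sin u φ
  rw [h1]
  exact (hc.integral_hasStrictDerivAt u (u + φ)).hasDerivAt.comp_const_add u φ

/-- The subtracted mean makes the integral over a full period vanish, so the first angle acts with
period `2π`. -/
theorem increment_period (u : ℝ) (N : ℤ) :
    increment ρ D (Real.cos u) (Real.sin u) (2 * Real.pi * N) = 0 := by
  have hc : Continuous fun t => ρ D (Real.cos t) := continuous_comp_cos hρ
  have hper : Function.Periodic (fun t => ρ D (Real.cos t) - meanRate ρ D) (2 * Real.pi) :=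
    fun t => by simp
  have h := hper.intervalIntegral_add_zsmul_eq N u
    (fun a b => (hc.sub continuous_const).intervalIntegrable a b)
  rw [increment_cos_sin, mul_comm, ← zsmul_eq_mul, h, intervalIntegral.integral_sub
    (hc.intervalIntegrable _ _) intervalIntegrable_const]
  have hper' : Function.Periodic (fun t => ρ D (Real.cos t)) (2 * Real.pi) := fun t => by simp
  rw [hper'.intervalIntegral_add_eq u 0, zero_add, integral_period]
  simp

theorem contDiffAt_meanRate : ContDiffAt ℝ ∞ (meanRate ρ) D :=
  contDiffAt_integral (H := fun p : (ℝ × ℝ) × ℝ => ρ p.1 (Real.cos (2 * Real.pi * p.2)))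
    fun t _ => ContDiffAt.comp
      (f := fun p : (ℝ × ℝ) × ℝ => (p.1, Real.cos (2 * Real.pi * p.2)))
      (g := fun p : (ℝ × ℝ) × ℝ => ρ p.1 p.2) _ (hρ _ (Real.cos_mem_Icc _)) (by fun_prop)

theorem contDiffAt_increment {c s φ : ℝ} (hcs : c ^ 2 + s ^ 2 = 1) :
    ContDiffAt ℝ ∞ (fun p : (ℝ × ℝ) × ℝ × ℝ × ℝ => increment ρ p.1 p.2.1 p.2.2.1 p.2.2.2)
      (D, c, s, φ) := by
  refine ContDiffAt.mul (by fun_prop) ?_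
  refine contDiffAt_integral (H := fun p : ((ℝ × ℝ) × ℝ × ℝ × ℝ) × ℝ =>
    ρ p.1.1 (p.1.2.1 * Real.cos (p.1.2.2.2 * p.2) - p.1.2.2.1 * Real.sin (p.1.2.2.2 * p.2)) -
      meanRate ρ p.1.1) fun t _ => ContDiffAt.sub ?_ ?_
  · refine ContDiffAt.comp (f := fun p : ((ℝ × ℝ) × ℝ × ℝ × ℝ) × ℝ => (p.1.1,
      p.1.2.1 * Real.cos (p.1.2.2.2 * p.2) - p.1.2.2.1 * Real.sin (p.1.2.2.2 * p.2)))
      (g := fun p : (ℝ × ℝ) × ℝ => ρ p.1 p.2) _ (hρ _ (abs_le.1 ?_)) (by fun_prop)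
    -- The argument of `ρ` stays in `[-1, 1]`, where smoothness is assumed: `(cC - sS)² + (cS + sC)²
    -- = 1`.
    simp only
    rw [← sq_le_one_iff_abs_le_one]
    nlinarith [sq_nonneg (c * Real.sin (φ * t) + s * Real.cos (φ * t)),
      Real.sin_sq_add_cos_sq (φ * t)]
  · exact ContDiffAt.comp (f := fun p : ((ℝ × ℝ) × ℝ × ℝ × ℝ) × ℝ => p.1.1) (g := meanRate ρ) _
      (contDiffAt_meanRate hρ) (by fun_prop)

end increment

/-! ## Adapted frames and the reduced angle -/

/-- The axis of dynamical symmetry. -/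
def axis (m : ℕ) : Fin (m + 1) → ℝ := Pi.single (Fin.last m) 1

/-- The height `Γₙ`. -/
def height {m : ℕ} (Γ : Fin (m + 1) → ℝ) : ℝ := Γ (Fin.last m)

/-- The energy and the squared area integral. -/
def integrals {m : ℕ} (b : ℝ) (v Γ : Fin (m + 1) → ℝ) : ℝ × ℝ :=
  (v ⬝ᵥ v / 2 + b * height Γ, (v ⬝ᵥ v) * (1 - height Γ ^ 2) - (v ⬝ᵥ Γ) ^ 2)

/-- The length of the horizontal part of a unit vector of height `z`. -/
def radius (z : ℝ) : ℝ := Real.sqrt (1 - z ^ 2)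

/-- The orthonormal frame adapted to the velocity and the vertical. -/
def frame {m : ℕ} (b : ℝ) (v Γ : Fin (m + 1) → ℝ) : Matrix (Fin (m + 1)) (Fin 3) ℝ :=
  Matrix.of fun i => ![(Γ i - height Γ * axis m i) / radius (height Γ),
    ((v ⬝ᵥ Γ) * (Γ i - height Γ * axis m i) - (1 - height Γ ^ 2) * v i) /
      (Real.sqrt (integrals b v Γ).2 * radius (height Γ)), axis m i]

structure IsRegular {m : ℕ} (b : ℝ) (v Γ : Fin (m + 1) → ℝ) : Prop where
  last : v (Fin.last m) = 0
  unit : Γ ⬝ᵥ Γ = 1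
  regular : integrals b v Γ ∈ regularValues b

/-- The cosine of the reduced angle. -/
def angleCos {m : ℕ} (b : ℝ) (v Γ : Fin (m + 1) → ℝ) : ℝ :=
  ((turning b (integrals b v Γ)).1 - height Γ) / (turning b (integrals b v Γ)).2

/-- The sine of the reduced angle. -/
def angleSin {m : ℕ} (b : ℝ) (v Γ : Fin (m + 1) → ℝ) : ℝ :=
  (v ⬝ᵥ Γ) / ((turning b (integrals b v Γ)).2 *
    Real.sqrt (linFactor b (integrals b v Γ) (height Γ)))

/-- The height as a function of the cosine of the reduced angle. -/
def levelHeight (b : ℝ) (D : ℝ × ℝ) (C : ℝ) : ℝ := (turning b D).1 - (turning b D).2 * C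

/-- The time derivative of the reduced angle. -/
def levelRate (b : ℝ) (D : ℝ × ℝ) (C : ℝ) : ℝ :=
  Real.sqrt (linFactor b D (levelHeight b D C))

/-- The velocity in the adapted frame. -/
def levelVel (b : ℝ) (D : ℝ × ℝ) (C S : ℝ) : Fin 3 → ℝ :=
  ![(turning b D).2 * S * levelRate b D C / radius (levelHeight b D C),
    -Real.sqrt D.2 / radius (levelHeight b D C), 0]

/-- The vertical in the adapted frame. -/
def levelDir (b : ℝ) (D : ℝ × ℝ) (C : ℝ) : Fin 3 → ℝ :=
  ![radius (levelHeight b D C), 0, levelHeight b D C]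

/-- The state with integrals `D`, adapted frame `B` and reduced angle `u`. -/
structure IsState {m : ℕ} (b : ℝ) (v Γ : Fin (m + 1) → ℝ) (D : ℝ × ℝ)
    (B : Matrix (Fin (m + 1)) (Fin 3) ℝ) (u : ℝ) : Prop where
  regular : D ∈ regularValues b
  orthonormal : Bᵀ * B = 1
  axis_eq : B *ᵥ ![0, 0, 1] = axis m
  vel : v = B *ᵥ levelVel b D (Real.cos u) (Real.sin u)
  dir : Γ = B *ᵥ levelDir b D (Real.cos u)

/-! ### Height, radius and rate on a level of the integrals. -/

section level

variable {b : ℝ} {D : ℝ × ℝ}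

theorem levelHeight_mem (hD : D ∈ regularValues b) {C : ℝ} (hC : C ∈ Icc (-1 : ℝ) 1) :
    levelHeight b D C ∈ Ioo (-1 : ℝ) 1 := by
  have h := isTurning_turning hD
  have h1 := h.pos
  have h2 := h.left
  have h3 := h.right
  obtain ⟨hC1, hC2⟩ := hC
  unfold levelHeight
  constructor <;> nlinarith

theorem radius_pos {z : ℝ} (hz : z ∈ Ioo (-1 : ℝ) 1) : 0 < radius z :=
  Real.sqrt_pos.2 (by nlinarith [hz.1, hz.2])

theorem radius_sq {z : ℝ} (hz : z ∈ Icc (-1 : ℝ) 1) : radius z ^ 2 = 1 - z ^ 2 :=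
  Real.sq_sqrt (by nlinarith [hz.1, hz.2])

theorem levelRate_pos (hD : D ∈ regularValues b) {C : ℝ} (hC : C ∈ Icc (-1 : ℝ) 1) :
    0 < levelRate b D C :=
  Real.sqrt_pos.2 (linFactor_pos hD (Ioo_subset_Icc_self (levelHeight_mem hD hC)))

theorem levelRate_sq (hD : D ∈ regularValues b) {C : ℝ} (hC : C ∈ Icc (-1 : ℝ) 1) :
    levelRate b D C ^ 2 = linFactor b D (levelHeight b D C) :=
  Real.sq_sqrt (linFactor_pos hD (Ioo_subset_Icc_self (levelHeight_mem hD hC))).le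

/-- The quantity squared on the left is `v ⬝ Γ`, the velocity of the height; the factorization of
the cubic and `sin² = 1 - cos²` give the relation `ż² = cubic z`. -/
theorem levelVel_sq (hD : D ∈ regularValues b) (u : ℝ) :
    ((turning b D).2 * Real.sin u * levelRate b D (Real.cos u)) ^ 2 =
      cubic b D (levelHeight b D (Real.cos u)) := by
  rw [(isTurning_turning hD).factor, mul_pow, levelRate_sq hD (Real.cos_mem_Icc u), linFactor,
    levelHeight, mul_pow, Real.sin_sq]
  ring

end level

theorem dotProduct_mulVec_mulVec {n : ℕ} {B : Matrix (Fin n) (Fin 3) ℝ} (hB : Bᵀ * B = 1)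
    (x y : Fin 3 → ℝ) : (B *ᵥ x) ⬝ᵥ (B *ᵥ y) = x ⬝ᵥ y := by
  rw [Matrix.dotProduct_mulVec, ← Matrix.mulVec_transpose, Matrix.mulVec_mulVec, hB,
    Matrix.one_mulVec]

theorem axis_dotProduct {m : ℕ} (x : Fin (m + 1) → ℝ) : axis m ⬝ᵥ x = height x := by
  simp [axis, height]

namespace IsState

variable {m : ℕ} {b : ℝ} {v Γ : Fin (m + 1) → ℝ} {D : ℝ × ℝ}
    {B : Matrix (Fin (m + 1)) (Fin 3) ℝ} {u : ℝ}

theorem height_eq (h : IsState b v Γ D B u) : height Γ = levelHeight b D (Real.cos u) := by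
  rw [← axis_dotProduct, h.dir, ← h.axis_eq, dotProduct_mulVec_mulVec h.orthonormal]
  simp [levelDir, dotProduct, Fin.sum_univ_three]

theorem vel_dotProduct_dir (h : IsState b v Γ D B u) :
    v ⬝ᵥ Γ = (turning b D).2 * Real.sin u * levelRate b D (Real.cos u) := by
  have hr := radius_pos (levelHeight_mem h.regular (Real.cos_mem_Icc u))
  rw [h.vel, h.dir, dotProduct_mulVec_mulVec h.orthonormal]
  simp [levelDir, levelVel, dotProduct, Fin.sum_univ_three]
  field_simp

/-- The components of `v` in the frame are `y / r` and `-p / r` with `y = v ⬝ Γ`, and `y² + p² = 2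
(h - b z) r²` by the cubic relation. -/
theorem vel_sq (h : IsState b v Γ D B u) :
    v ⬝ᵥ v = 2 * (D.1 - b * levelHeight b D (Real.cos u)) := by
  have hz := levelHeight_mem h.regular (Real.cos_mem_Icc u)
  have hr := radius_pos hz
  have hr2 := radius_sq (Ioo_subset_Icc_self hz)
  have hP := Real.sq_sqrt h.regular.1.le
  have hy := levelVel_sq h.regular u
  rw [h.vel, dotProduct_mulVec_mulVec h.orthonormal]
  simp only [levelVel, dotProduct, Fin.sum_univ_three, Matrix.cons_val]
  unfold cubic at hy
  rw [← hr2] at hy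
  field_simp
  linear_combination hy + hP

theorem integrals_eq (h : IsState b v Γ D B u) : integrals b v Γ = D := by
  have hy := levelVel_sq h.regular u
  unfold cubic at hy
  ext
  · simp only [integrals]
    rw [h.vel_sq, h.height_eq]; ring
  · simp only [integrals]
    rw [h.vel_sq, h.height_eq, h.vel_dotProduct_dir, hy]; ring

theorem vel_last (h : IsState b v Γ D B u) : v (Fin.last m) = 0 := by
  change height v = 0
  rw [← axis_dotProduct, h.vel, ← h.axis_eq, dotProduct_mulVec_mulVec h.orthonormal]
  simp [levelVel, dotProduct, Fin.sum_univ_three]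

theorem dir_sq (h : IsState b v Γ D B u) : Γ ⬝ᵥ Γ = 1 := by
  have hz := levelHeight_mem h.regular (Real.cos_mem_Icc u)
  have hr2 := radius_sq (Ioo_subset_Icc_self hz)
  rw [h.dir, dotProduct_mulVec_mulVec h.orthonormal]
  simp [levelDir, dotProduct, Fin.sum_univ_three]
  linear_combination hr2

theorem isRegular (h : IsState b v Γ D B u) : IsRegular b v Γ :=
  ⟨h.vel_last, h.dir_sq, by rw [h.integrals_eq]; exact h.regular⟩

theorem angleCos_eq (h : IsState b v Γ D B u) : angleCos b v Γ = Real.cos u := by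
  have ha := (isTurning_turning h.regular).pos
  rw [angleCos, h.integrals_eq, h.height_eq, levelHeight]
  field_simp
  ring

theorem angleSin_eq (h : IsState b v Γ D B u) : angleSin b v Γ = Real.sin u := by
  have ha := (isTurning_turning h.regular).pos
  have hq := levelRate_pos h.regular (Real.cos_mem_Icc u)
  rw [angleSin, h.integrals_eq, h.height_eq, h.vel_dotProduct_dir, ← levelRate]
  field_simp

/-- The integrals, the frame and the reduced angle modulo `2π` are all recovered from `(v, Γ)`.
Formulas defined on phase space may therefore be evaluated through any description of the point as a
state. -/
theorem frame_eq (h : IsState b v Γ D B u) : frame b v Γ = B := by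
  have hz := levelHeight_mem h.regular (Real.cos_mem_Icc u)
  have hr := radius_pos hz
  have hr2 := radius_sq (Ioo_subset_Icc_self hz)
  have hp : 0 < Real.sqrt D.2 := Real.sqrt_pos.2 h.regular.1
  have hax : ∀ i, axis m i = B i 2 := fun i => by
    rw [← h.axis_eq]; simp [Matrix.mulVec, dotProduct, Fin.sum_univ_three]
  have hΓ : ∀ i, Γ i = B i 0 * radius (levelHeight b D (Real.cos u)) +
      B i 2 * levelHeight b D (Real.cos u) := fun i => by
    rw [h.dir]; simp [levelDir, Matrix.mulVec, dotProduct, Fin.sum_univ_three]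
  have hv : ∀ i, v i = B i 0 * ((v ⬝ᵥ Γ) / radius (levelHeight b D (Real.cos u))) +
      B i 1 * (-Real.sqrt D.2 / radius (levelHeight b D (Real.cos u))) := fun i => by
    rw [h.vel_dotProduct_dir]
    conv_lhs => rw [h.vel]
    simp [levelVel, Matrix.mulVec, dotProduct, Fin.sum_univ_three]
  ext i j
  simp only [frame, h.integrals_eq, h.height_eq, ← hr2, hax]
  have h1 := hΓ i
  have h2 := hv i
  generalize v ⬝ᵥ Γ = y at *
  generalize Real.sqrt D.2 = p at *
  generalize radius (levelHeight b D (Real.cos u)) = r at *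
  fin_cases j
  · simp [h1]; field_simp; ring
  · simp only [Fin.mk_one, Fin.isValue, Matrix.of_apply, Matrix.cons_val_one, Matrix.cons_val_zero]
    rw [h1, h2]; field_simp; ring
  · simp

end IsState

/-- If `z² = 1`, then `P = -(v ⬝ Γ)² ≤ 0`. -/
theorem height_mem_Ioo {m : ℕ} {b : ℝ} {v Γ : Fin (m + 1) → ℝ}
    (hΓ : Γ ⬝ᵥ Γ = 1) (hP : 0 < (integrals b v Γ).2) : height Γ ∈ Ioo (-1 : ℝ) 1 := by
  have h1 : height Γ ^ 2 ≤ 1 := by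
    rw [← hΓ, height, pow_two, dotProduct]
    exact Finset.single_le_sum (f := fun i => Γ i * Γ i) (fun i _ => mul_self_nonneg _)
      (Finset.mem_univ (Fin.last m))
  simp only [integrals] at hP
  have hv : 0 ≤ v ⬝ᵥ v := dotProduct_self_star_nonneg v
  have h2 : height Γ ^ 2 < 1 := by
    refine lt_of_le_of_ne h1 fun h3 => ?_
    rw [h3] at hP
    nlinarith [sq_nonneg (v ⬝ᵥ Γ)]
  constructor <;> nlinarith

namespace IsRegular

variable {m : ℕ} {b : ℝ} {v Γ : Fin (m + 1) → ℝ}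

theorem height_mem (h : IsRegular b v Γ) : height Γ ∈ Ioo (-1 : ℝ) 1 :=
  height_mem_Ioo h.unit h.regular.1

theorem sq_eq_cubic (b : ℝ) (v Γ : Fin (m + 1) → ℝ) :
    (v ⬝ᵥ Γ) ^ 2 = cubic b (integrals b v Γ) (height Γ) := by
  simp only [cubic, integrals]; ring

theorem linFactor_pos (h : IsRegular b v Γ) :
    0 < linFactor b (integrals b v Γ) (height Γ) :=
  Suslov.linFactor_pos h.regular (Ioo_subset_Icc_self h.height_mem)

theorem angle_sq (h : IsRegular b v Γ) : angleCos b v Γ ^ 2 + angleSin b v Γ ^ 2 = 1 := by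
  have hT := isTurning_turning h.regular
  have ha := hT.pos
  have hq := h.linFactor_pos
  have hs := Real.sq_sqrt hq.le
  have hq' := Real.sqrt_pos.2 hq
  have hy := sq_eq_cubic b v Γ
  rw [hT.factor, ← linFactor, ← hs] at hy
  rw [angleCos, angleSin, div_pow, div_pow, hy]
  field_simp
  ring

/-- `angleCos` and `angleSin` are the coordinates of a point of the unit circle, whose argument is
`u`. The frame is the Gram–Schmidt basis of `γ` and `v`, its second vector being opposite to the
part of `v` normal to `γ`. -/
theorem exists_isState (h : IsRegular b v Γ) :
    ∃ u, IsState b v Γ (integrals b v Γ) (frame b v Γ) u := by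
  obtain ⟨u, hu1, hu2⟩ : ∃ u, Real.cos u = angleCos b v Γ ∧ Real.sin u = angleSin b v Γ := by
    have hn : ‖(⟨angleCos b v Γ, angleSin b v Γ⟩ : ℂ)‖ = 1 := by
      rw [← sq_eq_sq₀ (norm_nonneg _) zero_le_one, Complex.sq_norm, Complex.normSq_mk]
      linear_combination h.angle_sq
    refine ⟨Complex.arg ⟨angleCos b v Γ, angleSin b v Γ⟩, ?_, ?_⟩
    · rw [Complex.cos_arg (norm_ne_zero_iff.1 (by rw [hn]; exact one_ne_zero)), hn]; simp
    · rw [Complex.sin_arg, hn]; simp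
  have hT := isTurning_turning h.regular
  have ha := hT.pos
  have hz := h.height_mem
  have hr := radius_pos hz
  have hr2 := radius_sq (Ioo_subset_Icc_self hz)
  have hP := h.regular.1
  have hp : 0 < Real.sqrt (integrals b v Γ).2 := Real.sqrt_pos.2 hP
  have hp2 := Real.sq_sqrt hP.le
  have hq' := Real.sqrt_pos.2 h.linFactor_pos
  have hlev : levelHeight b (integrals b v Γ) (Real.cos u) = height Γ := by
    rw [levelHeight, hu1, angleCos]; field_simp; ring
  have hvel : (turning b (integrals b v Γ)).2 * Real.sin u *
      levelRate b (integrals b v Γ) (Real.cos u) = v ⬝ᵥ Γ := by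
    rw [levelRate, hlev, hu2, angleSin]; field_simp
  have haa : axis m ⬝ᵥ axis m = 1 := by rw [axis_dotProduct]; simp [height, axis]
  have hav : axis m ⬝ᵥ v = 0 := by rw [axis_dotProduct]; exact h.last
  have hva : v ⬝ᵥ axis m = 0 := by rw [dotProduct_comm]; exact hav
  have haΓ : axis m ⬝ᵥ Γ = height Γ := axis_dotProduct Γ
  have hΓa : Γ ⬝ᵥ axis m = height Γ := by rw [dotProduct_comm]; exact haΓ
  have hΓv : Γ ⬝ᵥ v = v ⬝ᵥ Γ := dotProduct_comm _ _
  have hΓΓ := h.unit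
  have hP2 : Real.sqrt (integrals b v Γ).2 ^ 2 = (v ⬝ᵥ v) * radius (height Γ) ^ 2 -
      (v ⬝ᵥ Γ) ^ 2 := by rw [hp2, hr2]; rfl
  set z := height Γ
  set y := v ⬝ᵥ Γ
  set p := Real.sqrt (integrals b v Γ).2
  set r := radius z
  have c0 : (fun i => frame b v Γ i 0) = (1 / r) • (Γ - z • axis m) := by
    ext i
    simp only [frame, Matrix.of_apply, Matrix.cons_val, Pi.smul_apply, Pi.sub_apply, smul_eq_mul]
    ring
  have c1 : (fun i => frame b v Γ i 1) = (1 / (p * r)) • (y • (Γ - z • axis m) - r ^ 2 • v) := by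
    ext i
    simp only [frame, Matrix.of_apply, Matrix.cons_val, Pi.smul_apply, Pi.sub_apply, smul_eq_mul]
    rw [hr2]
    ring
  have c2 : (fun i => frame b v Γ i 2) = axis m := by
    ext i; simp [frame]
  refine ⟨u, h.regular, ?_, ?_, ?_, ?_⟩
  · ext i j
    have : (frame b v Γ)ᵀ * frame b v Γ = Matrix.of fun i j =>
      (fun k => frame b v Γ k i) ⬝ᵥ (fun k => frame b v Γ k j) := by
      ext i j; simp [Matrix.mul_apply, dotProduct]
    rw [this, Matrix.of_apply]
    have hsymm : ∀ i j, (fun k => frame b v Γ k i) ⬝ᵥ (fun k => frame b v Γ k j) =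
      (fun k => frame b v Γ k j) ⬝ᵥ (fun k => frame b v Γ k i) := fun i j => dotProduct_comm _ _
    have d00 : (fun k => frame b v Γ k 0) ⬝ᵥ (fun k => frame b v Γ k 0) = 1 := by
      rw [c0]
      simp only [smul_dotProduct, dotProduct_smul, sub_dotProduct, dotProduct_sub, smul_eq_mul,
        haa, haΓ, hΓa, hΓΓ]
      field_simp
      linear_combination -hr2
    have d01 : (fun k => frame b v Γ k 0) ⬝ᵥ (fun k => frame b v Γ k 1) = 0 := by
      rw [c0, c1]
      simp only [smul_dotProduct, dotProduct_smul, sub_dotProduct, dotProduct_sub, smul_eq_mul,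
        haa, haΓ, hΓa, hΓΓ, hav, hΓv]
      field_simp
      linear_combination (-y) * hr2
    have d02 : (fun k => frame b v Γ k 0) ⬝ᵥ (fun k => frame b v Γ k 2) = 0 := by
      rw [c0, c2]
      simp only [smul_dotProduct, sub_dotProduct, smul_eq_mul, haa, hΓa]
      ring
    have d11 : (fun k => frame b v Γ k 1) ⬝ᵥ (fun k => frame b v Γ k 1) = 1 := by
      rw [c1]
      simp only [smul_dotProduct, dotProduct_smul, sub_dotProduct, dotProduct_sub, smul_eq_mul,
        haa, haΓ, hΓa, hΓΓ, hav, hΓv, hva]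
      field_simp
      have : v ⬝ᵥ Γ = y := rfl
      rw [this, hP2]
      linear_combination (-y ^ 2) * hr2
    have d12 : (fun k => frame b v Γ k 1) ⬝ᵥ (fun k => frame b v Γ k 2) = 0 := by
      rw [c1, c2]
      simp only [smul_dotProduct, sub_dotProduct, smul_eq_mul, haa, hΓa, hva]
      ring
    have d22 : (fun k => frame b v Γ k 2) ⬝ᵥ (fun k => frame b v Γ k 2) = 1 := by
      rw [c2, haa]
    fin_cases i <;> fin_cases j <;>
      simp only [Fin.zero_eta, Fin.mk_one, Fin.reduceFinMk, Fin.isValue, Matrix.one_apply_eq, ne_eq,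
        Fin.reduceEq, not_false_eq_true, Matrix.one_apply_ne]
    · exact d00
    · exact d01
    · exact d02
    · rw [hsymm]; exact d01
    · exact d11
    · exact d12
    · rw [hsymm]; exact d02
    · rw [hsymm]; exact d12
    · exact d22
  · ext i; simp [Matrix.mulVec, dotProduct, Fin.sum_univ_three, frame]
  · ext i
    have e0 := congrFun c0 i
    have e1 := congrFun c1 i
    simp only [Pi.smul_apply, Pi.sub_apply, smul_eq_mul] at e0 e1
    simp only [levelVel, Matrix.mulVec, dotProduct, Fin.sum_univ_three, Matrix.cons_val, hvel, hlev]
    rw [e0, e1]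
    change v i = 1 / r * (Γ i - z * axis m i) * (y / r) + 1 / (p * r) * (y * (Γ i - z * axis m i) -
      r ^ 2 * v i) * (-p / r) + _
    field_simp
    ring
  · ext i
    have e0 := congrFun c0 i
    simp only [Pi.smul_apply, Pi.sub_apply, smul_eq_mul] at e0
    simp only [levelDir, Matrix.mulVec, dotProduct, Fin.sum_univ_three, Matrix.cons_val, hlev]
    rw [e0]
    change Γ i = 1 / r * (Γ i - z * axis m i) * r + _ + axis m i * z
    field_simp
    ring

end IsRegular

/-! ## Rotations of the adapted frames -/

/-- Rotation about the third axis. -/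
def rotZ (α : ℝ) : Matrix (Fin 3) (Fin 3) ℝ :=
  !![Real.cos α, -Real.sin α, 0; Real.sin α, Real.cos α, 0; 0, 0, 1]

/-- The rotation about the second axis that takes the third axis to `(radius z, 0, z)`. -/
def tilt (z : ℝ) : Matrix (Fin 3) (Fin 3) ℝ :=
  !![z, 0, radius z; 0, 1, 0; -radius z, 0, z]

theorem rotZ_mul (α β : ℝ) : rotZ α * rotZ β = rotZ (α + β) := by
  ext i j
  fin_cases i <;> fin_cases j <;>
    simp [rotZ, Matrix.mul_apply, Fin.sum_univ_three, Real.cos_add, Real.sin_add] <;> ring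

theorem rotZ_zero : rotZ 0 = 1 := by
  ext i j; fin_cases i <;> fin_cases j <;> simp [rotZ]

theorem rotZ_transpose (α : ℝ) : (rotZ α)ᵀ = rotZ (-α) := by
  ext i j; fin_cases i <;> fin_cases j <;> simp [rotZ]

theorem rotZ_transpose_mul (α : ℝ) : (rotZ α)ᵀ * rotZ α = 1 := by
  rw [rotZ_transpose, rotZ_mul, neg_add_cancel, rotZ_zero]

theorem rotZ_mul_transpose (α : ℝ) : rotZ α * (rotZ α)ᵀ = 1 := by
  rw [rotZ_transpose, rotZ_mul, add_neg_cancel, rotZ_zero]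

theorem det_rotZ (α : ℝ) : (rotZ α).det = 1 := by
  simp [rotZ, Matrix.det_fin_three]
  linear_combination Real.sin_sq_add_cos_sq α

theorem rotZ_mulVec_axis (α : ℝ) : rotZ α *ᵥ ![0, 0, 1] = ![0, 0, 1] := by
  ext i; fin_cases i <;> simp [rotZ, Matrix.mulVec, dotProduct, Fin.sum_univ_three]

theorem exists_int_of_cos_sin {x u : ℝ} (hc : Real.cos (u + x) = Real.cos u)
    (hs : Real.sin (u + x) = Real.sin u) : ∃ N : ℤ, x = 2 * Real.pi * N := by
  have h : Real.cos x = 1 := by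
    rw [show x = (u + x) - u by ring, Real.cos_sub, hc, hs]
    linear_combination Real.sin_sq_add_cos_sq u
  obtain ⟨N, hN⟩ := (Real.cos_eq_one_iff x).1 h
  exact ⟨N, by rw [← hN]; ring⟩

theorem rotZ_eq_one_iff {α : ℝ} : rotZ α = 1 ↔ ∃ N : ℤ, α = 2 * Real.pi * N := by
  constructor
  · intro h
    have h0 := congrFun (congrFun h 0) 0
    have h1 := congrFun (congrFun h 1) 0
    simp [rotZ] at h0 h1
    exact exists_int_of_cos_sin (u := 0) (by simpa using h0) (by simpa using h1)
  · rintro ⟨N, rfl⟩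
    have hc : Real.cos (2 * Real.pi * N) = 1 := by
      rw [mul_comm]; exact Real.cos_int_mul_two_pi N
    have hs : Real.sin (2 * Real.pi * N) = 0 := by
      rw [show 2 * Real.pi * N = ((2 * N : ℤ) : ℝ) * Real.pi by push_cast; ring]
      exact Real.sin_int_mul_pi _
    ext i j; fin_cases i <;> fin_cases j <;> simp [rotZ, hc, hs]

theorem tilt_transpose_mul {z : ℝ} (hz : z ∈ Icc (-1 : ℝ) 1) : (tilt z)ᵀ * tilt z = 1 := by
  have hr := radius_sq hz
  ext i j
  fin_cases i <;> fin_cases j <;> simp [tilt, Matrix.mul_apply, Fin.sum_univ_three] <;>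
    first | linear_combination hr | ring

theorem tilt_mul_transpose {z : ℝ} (hz : z ∈ Icc (-1 : ℝ) 1) : tilt z * (tilt z)ᵀ = 1 := by
  have hr := radius_sq hz
  ext i j
  fin_cases i <;> fin_cases j <;> simp [tilt, Matrix.mul_apply, Fin.sum_univ_three] <;>
    first | linear_combination hr | ring

theorem det_tilt {z : ℝ} (hz : z ∈ Icc (-1 : ℝ) 1) : (tilt z).det = 1 := by
  have hr := radius_sq hz
  simp [tilt, Matrix.det_fin_three]
  linear_combination hr

theorem tilt_mulVec_axis (z : ℝ) : tilt z *ᵥ ![0, 0, 1] = ![radius z, 0, z] := by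
  ext i; fin_cases i <;> simp [tilt, Matrix.mulVec, dotProduct, Fin.sum_univ_three]

/-! ## The torus action in adapted coordinates -/

/-- The derivative of the precession angle with respect to the reduced angle. -/
def precession (b : ℝ) (D : ℝ × ℝ) (C : ℝ) : ℝ :=
  Real.sqrt D.2 * levelHeight b D C / ((1 - levelHeight b D C ^ 2) * levelRate b D C)

/-- The derivative of the angle of the nodal line in space with respect to the reduced angle. -/
def nodal (b : ℝ) (D : ℝ × ℝ) (C : ℝ) : ℝ :=
  Real.sqrt D.2 / ((1 - levelHeight b D C ^ 2) * levelRate b D C)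

section flow

variable {m : ℕ} (b : ℝ) (v Γ : Fin (m + 1) → ℝ)

/-- The addition formulas shift the reduced angle without choosing a representative of it. -/
def shiftCos (φ : ℝ) : ℝ := angleCos b v Γ * Real.cos φ - angleSin b v Γ * Real.sin φ

def shiftSin (φ : ℝ) : ℝ := angleSin b v Γ * Real.cos φ + angleCos b v Γ * Real.sin φ

/-- The increment of an angle, corrected so that it becomes an angle of the torus. -/
def shiftAngle (ρ : ℝ × ℝ → ℝ → ℝ) (φ : ℝ) : ℝ :=
  increment ρ (integrals b v Γ) (angleCos b v Γ) (angleSin b v Γ) φ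

def flowFrame (φ₁ φ₂ : ℝ) : Matrix (Fin (m + 1)) (Fin 3) ℝ :=
  frame b v Γ * rotZ (φ₂ + shiftAngle b v Γ (precession b) φ₁)

def flowVel (φ₁ φ₂ : ℝ) : Fin (m + 1) → ℝ :=
  flowFrame b v Γ φ₁ φ₂ *ᵥ levelVel b (integrals b v Γ) (shiftCos b v Γ φ₁) (shiftSin b v Γ φ₁)

def flowDir (φ₁ φ₂ : ℝ) : Fin (m + 1) → ℝ :=
  flowFrame b v Γ φ₁ φ₂ *ᵥ levelDir b (integrals b v Γ) (shiftCos b v Γ φ₁)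

/-- The action on attitudes, `g` being the attitude at the state `(v, Γ)`. -/
def flowAtt (g : Matrix (Fin (m + 1)) (Fin (m + 1)) ℝ) (φ₁ φ₂ φ₃ : ℝ) :
    Matrix (Fin (m + 1)) (Fin (m + 1)) ℝ :=
  g * (1 - frame b v Γ * (frame b v Γ)ᵀ) +
    g * frame b v Γ * (tilt (height Γ) * rotZ (φ₃ + shiftAngle b v Γ (nodal b) φ₁) *
      (tilt (levelHeight b (integrals b v Γ) (shiftCos b v Γ φ₁)))ᵀ) * (flowFrame b v Γ φ₁ φ₂)ᵀ

end flow

/-! ### Smooth dependence of the level functions on the integrals and the angle. -/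

section smooth

variable {b : ℝ} {D : ℝ × ℝ} {C : ℝ}

theorem contDiffAt_levelHeight (hD : D ∈ regularValues b) :
    ContDiffAt ℝ ∞ (fun p : (ℝ × ℝ) × ℝ => levelHeight b p.1 p.2) (D, C) := by
  have h : ContDiffAt ℝ ∞ (fun p : (ℝ × ℝ) × ℝ => turning b p.1) (D, C) :=
    ContDiffAt.comp (f := Prod.fst) (g := turning b) (D, C) (contDiffAt_turning hD) contDiffAt_fst
  unfold levelHeight
  fun_prop

theorem contDiffAt_levelRate (hD : D ∈ regularValues b) (hC : C ∈ Icc (-1 : ℝ) 1) :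
    ContDiffAt ℝ ∞ (fun p : (ℝ × ℝ) × ℝ => levelRate b p.1 p.2) (D, C) := by
  have h : ContDiffAt ℝ ∞ (fun p : (ℝ × ℝ) × ℝ => turning b p.1) (D, C) :=
    ContDiffAt.comp (f := Prod.fst) (g := turning b) (D, C) (contDiffAt_turning hD) contDiffAt_fst
  have hz := contDiffAt_levelHeight (C := C) hD
  refine ContDiffAt.sqrt ?_
    (linFactor_pos hD (Ioo_subset_Icc_self (levelHeight_mem hD hC))).ne'
  unfold linFactor
  fun_prop

theorem one_sub_levelHeight_sq_pos (hD : D ∈ regularValues b) (hC : C ∈ Icc (-1 : ℝ) 1) :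
    0 < 1 - levelHeight b D C ^ 2 := by
  have h := levelHeight_mem hD hC
  nlinarith [h.1, h.2]

theorem contDiffAt_radius {z : ℝ} (hz : z ∈ Ioo (-1 : ℝ) 1) : ContDiffAt ℝ ∞ radius z := by
  have : (1 - z ^ 2) ≠ 0 := by nlinarith [hz.1, hz.2]
  unfold radius
  exact ContDiffAt.sqrt (by fun_prop) this

theorem contDiffAt_sqrt_snd (hD : D ∈ regularValues b) :
    ContDiffAt ℝ ∞ (fun p : (ℝ × ℝ) × ℝ => Real.sqrt p.1.2) (D, C) :=
  ContDiffAt.sqrt (by fun_prop) hD.1.ne'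

theorem contDiffAt_precession (hD : D ∈ regularValues b) (hC : C ∈ Icc (-1 : ℝ) 1) :
    ContDiffAt ℝ ∞ (fun p : (ℝ × ℝ) × ℝ => precession b p.1 p.2) (D, C) := by
  have hz := contDiffAt_levelHeight (C := C) hD
  exact ((contDiffAt_sqrt_snd hD).mul hz).div
    ((contDiffAt_const.sub (hz.pow 2)).mul (contDiffAt_levelRate hD hC))
    (mul_pos (one_sub_levelHeight_sq_pos hD hC) (levelRate_pos hD hC)).ne'

theorem contDiffAt_nodal (hD : D ∈ regularValues b) (hC : C ∈ Icc (-1 : ℝ) 1) :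
    ContDiffAt ℝ ∞ (fun p : (ℝ × ℝ) × ℝ => nodal b p.1 p.2) (D, C) := by
  have hz := contDiffAt_levelHeight (C := C) hD
  exact (contDiffAt_sqrt_snd hD).div
    ((contDiffAt_const.sub (hz.pow 2)).mul (contDiffAt_levelRate hD hC))
    (mul_pos (one_sub_levelHeight_sq_pos hD hC) (levelRate_pos hD hC)).ne'

end smooth

namespace IsState

variable {m : ℕ} {b : ℝ} {v Γ : Fin (m + 1) → ℝ} {D : ℝ × ℝ}
    {B : Matrix (Fin (m + 1)) (Fin 3) ℝ} {u : ℝ}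

theorem shiftCos_eq (h : IsState b v Γ D B u) (φ : ℝ) : shiftCos b v Γ φ = Real.cos (u + φ) := by
  rw [shiftCos, h.angleCos_eq, h.angleSin_eq, Real.cos_add]

theorem shiftSin_eq (h : IsState b v Γ D B u) (φ : ℝ) : shiftSin b v Γ φ = Real.sin (u + φ) := by
  rw [shiftSin, h.angleCos_eq, h.angleSin_eq, Real.sin_add]

theorem shiftAngle_eq (h : IsState b v Γ D B u) (ρ : ℝ × ℝ → ℝ → ℝ) (φ : ℝ) :
    shiftAngle b v Γ ρ φ = increment ρ D (Real.cos u) (Real.sin u) φ := by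
  rw [shiftAngle, h.angleCos_eq, h.angleSin_eq, h.integrals_eq]

theorem flowFrame_eq (h : IsState b v Γ D B u) (φ₁ φ₂ : ℝ) : flowFrame b v Γ φ₁ φ₂ =
    B * rotZ (φ₂ + increment (precession b) D (Real.cos u) (Real.sin u) φ₁) := by
  rw [flowFrame, h.frame_eq, h.shiftAngle_eq]

/-- The torus action shifts the reduced angle and rotates the frame. -/
theorem flow (h : IsState b v Γ D B u) (φ₁ φ₂ : ℝ) :
    IsState b (flowVel b v Γ φ₁ φ₂) (flowDir b v Γ φ₁ φ₂) D (flowFrame b v Γ φ₁ φ₂) (u + φ₁) := by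
  refine ⟨h.regular, ?_, ?_, ?_, ?_⟩
  · rw [h.flowFrame_eq, Matrix.transpose_mul, Matrix.mul_assoc, ← Matrix.mul_assoc Bᵀ,
      h.orthonormal, Matrix.one_mul, rotZ_transpose_mul]
  · rw [h.flowFrame_eq, ← Matrix.mulVec_mulVec, rotZ_mulVec_axis, h.axis_eq]
  · rw [flowVel, h.integrals_eq, h.shiftCos_eq, h.shiftSin_eq]
  · rw [flowDir, h.integrals_eq, h.shiftCos_eq]

/-- Rotations about the axis commute, so the rotation angles add; their corrections combine by
`increment_add`. -/
theorem flowFrame_flow (h : IsState b v Γ D B u) (φ₁ φ₂ ψ₁ ψ₂ : ℝ) :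
    flowFrame b (flowVel b v Γ ψ₁ ψ₂) (flowDir b v Γ ψ₁ ψ₂) φ₁ φ₂ =
      flowFrame b v Γ (φ₁ + ψ₁) (φ₂ + ψ₂) := by
  rw [(h.flow ψ₁ ψ₂).flowFrame_eq, h.flowFrame_eq, h.flowFrame_eq, Matrix.mul_assoc, rotZ_mul,
    increment_add (fun C hC => contDiffAt_precession h.regular hC)]
  congr 2
  ring

theorem flowVel_flow (h : IsState b v Γ D B u) (φ₁ φ₂ ψ₁ ψ₂ : ℝ) :
    flowVel b (flowVel b v Γ ψ₁ ψ₂) (flowDir b v Γ ψ₁ ψ₂) φ₁ φ₂ =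
      flowVel b v Γ (φ₁ + ψ₁) (φ₂ + ψ₂) := by
  rw [((h.flow ψ₁ ψ₂).flow φ₁ φ₂).vel, (h.flow (φ₁ + ψ₁) (φ₂ + ψ₂)).vel, h.flowFrame_flow]
  congr 3 <;> ring

theorem flowDir_flow (h : IsState b v Γ D B u) (φ₁ φ₂ ψ₁ ψ₂ : ℝ) :
    flowDir b (flowVel b v Γ ψ₁ ψ₂) (flowDir b v Γ ψ₁ ψ₂) φ₁ φ₂ =
      flowDir b v Γ (φ₁ + ψ₁) (φ₂ + ψ₂) := by
  rw [((h.flow ψ₁ ψ₂).flow φ₁ φ₂).dir, (h.flow (φ₁ + ψ₁) (φ₂ + ψ₂)).dir, h.flowFrame_flow]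
  congr 3; ring

theorem increment_zero (ρ : ℝ × ℝ → ℝ → ℝ) (D : ℝ × ℝ) (c s : ℝ) : increment ρ D c s 0 = 0 := by
  simp [increment]

theorem flowFrame_zero (h : IsState b v Γ D B u) : flowFrame b v Γ 0 0 = B := by
  rw [h.flowFrame_eq, increment_zero, add_zero, rotZ_zero, Matrix.mul_one]

theorem flowVel_zero (h : IsState b v Γ D B u) : flowVel b v Γ 0 0 = v := by
  rw [(h.flow 0 0).vel, h.flowFrame_zero, add_zero, ← h.vel]

theorem flowDir_zero (h : IsState b v Γ D B u) : flowDir b v Γ 0 0 = Γ := by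
  rw [(h.flow 0 0).dir, h.flowFrame_zero, add_zero, ← h.dir]

theorem eq_of_mul_eq {M N : Matrix (Fin 3) (Fin 3) ℝ} (h : IsState b v Γ D B u)
    (hMN : B * M = B * N) : M = N := by
  have := congrArg (fun T => Bᵀ * T) hMN
  simpa only [← Matrix.mul_assoc, h.orthonormal, Matrix.one_mul] using this

/-- The periods of the torus action. -/
theorem flow_eq_self_iff (h : IsState b v Γ D B u) (φ₁ φ₂ : ℝ) :
    (flowVel b v Γ φ₁ φ₂ = v ∧ flowDir b v Γ φ₁ φ₂ = Γ) ↔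
      (∃ N : ℤ, φ₁ = 2 * Real.pi * N) ∧ ∃ N : ℤ, φ₂ = 2 * Real.pi * N := by
  have hf := h.flow φ₁ φ₂
  constructor
  · rintro ⟨hv, hΓ⟩
    have hc := hf.angleCos_eq
    have hs := hf.angleSin_eq
    have hB := hf.frame_eq
    rw [hv, hΓ] at hc hs hB
    rw [h.angleCos_eq] at hc
    rw [h.angleSin_eq] at hs
    obtain ⟨N, hN⟩ := exists_int_of_cos_sin hc.symm hs.symm
    refine ⟨⟨N, hN⟩, rotZ_eq_one_iff.1 (h.eq_of_mul_eq ?_)⟩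
    rw [h.frame_eq, h.flowFrame_eq, hN,
      increment_period (fun C hC => contDiffAt_precession h.regular hC), add_zero] at hB
    rw [Matrix.mul_one, ← hB]
  · rintro ⟨⟨N, rfl⟩, N', rfl⟩
    have hB : flowFrame b v Γ (2 * Real.pi * N) (2 * Real.pi * N') = B := by
      rw [h.flowFrame_eq, increment_period (fun C hC => contDiffAt_precession h.regular hC),
        add_zero, rotZ_eq_one_iff.2 ⟨N', rfl⟩, Matrix.mul_one]
    have hc : Real.cos (u + 2 * Real.pi * N) = Real.cos u := by
      rw [mul_comm (2 * Real.pi)]; exact Real.cos_add_int_mul_two_pi u N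
    have hs : Real.sin (u + 2 * Real.pi * N) = Real.sin u := by
      rw [mul_comm (2 * Real.pi)]; exact Real.sin_add_int_mul_two_pi u N
    constructor
    · rw [hf.vel, hB, hc, hs, ← h.vel]
    · rw [hf.dir, hB, hc, ← h.dir]

end IsState

/-! ### The action on attitudes -/

section attitude

variable {m : ℕ} {b : ℝ} {v Γ : Fin (m + 1) → ℝ} {D : ℝ × ℝ}
    {B : Matrix (Fin (m + 1)) (Fin 3) ℝ} {u : ℝ}

namespace IsState

theorem flowAtt_eq (h : IsState b v Γ D B u) (g : Matrix (Fin (m + 1)) (Fin (m + 1)) ℝ)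
    (φ₁ φ₂ φ₃ : ℝ) : flowAtt b v Γ g φ₁ φ₂ φ₃ = g * (1 - B * Bᵀ) + g * B *
      (tilt (levelHeight b D (Real.cos u)) *
        rotZ (φ₃ + increment (nodal b) D (Real.cos u) (Real.sin u) φ₁) *
        (tilt (levelHeight b D (Real.cos (u + φ₁))))ᵀ) * (flowFrame b v Γ φ₁ φ₂)ᵀ := by
  rw [flowAtt, h.frame_eq, h.shiftAngle_eq, h.integrals_eq, h.shiftCos_eq, h.height_eq]

theorem level_mem (h : IsState b v Γ D B u) (x : ℝ) :
    levelHeight b D (Real.cos x) ∈ Icc (-1 : ℝ) 1 :=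
  Ioo_subset_Icc_self (levelHeight_mem h.regular (Real.cos_mem_Icc x))

/-- Rotating the frame does not change the space it spans. The projection to that space is thus an
invariant of the action, and attitudes are altered only on it. -/
theorem frame_proj (h : IsState b v Γ D B u) (φ₁ φ₂ : ℝ) :
    flowFrame b v Γ φ₁ φ₂ * (flowFrame b v Γ φ₁ φ₂)ᵀ = B * Bᵀ := by
  rw [h.flowFrame_eq, Matrix.transpose_mul, Matrix.mul_assoc, ← Matrix.mul_assoc (rotZ _),
    rotZ_mul_transpose, Matrix.one_mul]

theorem transpose_mul_compl (h : IsState b v Γ D B u) : Bᵀ * (1 - B * Bᵀ) = 0 := by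
  rw [Matrix.mul_sub, Matrix.mul_one, ← Matrix.mul_assoc, h.orthonormal, Matrix.one_mul, sub_self]

theorem compl_mul (h : IsState b v Γ D B u) : (1 - B * Bᵀ) * B = 0 := by
  rw [Matrix.sub_mul, Matrix.one_mul, Matrix.mul_assoc, h.orthonormal, Matrix.mul_one, sub_self]

theorem flowAtt_mul_compl (h : IsState b v Γ D B u)
    (g : Matrix (Fin (m + 1)) (Fin (m + 1)) ℝ) (φ₁ φ₂ φ₃ : ℝ) :
    flowAtt b v Γ g φ₁ φ₂ φ₃ * (1 - B * Bᵀ) = g * (1 - B * Bᵀ) := by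
  have h1 : (flowFrame b v Γ φ₁ φ₂)ᵀ * (1 - B * Bᵀ) = 0 := by
    rw [← h.frame_proj φ₁ φ₂]
    exact (h.flow φ₁ φ₂).transpose_mul_compl
  have h2 : (1 - B * Bᵀ) * (1 - B * Bᵀ) = 1 - B * Bᵀ := by
    rw [Matrix.mul_sub (1 - B * Bᵀ), Matrix.mul_one, ← Matrix.mul_assoc _ B,
      h.compl_mul, Matrix.zero_mul, sub_zero]
  rw [h.flowAtt_eq, Matrix.add_mul, Matrix.mul_assoc _ (flowFrame b v Γ φ₁ φ₂)ᵀ (1 - B * Bᵀ), h1,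
    Matrix.mul_zero, add_zero, Matrix.mul_assoc g, h2]

/-- The meaning of `flowAtt`: since `tilt z` takes the third axis to the coordinates of `Γ`, the
columns of `g B (tilt z)` form a frame in space whose third vector is `gΓ = Γ₀` and whose second
vector is the nodal line. The action turns this frame about `Γ₀`. -/
theorem flowAtt_mul_frame (h : IsState b v Γ D B u)
    (g : Matrix (Fin (m + 1)) (Fin (m + 1)) ℝ) (φ₁ φ₂ φ₃ : ℝ) :
    flowAtt b v Γ g φ₁ φ₂ φ₃ * flowFrame b v Γ φ₁ φ₂ = g * B *
      (tilt (levelHeight b D (Real.cos u)) *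
        rotZ (φ₃ + increment (nodal b) D (Real.cos u) (Real.sin u) φ₁) *
        (tilt (levelHeight b D (Real.cos (u + φ₁))))ᵀ) := by
  have h1 : (1 - B * Bᵀ) * flowFrame b v Γ φ₁ φ₂ = 0 := by
    rw [← h.frame_proj φ₁ φ₂]
    exact (h.flow φ₁ φ₂).compl_mul
  rw [h.flowAtt_eq, Matrix.add_mul, Matrix.mul_assoc g, h1, Matrix.mul_zero, zero_add,
    Matrix.mul_assoc _ _ (flowFrame b v Γ φ₁ φ₂), (h.flow φ₁ φ₂).orthonormal, Matrix.mul_one]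

/-- The intermediate `tilt` cancels against its transpose, the two rotations about `Γ₀` multiply,
and the corrections add by `increment_add`. -/
theorem flowAtt_flow (h : IsState b v Γ D B u) (g : Matrix (Fin (m + 1)) (Fin (m + 1)) ℝ)
    (φ₁ φ₂ φ₃ ψ₁ ψ₂ ψ₃ : ℝ) :
    flowAtt b (flowVel b v Γ ψ₁ ψ₂) (flowDir b v Γ ψ₁ ψ₂) (flowAtt b v Γ g ψ₁ ψ₂ ψ₃) φ₁ φ₂ φ₃ =
      flowAtt b v Γ g (φ₁ + ψ₁) (φ₂ + ψ₂) (φ₃ + ψ₃) := by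
  rw [(h.flow ψ₁ ψ₂).flowAtt_eq, h.frame_proj, h.flowAtt_mul_compl, h.flowAtt_mul_frame,
    h.flowFrame_flow, h.flowAtt_eq,
    increment_add (fun C hC => contDiffAt_nodal h.regular hC) u φ₁ ψ₁]
  have h2 := tilt_transpose_mul (h.level_mem (u + ψ₁))
  congr 2
  rw [Matrix.mul_assoc (g * B)]
  congr 1
  rw [show u + (φ₁ + ψ₁) = u + ψ₁ + φ₁ by ring]
  generalize tilt (levelHeight b D (Real.cos (u + ψ₁))) = T at *
  generalize tilt (levelHeight b D (Real.cos u)) = T₀ at *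
  generalize tilt (levelHeight b D (Real.cos (u + ψ₁ + φ₁))) = T₁ at *
  simp only [← Matrix.mul_assoc]
  rw [Matrix.mul_assoc _ Tᵀ T, h2, Matrix.mul_one, Matrix.mul_assoc T₀, rotZ_mul]
  congr 3
  ring

theorem flowAtt_zero (h : IsState b v Γ D B u) (g : Matrix (Fin (m + 1)) (Fin (m + 1)) ℝ) :
    flowAtt b v Γ g 0 0 0 = g := by
  rw [h.flowAtt_eq, h.flowFrame_zero, increment_zero, add_zero, add_zero, rotZ_zero, Matrix.mul_one,
    tilt_mul_transpose (h.level_mem u), Matrix.mul_one, Matrix.mul_assoc, ← Matrix.mul_add,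
    sub_add_cancel, Matrix.mul_one]

theorem flowAtt_period_iff (h : IsState b v Γ D B u)
    {g : Matrix (Fin (m + 1)) (Fin (m + 1)) ℝ} (hg : gᵀ * g = 1) (N₁ N₂ : ℤ) (φ₃ : ℝ) :
    flowAtt b v Γ g (2 * Real.pi * N₁) (2 * Real.pi * N₂) φ₃ = g ↔
      ∃ N : ℤ, φ₃ = 2 * Real.pi * N := by
  have hB : flowFrame b v Γ (2 * Real.pi * N₁) (2 * Real.pi * N₂) = B := by
    rw [h.flowFrame_eq, increment_period (fun C hC => contDiffAt_precession h.regular hC),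
      add_zero, rotZ_eq_one_iff.2 ⟨N₂, rfl⟩, Matrix.mul_one]
  have hc : Real.cos (u + 2 * Real.pi * N₁) = Real.cos u := by
    rw [mul_comm (2 * Real.pi)]; exact Real.cos_add_int_mul_two_pi u N₁
  have hT := tilt_transpose_mul (h.level_mem u)
  have hT' := tilt_mul_transpose (h.level_mem u)
  rw [h.flowAtt_eq, hB, hc, increment_period (fun C hC => contDiffAt_nodal h.regular hC), add_zero]
  constructor
  · intro heq
    refine rotZ_eq_one_iff.1 ?_
    have h1 : g * B * (tilt (levelHeight b D (Real.cos u)) * rotZ φ₃ *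
        (tilt (levelHeight b D (Real.cos u)))ᵀ) = g * B := by
      have := congrArg (fun T => T * B) heq
      simpa only [Matrix.add_mul, Matrix.mul_assoc _ _ B, h.compl_mul, h.orthonormal,
        Matrix.mul_zero, zero_add, Matrix.mul_one] using this
    have h2 : tilt (levelHeight b D (Real.cos u)) * rotZ φ₃ *
        (tilt (levelHeight b D (Real.cos u)))ᵀ = 1 := by
      refine h.eq_of_mul_eq ?_
      rw [Matrix.mul_one]
      have := congrArg (fun T => gᵀ * T) h1
      simpa only [← Matrix.mul_assoc, hg, Matrix.one_mul] using this
    have h3 := congrArg (fun T => (tilt (levelHeight b D (Real.cos u)))ᵀ * T *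
      tilt (levelHeight b D (Real.cos u))) h2
    simpa only [Matrix.mul_assoc, hT, Matrix.mul_one, ← Matrix.mul_assoc (tilt _)ᵀ (tilt _),
      Matrix.one_mul] using h3
  · rintro ⟨N, rfl⟩
    rw [rotZ_eq_one_iff.2 ⟨N, rfl⟩, Matrix.mul_one, hT', Matrix.mul_one, Matrix.mul_assoc,
      ← Matrix.mul_add, sub_add_cancel, Matrix.mul_one]

/-- The action preserves the special orthogonal group. -/
theorem flowAtt_mem (h : IsState b v Γ D B u) {g : Matrix (Fin (m + 1)) (Fin (m + 1)) ℝ}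
    (hg : g ∈ Matrix.specialOrthogonalGroup (Fin (m + 1)) ℝ) (φ₁ φ₂ φ₃ : ℝ) :
    flowAtt b v Γ g φ₁ φ₂ φ₃ ∈ Matrix.specialOrthogonalGroup (Fin (m + 1)) ℝ := by
  set Y := tilt (levelHeight b D (Real.cos u)) *
        rotZ (φ₃ + increment (nodal b) D (Real.cos u) (Real.sin u) φ₁) *
        (tilt (levelHeight b D (Real.cos (u + φ₁))))ᵀ *
        (rotZ (φ₂ + increment (precession b) D (Real.cos u) (Real.sin u) φ₁))ᵀ with hY
  have hYY : Y * Yᵀ = 1 := by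
    rw [hY]
    simp only [Matrix.transpose_mul, Matrix.transpose_transpose]
    simp only [Matrix.mul_assoc]
    rw [← Matrix.mul_assoc (rotZ (φ₂ + _))ᵀ, rotZ_transpose_mul, Matrix.one_mul,
      ← Matrix.mul_assoc (tilt (levelHeight b D (Real.cos (u + φ₁))))ᵀ,
      tilt_transpose_mul (h.level_mem _), Matrix.one_mul, ← Matrix.mul_assoc (rotZ _),
      rotZ_mul_transpose, Matrix.one_mul, tilt_mul_transpose (h.level_mem _)]
  have hYd : Y.det = 1 := by
    simp only [hY, Matrix.det_mul, Matrix.det_transpose, det_rotZ, det_tilt (h.level_mem _), mul_one]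
  -- The second factor is the rotation `Y` on the range of `B` and the identity on its complement.
  -- Its determinant is that of `Y`, by `det (1 + MN) = det (1 + NM)`.
  have heq : flowAtt b v Γ g φ₁ φ₂ φ₃ = g * (1 + B * ((Y - 1) * Bᵀ)) := by
    rw [h.flowAtt_eq, h.flowFrame_eq, Matrix.transpose_mul, hY]
    simp only [Matrix.mul_add, Matrix.mul_sub, Matrix.sub_mul, Matrix.mul_assoc, Matrix.one_mul]
    abel
  rw [Matrix.mem_specialOrthogonalGroup_iff] at hg ⊢
  refine ⟨?_, ?_⟩
  · rw [heq]
    refine mul_mem hg.1 ?_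
    rw [Matrix.mem_orthogonalGroup_iff]
    have e2 : ∀ M : Matrix (Fin 3) (Fin (m + 1)) ℝ, Bᵀ * (B * M) = M := fun M => by
      rw [← Matrix.mul_assoc, h.orthonormal, Matrix.one_mul]
    simp only [Matrix.transpose_add, Matrix.transpose_mul, Matrix.transpose_sub,
      Matrix.transpose_one, Matrix.transpose_transpose, Matrix.mul_add, Matrix.add_mul,
      Matrix.mul_sub, Matrix.sub_mul, Matrix.mul_assoc, Matrix.one_mul, Matrix.mul_one, e2]
    rw [← Matrix.mul_assoc Y, hYY, Matrix.one_mul]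
    abel
  · rw [heq, Matrix.det_mul, hg.2, one_mul, Matrix.det_one_add_mul_comm, Matrix.mul_assoc,
      h.orthonormal, Matrix.mul_one, add_sub_cancel, hYd]

/-- The attitude and the vertical stay compatible. -/
theorem flowAtt_transpose_mulVec (h : IsState b v Γ D B u)
    {g : Matrix (Fin (m + 1)) (Fin (m + 1)) ℝ} {Γ₀ : Fin (m + 1) → ℝ}
    (hΓ : gᵀ *ᵥ Γ₀ = Γ) (φ₁ φ₂ φ₃ : ℝ) :
    (flowAtt b v Γ g φ₁ φ₂ φ₃)ᵀ *ᵥ Γ₀ = flowDir b v Γ φ₁ φ₂ := by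
  -- `Γ` lies in the range of `B`, and its coordinates are the tilted third axis, which the rotation
  -- by `φ₃` leaves fixed.
  have hΓB : Γ = B *ᵥ (tilt (levelHeight b D (Real.cos u)) *ᵥ ![0, 0, 1]) := by
    rw [tilt_mulVec_axis, h.dir]; rfl
  have hBΓ : Bᵀ *ᵥ Γ = tilt (levelHeight b D (Real.cos u)) *ᵥ ![0, 0, 1] := by
    conv_lhs => rw [hΓB]
    rw [Matrix.mulVec_mulVec, h.orthonormal, Matrix.one_mulVec]
  rw [h.flowAtt_eq, (h.flow φ₁ φ₂).dir, Matrix.transpose_add, Matrix.add_mulVec]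
  simp only [Matrix.transpose_mul, Matrix.transpose_sub, Matrix.transpose_one,
    Matrix.transpose_transpose, ← Matrix.mulVec_mulVec]
  rw [hΓ, hBΓ, Matrix.mulVec_mulVec _ (tilt (levelHeight b D (Real.cos u)))ᵀ,
    tilt_transpose_mul (h.level_mem u), Matrix.one_mulVec, rotZ_transpose, rotZ_mulVec_axis,
    tilt_mulVec_axis]
  have : (1 - B * Bᵀ) *ᵥ Γ = 0 := by
    rw [hΓB, Matrix.mulVec_mulVec, h.compl_mul, Matrix.zero_mulVec]
  rw [this, zero_add]
  rfl

end IsState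

end attitude

/-! ## The equations of motion on the tori -/

theorem hasDerivAt_matrix {n k : Type*} [Fintype n] [Fintype k] {M : ℝ → Matrix n k ℝ}
    {M' : Matrix n k ℝ} {t : ℝ} :
    HasDerivAt M M' t ↔ ∀ i j, HasDerivAt (fun s => M s i j) (M' i j) t :=
  Iff.trans (hasDerivAt_pi (φ := fun s i => M s i) (φ' := fun i => M' i))
    (forall_congr' fun i => hasDerivAt_pi (φ := fun s j => M s i j) (φ' := fun j => M' i j))

theorem hasDerivAt_const_mul_matrix {n k l : Type*} [Fintype n] [Fintype k] [Fintype l]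
    (L : Matrix n k ℝ) {M : ℝ → Matrix k l ℝ} {M' : Matrix k l ℝ} {t : ℝ}
    (h : HasDerivAt M M' t) : HasDerivAt (fun s => L * M s) (L * M') t := by
  rw [hasDerivAt_matrix] at h ⊢
  intro i j
  simp only [Matrix.mul_apply]
  exact HasDerivAt.fun_sum fun a _ => (h a j).const_mul _

theorem hasDerivAt_matrix_mul_const {n k l : Type*} [Fintype n] [Fintype k] [Fintype l]
    {M : ℝ → Matrix n k ℝ} {M' : Matrix n k ℝ} {t : ℝ}
    (h : HasDerivAt M M' t) (R : Matrix k l ℝ) : HasDerivAt (fun s => M s * R) (M' * R) t := by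
  rw [hasDerivAt_matrix] at h ⊢
  intro i j
  simp only [Matrix.mul_apply]
  exact HasDerivAt.fun_sum fun a _ => (h i a).mul_const _

theorem hasDerivAt_const_mulVec {n k : Type*} [Fintype n] [Fintype k]
    (L : Matrix n k ℝ) {x : ℝ → k → ℝ} {x' : k → ℝ} {t : ℝ}
    (h : HasDerivAt x x' t) : HasDerivAt (fun s => L *ᵥ x s) (L *ᵥ x') t := by
  rw [hasDerivAt_pi] at h ⊢
  intro i
  simp only [Matrix.mulVec, dotProduct]
  exact HasDerivAt.fun_sum fun a _ => (h a).const_mul _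

/-- The velocity of the height. -/
def levelSpeed (b : ℝ) (D : ℝ × ℝ) (u : ℝ) : ℝ :=
  (turning b D).2 * Real.sin u * levelRate b D (Real.cos u)

section level

variable {b : ℝ} {D : ℝ × ℝ} {u : ℝ → ℝ} {t : ℝ}

/-- The equality of the coefficients of `z` in the factorization, read off from the values at `±1`.
-/
theorem turning_relation (hD : D ∈ regularValues b) :
    (turning b D).1 * (2 * D.1 - 4 * b * (turning b D).1) =
      b * ((turning b D).2 ^ 2 - 1 - (turning b D).1 ^ 2) := by
  have h1 := (isTurning_turning hD).factor 1
  have h2 := (isTurning_turning hD).factor (-1)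
  unfold cubic at h1 h2
  linear_combination (h2 - h1) / 4

theorem hasDerivAt_levelHeight (hu : HasDerivAt u (levelRate b D (Real.cos (u t))) t) :
    HasDerivAt (fun s => levelHeight b D (Real.cos (u s))) (levelSpeed b D (u t)) t := by
  have := (hu.cos.const_mul (turning b D).2).const_sub (turning b D).1
  unfold levelHeight
  convert! this using 1
  simp only [levelSpeed]; ring

theorem hasDerivAt_radius (hD : D ∈ regularValues b)
    (hu : HasDerivAt u (levelRate b D (Real.cos (u t))) t) :
    HasDerivAt (fun s => radius (levelHeight b D (Real.cos (u s))))
      (-(levelHeight b D (Real.cos (u t)) * levelSpeed b D (u t) /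
        radius (levelHeight b D (Real.cos (u t))))) t := by
  have hz := levelHeight_mem hD (Real.cos_mem_Icc (u t))
  have hr := radius_pos hz
  have h1 := ((hasDerivAt_levelHeight hu).pow 2).const_sub 1
  have h2 := h1.sqrt (by have := radius_sq (Ioo_subset_Icc_self hz); simp only [Pi.pow_apply]; rw [← this]; positivity)
  convert! h2 using 1
  simp only [Pi.pow_apply]
  rw [← radius]
  field_simp
  simp
  ring

theorem hasDerivAt_levelRate (hD : D ∈ regularValues b)
    (hu : HasDerivAt u (levelRate b D (Real.cos (u t))) t) :
    HasDerivAt (fun s => levelRate b D (Real.cos (u s)))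
      (-(b * (turning b D).2 * Real.sin (u t))) t := by
  have hq := levelRate_pos hD (Real.cos_mem_Icc (u t))
  have h1 : HasDerivAt (fun s => linFactor b D (levelHeight b D (Real.cos (u s))))
      (-(2 * b * levelSpeed b D (u t))) t := by
    unfold linFactor
    exact ((hasDerivAt_levelHeight hu).const_mul (2 * b)).const_sub _
  have h2 := h1.sqrt (by
    have := levelRate_sq hD (Real.cos_mem_Icc (u t)); rw [← this]; positivity)
  convert! h2 using 1
  rw [← levelRate, levelSpeed]
  field_simp

/-- The value is half the derivative of the cubic. Differentiating `a sin u · q` rather than `ż² =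
cubic z` avoids dividing by `ż`, which vanishes at the turning points. -/
theorem hasDerivAt_levelSpeed (hD : D ∈ regularValues b)
    (hu : HasDerivAt u (levelRate b D (Real.cos (u t))) t) :
    HasDerivAt (fun s => levelSpeed b D (u s))
      (-b * (1 - levelHeight b D (Real.cos (u t)) ^ 2) - 2 * levelHeight b D (Real.cos (u t)) *
        (D.1 - b * levelHeight b D (Real.cos (u t)))) t := by
  have h := (hu.sin.const_mul (turning b D).2).mul (hasDerivAt_levelRate hD hu)
  unfold levelSpeed
  convert! h using 1
  have hq := levelRate_sq hD (Real.cos_mem_Icc (u t))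
  have hrel := turning_relation hD
  have hs := Real.sin_sq_add_cos_sq (u t)
  rw [linFactor] at hq
  simp only [levelHeight] at hq ⊢
  generalize (turning b D).1 = s at *
  generalize (turning b D).2 = a at *
  generalize levelRate b D (Real.cos (u t)) = q at *
  generalize Real.cos (u t) = c at *
  generalize Real.sin (u t) = σ at *
  linear_combination (-(a * c)) * hq - hrel + b * a ^ 2 * hs

theorem rotZ_mul_tilt_mul_rotZ (β z α : ℝ) : rotZ β * (tilt z)ᵀ * (rotZ α)ᵀ = !![
    Real.cos β * z * Real.cos α + Real.sin β * Real.sin α,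
    Real.cos β * z * Real.sin α - Real.sin β * Real.cos α, -(Real.cos β * radius z);
    Real.sin β * z * Real.cos α - Real.cos β * Real.sin α,
    Real.sin β * z * Real.sin α + Real.cos β * Real.cos α, -(Real.sin β * radius z);
    radius z * Real.cos α, radius z * Real.sin α, z] := by
  ext i j
  fin_cases i <;> fin_cases j <;>
    simp only [rotZ, tilt, Matrix.mul_apply, Fin.sum_univ_three, Matrix.transpose_apply,
      Matrix.of_apply, Matrix.cons_val, Fin.zero_eta, Fin.mk_one, Fin.reduceFinMk] <;> ring

variable {α β : ℝ → ℝ}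

/-- In coordinates of a constant frame this is `Γ' = -z v + (v ⬝ Γ) eₙ`. The prescribed rate of `α`
accounts for the part of `γ' = -z v` normal to `γ`. -/
theorem hasDerivAt_rotZ_levelDir (hD : D ∈ regularValues b)
    (hu : HasDerivAt u (levelRate b D (Real.cos (u t))) t)
    (hα : HasDerivAt α (Real.sqrt D.2 * levelHeight b D (Real.cos (u t)) /
      radius (levelHeight b D (Real.cos (u t))) ^ 2) t) :
    HasDerivAt (fun s => rotZ (α s) *ᵥ levelDir b D (Real.cos (u s)))
      (rotZ (α t) *ᵥ (-levelHeight b D (Real.cos (u t)) • levelVel b D (Real.cos (u t))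
        (Real.sin (u t)) + levelSpeed b D (u t) • ![0, 0, 1])) t := by
  have hz := levelHeight_mem hD (Real.cos_mem_Icc (u t))
  have hr := radius_pos hz
  have dr := hasDerivAt_radius hD hu
  have dz := hasDerivAt_levelHeight hu
  rw [hasDerivAt_pi]
  intro i
  fin_cases i
  · simp only [rotZ, levelDir, levelVel, Matrix.mulVec, dotProduct, Fin.sum_univ_three,
      Fin.zero_eta, Matrix.of_apply, Matrix.cons_val, Pi.add_apply, Pi.smul_apply, smul_eq_mul,
      Matrix.cons_val_zero, mul_zero, add_zero, zero_mul]
    convert! hα.cos.mul dr using 1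
    rw [← levelSpeed]
    field_simp
    ring
  · simp only [rotZ, levelDir, levelVel, Matrix.mulVec, dotProduct, Fin.sum_univ_three,
      Fin.mk_one, Matrix.of_apply, Matrix.cons_val, Pi.add_apply, Pi.smul_apply, smul_eq_mul,
      mul_zero, add_zero, zero_mul]
    convert! hα.sin.mul dr using 1
    rw [← levelSpeed]
    field_simp
    ring
  · simp only [rotZ, levelDir, levelVel, Matrix.mulVec, dotProduct, Fin.sum_univ_three,
      Fin.reduceFinMk, Matrix.of_apply, Matrix.cons_val, Pi.add_apply, Pi.smul_apply, smul_eq_mul,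
      mul_zero, add_zero, zero_add, zero_mul, one_mul, mul_one]
    exact dz

/-- In coordinates of a constant frame this is `v' = -b γ`. Beyond the rates it uses `y² + p² = 2 (h
- b z) r²`, which cancels the terms containing `z`. -/
theorem hasDerivAt_rotZ_levelVel (hD : D ∈ regularValues b)
    (hu : HasDerivAt u (levelRate b D (Real.cos (u t))) t)
    (hα : HasDerivAt α (Real.sqrt D.2 * levelHeight b D (Real.cos (u t)) /
      radius (levelHeight b D (Real.cos (u t))) ^ 2) t) :
    HasDerivAt (fun s => rotZ (α s) *ᵥ levelVel b D (Real.cos (u s)) (Real.sin (u s)))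
      (rotZ (α t) *ᵥ (b • (levelHeight b D (Real.cos (u t)) • ![0, 0, 1] -
        levelDir b D (Real.cos (u t))))) t := by
  have hz := levelHeight_mem hD (Real.cos_mem_Icc (u t))
  have hr := radius_pos hz
  have hr2 := radius_sq (Ioo_subset_Icc_self hz)
  have hy2 := levelVel_sq hD (u t)
  have hp2 := Real.sq_sqrt hD.1.le
  rw [← levelSpeed, cubic, ← hr2] at hy2
  have dr := hasDerivAt_radius hD hu
  have dy := (hasDerivAt_levelSpeed hD hu).div dr hr.ne'
  have dp := (hasDerivAt_const t (-Real.sqrt D.2)).div dr hr.ne'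
  rw [← hr2] at dy
  rw [hasDerivAt_pi]
  intro i
  fin_cases i
  · simp only [rotZ, levelDir, levelVel, Matrix.mulVec, dotProduct, Fin.sum_univ_three,
      Fin.zero_eta, Matrix.of_apply, Matrix.cons_val, Pi.sub_apply, Pi.smul_apply, smul_eq_mul,
      Matrix.cons_val_zero, mul_zero, add_zero, zero_mul]
    convert! (hα.cos.mul dy).add (hα.sin.neg.mul dp) using 1
    simp only [Pi.div_apply, Pi.neg_apply]
    generalize radius (levelHeight b D (Real.cos (u t))) = r at *
    generalize levelSpeed b D (u t) = y at *
    generalize levelHeight b D (Real.cos (u t)) = z at *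
    generalize Real.sqrt D.2 = p at *
    field_simp
    linear_combination (-(z * Real.cos (α t))) * hy2 - (z * Real.cos (α t)) * hp2
  · simp only [rotZ, levelDir, levelVel, Matrix.mulVec, dotProduct, Fin.sum_univ_three,
      Fin.mk_one, Matrix.of_apply, Matrix.cons_val, Pi.sub_apply, Pi.smul_apply, smul_eq_mul,
      mul_zero, add_zero, zero_mul]
    convert! (hα.sin.mul dy).add (hα.cos.mul dp) using 1
    simp only [Pi.div_apply]
    generalize radius (levelHeight b D (Real.cos (u t))) = r at *
    generalize levelSpeed b D (u t) = y at *
    generalize levelHeight b D (Real.cos (u t)) = z at *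
    generalize Real.sqrt D.2 = p at *
    field_simp
    linear_combination (-(z * Real.sin (α t))) * hy2 - (z * Real.sin (α t)) * hp2
  · simp only [rotZ, levelDir, levelVel, Matrix.mulVec, dotProduct, Fin.sum_univ_three,
      Fin.reduceFinMk, Matrix.of_apply, Matrix.cons_val, Pi.sub_apply, Pi.smul_apply, smul_eq_mul,
      mul_zero, add_zero, zero_mul, mul_one, sub_self]
    exact hasDerivAt_const t 0

/-- Since `α' = z β'`, the spins about `eₙ` due to `β` and to `α` cancel, and the angular velocity
in the body has no component in the horizontal plane, as the constraints demand; what remains is `v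
∧ eₙ`. -/
theorem hasDerivAt_attitude (hD : D ∈ regularValues b)
    (hu : HasDerivAt u (levelRate b D (Real.cos (u t))) t)
    (hα : HasDerivAt α (Real.sqrt D.2 * levelHeight b D (Real.cos (u t)) /
      radius (levelHeight b D (Real.cos (u t))) ^ 2) t)
    (hβ : HasDerivAt β (Real.sqrt D.2 / radius (levelHeight b D (Real.cos (u t))) ^ 2) t) :
    HasDerivAt (fun s => rotZ (β s) * (tilt (levelHeight b D (Real.cos (u s))))ᵀ * (rotZ (α s))ᵀ)
      (rotZ (β t) * (tilt (levelHeight b D (Real.cos (u t))))ᵀ *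
        (Matrix.vecMulVec (levelVel b D (Real.cos (u t)) (Real.sin (u t))) ![0, 0, 1] -
          Matrix.vecMulVec ![0, 0, 1] (levelVel b D (Real.cos (u t)) (Real.sin (u t)))) *
        (rotZ (α t))ᵀ) t := by
  have hz := levelHeight_mem hD (Real.cos_mem_Icc (u t))
  have hr := radius_pos hz
  have hr2 := radius_sq (Ioo_subset_Icc_self hz)
  have dr := hasDerivAt_radius hD hu
  have dz := hasDerivAt_levelHeight hu
  have ca := hα.cos
  have sa := hα.sin
  have cb := hβ.cos
  have sb := hβ.sin
  simp only [rotZ_mul_tilt_mul_rotZ]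
  have hW : Matrix.vecMulVec (levelVel b D (Real.cos (u t)) (Real.sin (u t))) ![0, 0, 1] -
      Matrix.vecMulVec ![0, 0, 1] (levelVel b D (Real.cos (u t)) (Real.sin (u t))) =
      !![0, 0, levelSpeed b D (u t) / radius (levelHeight b D (Real.cos (u t)));
        0, 0, -Real.sqrt D.2 / radius (levelHeight b D (Real.cos (u t)));
        -(levelSpeed b D (u t) / radius (levelHeight b D (Real.cos (u t)))),
        Real.sqrt D.2 / radius (levelHeight b D (Real.cos (u t))), 0] := by
    ext i j
    fin_cases i <;> fin_cases j <;> simp [levelVel, levelSpeed, neg_div]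
  rw [hW, hasDerivAt_matrix]
  have h00 := ((cb.mul dz).mul ca).add (sb.mul sa)
  have h01 := ((cb.mul dz).mul sa).sub (sb.mul ca)
  have h02 := (cb.mul dr).neg
  have h10 := ((sb.mul dz).mul ca).sub (cb.mul sa)
  have h11 := ((sb.mul dz).mul sa).add (cb.mul ca)
  have h12 := (sb.mul dr).neg
  have h20 := dr.mul ca
  have h21 := dr.mul sa
  generalize levelSpeed b D (u t) = y at *
  generalize Real.sqrt D.2 = p at *
  intro i j
  fin_cases i <;> fin_cases j <;>
    simp only [rotZ, tilt, Matrix.mul_apply, Fin.sum_univ_three, Matrix.transpose_apply,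
      Matrix.of_apply, Matrix.cons_val, Fin.zero_eta, Fin.mk_one, Fin.reduceFinMk,
      mul_zero, zero_mul, add_zero, zero_add, mul_one, one_mul]
  · convert! h00 using 1
    simp only [Pi.mul_apply]
    generalize radius (levelHeight b D (Real.cos (u t))) = r at *
    generalize levelHeight b D (Real.cos (u t)) = z at *
    field_simp
    linear_combination (Real.cos (β t) * Real.sin (α t) * p) * hr2
  · convert! h01 using 1
    simp only [Pi.mul_apply]
    generalize radius (levelHeight b D (Real.cos (u t))) = r at *
    generalize levelHeight b D (Real.cos (u t)) = z at *
    field_simp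
    linear_combination (-(Real.cos (β t) * Real.cos (α t) * p)) * hr2
  · convert! h02 using 1
    generalize radius (levelHeight b D (Real.cos (u t))) = r at *
    generalize levelHeight b D (Real.cos (u t)) = z at *
    field_simp
    ring
  · convert! h10 using 1
    simp only [Pi.mul_apply]
    generalize radius (levelHeight b D (Real.cos (u t))) = r at *
    generalize levelHeight b D (Real.cos (u t)) = z at *
    field_simp
    linear_combination (Real.sin (β t) * Real.sin (α t) * p) * hr2
  · convert! h11 using 1
    simp only [Pi.mul_apply]
    generalize radius (levelHeight b D (Real.cos (u t))) = r at *
    generalize levelHeight b D (Real.cos (u t)) = z at *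
    field_simp
    linear_combination (-(Real.sin (β t) * Real.cos (α t) * p)) * hr2
  · convert! h12 using 1
    generalize radius (levelHeight b D (Real.cos (u t))) = r at *
    generalize levelHeight b D (Real.cos (u t)) = z at *
    field_simp
    ring
  · convert! h20 using 1
    generalize radius (levelHeight b D (Real.cos (u t))) = r at *
    generalize levelHeight b D (Real.cos (u t)) = z at *
    field_simp
  · convert! h21 using 1
    generalize radius (levelHeight b D (Real.cos (u t))) = r at *
    generalize levelHeight b D (Real.cos (u t)) = z at *
    field_simp
  · convert! dz using 1
    field_simp

end level

namespace IsState

variable {m : ℕ} {b : ℝ} {v Γ : Fin (m + 1) → ℝ} {D : ℝ × ℝ}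
    {B : Matrix (Fin (m + 1)) (Fin 3) ℝ} {u : ℝ} {φ₁ φ₂ φ₃ : ℝ → ℝ} {t : ℝ}

/-- The linear angle advances at the mean rate and the increment supplies the deviation `ρ -
meanRate ρ D`, both multiplied by the velocity of the reduced angle. -/
theorem hasDerivAt_angle {ρ : ℝ × ℝ → ℝ → ℝ}
    (hρ : ∀ C ∈ Icc (-1 : ℝ) 1, ContDiffAt ℝ ∞ (fun p : (ℝ × ℝ) × ℝ => ρ p.1 p.2) (D, C))
    (h1 : HasDerivAt φ₁ (levelRate b D (Real.cos (u + φ₁ t))) t)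
    (h2 : HasDerivAt φ₂ (meanRate ρ D * levelRate b D (Real.cos (u + φ₁ t))) t) :
    HasDerivAt (fun s => φ₂ s + increment ρ D (Real.cos u) (Real.sin u) (φ₁ s))
      (ρ D (Real.cos (u + φ₁ t)) * levelRate b D (Real.cos (u + φ₁ t))) t := by
  convert! h2.add ((hasDerivAt_increment hρ u (φ₁ t)).comp t h1) using 1
  ring

theorem hasDerivAt_precession (h : IsState b v Γ D B u)
    (h1 : HasDerivAt φ₁ (levelRate b D (Real.cos (u + φ₁ t))) t)
    (h2 : HasDerivAt φ₂ (meanRate (precession b) D * levelRate b D (Real.cos (u + φ₁ t))) t) :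
    HasDerivAt (fun s => φ₂ s + increment (precession b) D (Real.cos u) (Real.sin u) (φ₁ s))
      (Real.sqrt D.2 * levelHeight b D (Real.cos (u + φ₁ t)) /
        radius (levelHeight b D (Real.cos (u + φ₁ t))) ^ 2) t := by
  have hq := levelRate_pos h.regular (Real.cos_mem_Icc (u + φ₁ t))
  convert! hasDerivAt_angle (fun C hC => contDiffAt_precession h.regular hC) h1 h2 using 1
  rw [precession, ← radius_sq (h.level_mem (u + φ₁ t))]
  field_simp

theorem hasDerivAt_nodal (h : IsState b v Γ D B u)
    (h1 : HasDerivAt φ₁ (levelRate b D (Real.cos (u + φ₁ t))) t)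
    (h2 : HasDerivAt φ₂ (meanRate (nodal b) D * levelRate b D (Real.cos (u + φ₁ t))) t) :
    HasDerivAt (fun s => φ₂ s + increment (nodal b) D (Real.cos u) (Real.sin u) (φ₁ s))
      (Real.sqrt D.2 / radius (levelHeight b D (Real.cos (u + φ₁ t))) ^ 2) t := by
  have hq := levelRate_pos h.regular (Real.cos_mem_Icc (u + φ₁ t))
  convert! hasDerivAt_angle (fun C hC => contDiffAt_nodal h.regular hC) h1 h2 using 1
  rw [nodal, ← radius_sq (h.level_mem (u + φ₁ t))]
  field_simp

theorem hasDerivAt_flowVel (h : IsState b v Γ D B u)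
    (h1 : HasDerivAt φ₁ (levelRate b D (Real.cos (u + φ₁ t))) t)
    (h2 : HasDerivAt φ₂ (meanRate (precession b) D * levelRate b D (Real.cos (u + φ₁ t))) t) :
    HasDerivAt (fun s => flowVel b v Γ (φ₁ s) (φ₂ s))
      (b • (height (flowDir b v Γ (φ₁ t) (φ₂ t)) • axis m - flowDir b v Γ (φ₁ t) (φ₂ t))) t := by
  have hf := h.flow (φ₁ t) (φ₂ t)
  have key := hasDerivAt_const_mulVec B (hasDerivAt_rotZ_levelVel h.regular
    (u := fun s => u + φ₁ s) (h1.const_add u) (h.hasDerivAt_precession h1 h2))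
  convert! key using 1
  · ext1 s
    rw [(h.flow (φ₁ s) (φ₂ s)).vel, h.flowFrame_eq, Matrix.mulVec_mulVec]
  · rw [Matrix.mulVec_mulVec, ← h.flowFrame_eq, Matrix.mulVec_smul, Matrix.mulVec_sub,
      Matrix.mulVec_smul, hf.axis_eq, ← hf.dir, ← hf.height_eq]

theorem hasDerivAt_flowDir (h : IsState b v Γ D B u)
    (h1 : HasDerivAt φ₁ (levelRate b D (Real.cos (u + φ₁ t))) t)
    (h2 : HasDerivAt φ₂ (meanRate (precession b) D * levelRate b D (Real.cos (u + φ₁ t))) t) :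
    HasDerivAt (fun s => flowDir b v Γ (φ₁ s) (φ₂ s))
      (-height (flowDir b v Γ (φ₁ t) (φ₂ t)) • flowVel b v Γ (φ₁ t) (φ₂ t) +
        (flowVel b v Γ (φ₁ t) (φ₂ t) ⬝ᵥ flowDir b v Γ (φ₁ t) (φ₂ t)) • axis m) t := by
  have hf := h.flow (φ₁ t) (φ₂ t)
  have key := hasDerivAt_const_mulVec B (hasDerivAt_rotZ_levelDir h.regular
    (u := fun s => u + φ₁ s) (h1.const_add u) (h.hasDerivAt_precession h1 h2))
  convert! key using 1
  · ext1 s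
    rw [(h.flow (φ₁ s) (φ₂ s)).dir, h.flowFrame_eq, Matrix.mulVec_mulVec]
  · rw [Matrix.mulVec_mulVec, ← h.flowFrame_eq, Matrix.mulVec_add, Matrix.mulVec_smul,
      Matrix.mulVec_smul, hf.axis_eq, ← hf.vel, ← hf.height_eq, hf.vel_dotProduct_dir]
    rfl

theorem hasDerivAt_flowAtt (h : IsState b v Γ D B u)
    (g : Matrix (Fin (m + 1)) (Fin (m + 1)) ℝ)
    (h1 : HasDerivAt φ₁ (levelRate b D (Real.cos (u + φ₁ t))) t)
    (h2 : HasDerivAt φ₂ (meanRate (precession b) D * levelRate b D (Real.cos (u + φ₁ t))) t)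
    (h3 : HasDerivAt φ₃ (meanRate (nodal b) D * levelRate b D (Real.cos (u + φ₁ t))) t) :
    HasDerivAt (fun s => flowAtt b v Γ g (φ₁ s) (φ₂ s) (φ₃ s))
      (flowAtt b v Γ g (φ₁ t) (φ₂ t) (φ₃ t) * wedge (flowVel b v Γ (φ₁ t) (φ₂ t)) (axis m)) t := by
  have hf := h.flow (φ₁ t) (φ₂ t)
  have key := (hasDerivAt_matrix_mul_const (hasDerivAt_const_mul_matrix
    (g * B * tilt (levelHeight b D (Real.cos u)))
    (hasDerivAt_attitude h.regular (u := fun s => u + φ₁ s) (h1.const_add u)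
      (h.hasDerivAt_precession h1 h2) (h.hasDerivAt_nodal h1 h3))) Bᵀ).const_add
      (g * (1 - B * Bᵀ))
  have hw : wedge (flowVel b v Γ (φ₁ t) (φ₂ t)) (axis m) = flowFrame b v Γ (φ₁ t) (φ₂ t) *
      (Matrix.vecMulVec (levelVel b D (Real.cos (u + φ₁ t)) (Real.sin (u + φ₁ t))) ![0, 0, 1] -
        Matrix.vecMulVec ![0, 0, 1] (levelVel b D (Real.cos (u + φ₁ t)) (Real.sin (u + φ₁ t)))) *
      (flowFrame b v Γ (φ₁ t) (φ₂ t))ᵀ := by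
    rw [wedge, Matrix.mul_sub, Matrix.sub_mul, Matrix.mul_vecMulVec, Matrix.mul_vecMulVec,
      Matrix.vecMulVec_mul, Matrix.vecMulVec_mul, Matrix.vecMul_transpose, Matrix.vecMul_transpose,
      hf.axis_eq, ← hf.vel]
  convert! key using 1
  · ext1 s
    rw [h.flowAtt_eq, h.flowFrame_eq, Matrix.transpose_mul]
    simp only [Matrix.mul_assoc]
  · rw [hw, ← Matrix.mul_assoc, ← Matrix.mul_assoc, h.flowAtt_mul_frame, h.flowFrame_eq,
      Matrix.transpose_mul]
    simp only [Matrix.mul_assoc]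

end IsState

/-! ## Smoothness of the action -/

section smooth

variable {W : Type*} [NormedAddCommGroup W] [NormedSpace ℝ W] {w : W}

theorem contDiffAt_matrix {n k : Type*} [Fintype n] [Fintype k] {M : W → Matrix n k ℝ} :
    ContDiffAt ℝ ∞ M w ↔ ∀ i j, ContDiffAt ℝ ∞ (fun x => M x i j) w :=
  Iff.trans (contDiffAt_pi (Φ := fun x i => M x i))
    (forall_congr' fun i => contDiffAt_pi (Φ := fun x j => M x i j))

theorem contDiffAt_matrix_mul {n k l : Type*} [Fintype n] [Fintype k] [Fintype l]
    {M : W → Matrix n k ℝ} {N : W → Matrix k l ℝ} (hM : ContDiffAt ℝ ∞ M w)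
    (hN : ContDiffAt ℝ ∞ N w) : ContDiffAt ℝ ∞ (fun x => M x * N x) w := by
  rw [contDiffAt_matrix] at *
  intro i j
  simp only [Matrix.mul_apply]
  exact ContDiffAt.sum fun a _ => (hM i a).mul (hN a j)

theorem contDiffAt_matrix_transpose {n k : Type*} [Fintype n] [Fintype k]
    {M : W → Matrix n k ℝ} (hM : ContDiffAt ℝ ∞ M w) : ContDiffAt ℝ ∞ (fun x => (M x)ᵀ) w := by
  rw [contDiffAt_matrix] at *
  exact fun i j => hM j i

theorem contDiffAt_dotProduct {n : Type*} [Fintype n] {x y : W → n → ℝ}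
    (hx : ContDiffAt ℝ ∞ x w) (hy : ContDiffAt ℝ ∞ y w) :
    ContDiffAt ℝ ∞ (fun p => x p ⬝ᵥ y p) w := by
  rw [contDiffAt_pi] at *
  exact ContDiffAt.sum fun a _ => (hx a).mul (hy a)

theorem contDiffAt_mulVec {n k : Type*} [Fintype n] [Fintype k]
    {M : W → Matrix n k ℝ} {x : W → k → ℝ} (hM : ContDiffAt ℝ ∞ M w)
    (hx : ContDiffAt ℝ ∞ x w) : ContDiffAt ℝ ∞ (fun p => M p *ᵥ x p) w := by
  rw [contDiffAt_matrix] at hM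
  rw [contDiffAt_pi] at *
  exact fun i => ContDiffAt.sum fun a _ => (hM i a).mul (hx a)

theorem contDiffAt_rotZ {α : W → ℝ} (hα : ContDiffAt ℝ ∞ α w) :
    ContDiffAt ℝ ∞ (fun p => rotZ (α p)) w := by
  rw [contDiffAt_matrix]
  intro i j
  fin_cases i <;> fin_cases j <;> simp [rotZ] <;> fun_prop

theorem contDiffAt_tilt {z : W → ℝ} (hz : ContDiffAt ℝ ∞ z w) (hzw : z w ∈ Ioo (-1 : ℝ) 1) :
    ContDiffAt ℝ ∞ (fun p => tilt (z p)) w := by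
  have hr : ContDiffAt ℝ ∞ (fun p => radius (z p)) w :=
    ContDiffAt.comp (g := radius) w (contDiffAt_radius hzw) hz
  rw [contDiffAt_matrix]
  intro i j
  fin_cases i <;> fin_cases j <;> simp [tilt] <;> fun_prop

variable {m : ℕ} {b : ℝ} {v Γ : W → Fin (m + 1) → ℝ}
  (hv : ContDiffAt ℝ ∞ v w) (hΓ : ContDiffAt ℝ ∞ Γ w) (hw : IsRegular b (v w) (Γ w))

include hΓ in
theorem contDiffAt_height : ContDiffAt ℝ ∞ (fun p => height (Γ p)) w :=
  contDiffAt_pi.1 hΓ _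

include hv hΓ in
theorem contDiffAt_integrals : ContDiffAt ℝ ∞ (fun p => integrals b (v p) (Γ p)) w := by
  have h1 := contDiffAt_dotProduct hv hv
  have h2 := contDiffAt_dotProduct hv hΓ
  have h3 := contDiffAt_height hΓ
  unfold integrals
  fun_prop

include hv hΓ hw

theorem contDiffAt_frame : ContDiffAt ℝ ∞ (fun p => frame b (v p) (Γ p)) w := by
  have h2 := contDiffAt_dotProduct hv hΓ
  have h3 := contDiffAt_height hΓ
  have h4 := contDiffAt_pi.1 hv
  have h5 := contDiffAt_pi.1 hΓ
  have h6 : ContDiffAt ℝ ∞ (fun p => radius (height (Γ p))) w :=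
    ContDiffAt.comp (g := radius) w (contDiffAt_radius hw.height_mem) h3
  have h7 : ContDiffAt ℝ ∞ (fun p => Real.sqrt (integrals b (v p) (Γ p)).2) w :=
    ((contDiffAt_integrals hv hΓ).snd).sqrt hw.regular.1.ne'
  have hr := radius_pos hw.height_mem
  have hp := Real.sqrt_pos.2 hw.regular.1
  rw [contDiffAt_matrix]
  intro i j
  have h8 : ContDiffAt ℝ ∞ (fun p => Γ p i - height (Γ p) * axis m i) w :=
    (h5 i).sub (h3.mul contDiffAt_const)
  fin_cases j
  · exact h8.div h6 hr.ne'
  · exact ((h2.mul h8).sub ((contDiffAt_const.sub (h3.pow 2)).mul (h4 i))).div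
      (h7.mul h6) (mul_pos hp hr).ne'
  · exact contDiffAt_const

theorem contDiffAt_turning_integrals :
    ContDiffAt ℝ ∞ (fun p => turning b (integrals b (v p) (Γ p))) w :=
  ContDiffAt.comp (g := turning b) w (contDiffAt_turning hw.regular) (contDiffAt_integrals hv hΓ)

theorem contDiffAt_sqrt_linFactor : ContDiffAt ℝ ∞
    (fun p => Real.sqrt (linFactor b (integrals b (v p) (Γ p)) (height (Γ p)))) w := by
  have h1 := contDiffAt_turning_integrals hv hΓ hw
  have h2 : ContDiffAt ℝ ∞ (fun p => integrals b (v p) (Γ p)) w := contDiffAt_integrals hv hΓ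
  have h3 := contDiffAt_height hΓ
  refine ContDiffAt.sqrt ?_ hw.linFactor_pos.ne'
  exact ((contDiffAt_const.mul h2.fst).sub (contDiffAt_const.mul h1.fst)).sub
    (contDiffAt_const.mul h3)

theorem contDiffAt_angleCos : ContDiffAt ℝ ∞ (fun p => angleCos b (v p) (Γ p)) w := by
  have h1 := contDiffAt_turning_integrals hv hΓ hw
  have h3 := contDiffAt_height hΓ
  exact (h1.fst.sub h3).div h1.snd (isTurning_turning hw.regular).pos.ne'

theorem contDiffAt_angleSin : ContDiffAt ℝ ∞ (fun p => angleSin b (v p) (Γ p)) w := by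
  have h1 := contDiffAt_turning_integrals hv hΓ hw
  exact (contDiffAt_dotProduct hv hΓ).div (h1.snd.mul (contDiffAt_sqrt_linFactor hv hΓ hw))
    (mul_pos (isTurning_turning hw.regular).pos (Real.sqrt_pos.2 hw.linFactor_pos)).ne'

omit hw in
theorem contDiffAt_meanRate_integrals {ρ : ℝ × ℝ → ℝ → ℝ}
    (hρ : ∀ C ∈ Icc (-1 : ℝ) 1, ContDiffAt ℝ ∞ (fun p : (ℝ × ℝ) × ℝ => ρ p.1 p.2)
      (integrals b (v w) (Γ w), C)) :
    ContDiffAt ℝ ∞ (fun p => meanRate ρ (integrals b (v p) (Γ p))) w :=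
  ContDiffAt.comp (g := meanRate ρ) w (contDiffAt_meanRate hρ) (contDiffAt_integrals hv hΓ)

variable {φ₁ φ₂ φ₃ : W → ℝ} (h1 : ContDiffAt ℝ ∞ φ₁ w) (h2 : ContDiffAt ℝ ∞ φ₂ w)
  (h3 : ContDiffAt ℝ ∞ φ₃ w)

include h1

theorem contDiffAt_shiftCos : ContDiffAt ℝ ∞ (fun p => shiftCos b (v p) (Γ p) (φ₁ p)) w :=
  ((contDiffAt_angleCos hv hΓ hw).mul h1.cos).sub ((contDiffAt_angleSin hv hΓ hw).mul h1.sin)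

theorem contDiffAt_shiftSin : ContDiffAt ℝ ∞ (fun p => shiftSin b (v p) (Γ p) (φ₁ p)) w :=
  ((contDiffAt_angleSin hv hΓ hw).mul h1.cos).add ((contDiffAt_angleCos hv hΓ hw).mul h1.sin)

theorem contDiffAt_shiftAngle {ρ : ℝ × ℝ → ℝ → ℝ}
    (hρ : ∀ C ∈ Icc (-1 : ℝ) 1, ContDiffAt ℝ ∞ (fun p : (ℝ × ℝ) × ℝ => ρ p.1 p.2)
      (integrals b (v w) (Γ w), C)) :
    ContDiffAt ℝ ∞ (fun p => shiftAngle b (v p) (Γ p) ρ (φ₁ p)) w :=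
  ContDiffAt.comp
    (g := fun p : (ℝ × ℝ) × ℝ × ℝ × ℝ => increment ρ p.1 p.2.1 p.2.2.1 p.2.2.2)
    (f := fun p => (integrals b (v p) (Γ p), angleCos b (v p) (Γ p), angleSin b (v p) (Γ p), φ₁ p))
    w (contDiffAt_increment hρ hw.angle_sq)
    ((contDiffAt_integrals hv hΓ).prodMk ((contDiffAt_angleCos hv hΓ hw).prodMk
      ((contDiffAt_angleSin hv hΓ hw).prodMk h1)))

omit [NormedAddCommGroup W] [NormedSpace ℝ W] hv hΓ h1 in
theorem shiftCos_mem (x : ℝ) : shiftCos b (v w) (Γ w) x ∈ Icc (-1 : ℝ) 1 := by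
  obtain ⟨u, hu⟩ := hw.exists_isState
  rw [hu.shiftCos_eq]
  exact Real.cos_mem_Icc _

theorem contDiffAt_shiftHeight : ContDiffAt ℝ ∞
    (fun p => levelHeight b (integrals b (v p) (Γ p)) (shiftCos b (v p) (Γ p) (φ₁ p))) w :=
  ContDiffAt.comp (g := fun p : (ℝ × ℝ) × ℝ => levelHeight b p.1 p.2)
    (f := fun p => (integrals b (v p) (Γ p), shiftCos b (v p) (Γ p) (φ₁ p))) w
    (contDiffAt_levelHeight hw.regular)
    ((contDiffAt_integrals hv hΓ).prodMk (contDiffAt_shiftCos hv hΓ hw h1))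

theorem contDiffAt_shiftRate : ContDiffAt ℝ ∞
    (fun p => levelRate b (integrals b (v p) (Γ p)) (shiftCos b (v p) (Γ p) (φ₁ p))) w :=
  ContDiffAt.comp (g := fun p : (ℝ × ℝ) × ℝ => levelRate b p.1 p.2)
    (f := fun p => (integrals b (v p) (Γ p), shiftCos b (v p) (Γ p) (φ₁ p))) w
    (contDiffAt_levelRate hw.regular (shiftCos_mem hw _))
    ((contDiffAt_integrals hv hΓ).prodMk (contDiffAt_shiftCos hv hΓ hw h1))

include h2

theorem contDiffAt_flowFrame :
    ContDiffAt ℝ ∞ (fun p => flowFrame b (v p) (Γ p) (φ₁ p) (φ₂ p)) w :=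
  contDiffAt_matrix_mul (contDiffAt_frame hv hΓ hw) (contDiffAt_rotZ (h2.add
    (contDiffAt_shiftAngle hv hΓ hw h1 fun _ hC => contDiffAt_precession hw.regular hC)))

theorem contDiffAt_flowDir :
    ContDiffAt ℝ ∞ (fun p => flowDir b (v p) (Γ p) (φ₁ p) (φ₂ p)) w := by
  refine contDiffAt_mulVec (contDiffAt_flowFrame hv hΓ hw h1 h2) ?_
  have hz := contDiffAt_shiftHeight hv hΓ hw h1
  have hr : ContDiffAt ℝ ∞ (fun p => radius (levelHeight b (integrals b (v p) (Γ p))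
      (shiftCos b (v p) (Γ p) (φ₁ p)))) w :=
    ContDiffAt.comp (g := radius) w
      (contDiffAt_radius (levelHeight_mem hw.regular (shiftCos_mem hw _))) hz
  rw [contDiffAt_pi]
  intro i
  fin_cases i
  · exact hr
  · exact contDiffAt_const
  · exact hz

theorem contDiffAt_flowVel :
    ContDiffAt ℝ ∞ (fun p => flowVel b (v p) (Γ p) (φ₁ p) (φ₂ p)) w := by
  refine contDiffAt_mulVec (contDiffAt_flowFrame hv hΓ hw h1 h2) ?_
  have hz := contDiffAt_shiftHeight hv hΓ hw h1
  have hmem := levelHeight_mem hw.regular (shiftCos_mem hw (φ₁ w))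
  have hr : ContDiffAt ℝ ∞ (fun p => radius (levelHeight b (integrals b (v p) (Γ p))
      (shiftCos b (v p) (Γ p) (φ₁ p)))) w :=
    ContDiffAt.comp (g := radius) w (contDiffAt_radius hmem) hz
  have hp : ContDiffAt ℝ ∞ (fun p => Real.sqrt (integrals b (v p) (Γ p)).2) w :=
    ((contDiffAt_integrals hv hΓ).snd).sqrt hw.regular.1.ne'
  rw [contDiffAt_pi]
  intro i
  fin_cases i
  · exact (((contDiffAt_turning_integrals hv hΓ hw).snd.mul
      (contDiffAt_shiftSin hv hΓ hw h1)).mul (contDiffAt_shiftRate hv hΓ hw h1)).div hr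
      (radius_pos hmem).ne'
  · exact hp.neg.div hr (radius_pos hmem).ne'
  · exact contDiffAt_const

include h3

theorem contDiffAt_flowAtt {g : W → Matrix (Fin (m + 1)) (Fin (m + 1)) ℝ}
    (hg : ContDiffAt ℝ ∞ g w) :
    ContDiffAt ℝ ∞ (fun p => flowAtt b (v p) (Γ p) (g p) (φ₁ p) (φ₂ p) (φ₃ p)) w := by
  have hB := contDiffAt_frame hv hΓ hw
  have hT := contDiffAt_tilt (contDiffAt_height hΓ) hw.height_mem
  have hT' := contDiffAt_tilt (contDiffAt_shiftHeight hv hΓ hw h1)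
    (levelHeight_mem hw.regular (shiftCos_mem hw (φ₁ w)))
  have hR := contDiffAt_rotZ (h3.add
    (contDiffAt_shiftAngle hv hΓ hw h1 fun _ hC => contDiffAt_nodal hw.regular hC))
  exact (contDiffAt_matrix_mul hg (contDiffAt_const.sub
      (contDiffAt_matrix_mul hB (contDiffAt_matrix_transpose hB)))).add
    (contDiffAt_matrix_mul (contDiffAt_matrix_mul (contDiffAt_matrix_mul hg hB)
      (contDiffAt_matrix_mul (contDiffAt_matrix_mul hT hR) (contDiffAt_matrix_transpose hT')))
      (contDiffAt_matrix_transpose (contDiffAt_flowFrame hv hΓ hw h1 h2)))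

end smooth

/-! ## Infinitesimal freeness -/

theorem hasDerivAt_comp_zero {V G H : Type*} [NormedAddCommGroup V] [NormedSpace ℝ V]
    [NormedAddCommGroup G] [NormedSpace ℝ G] [NormedAddCommGroup H] [NormedSpace ℝ H]
    {f : V × G → H} {v : ℝ → V} {γ : ℝ → G} {t : ℝ} (hf : ContDiffAt ℝ ∞ f (v t, γ t))
    (hv : HasDerivAt v 0 t) (hγ : HasDerivAt γ 0 t) :
    HasDerivAt (fun s => f (v s, γ s)) 0 t := by
  have := (hf.differentiableAt (by simp)).hasFDerivAt.comp_hasDerivAt t (hv.prodMk hγ)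
  rw [Prod.mk_zero_zero, map_zero] at this
  exact this

theorem eq_zero_of_hasDerivAt_rotZ {ξ : ℝ} (h : HasDerivAt (fun t : ℝ => rotZ (t * ξ)) 0 0) :
    ξ = 0 := by
  have h1 := hasDerivAt_matrix.1 h 1 0
  have h2 : HasDerivAt (fun t : ℝ => Real.sin (t * ξ)) ξ 0 := by
    simpa using ((hasDerivAt_id (0 : ℝ)).mul_const ξ).sin
  have h3 : (fun t : ℝ => rotZ (t * ξ) 1 0) = fun t : ℝ => Real.sin (t * ξ) := by
    ext t; simp [rotZ]
  rw [h3] at h1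
  simpa using h2.unique h1

namespace IsState

variable {m : ℕ} {b : ℝ} {v Γ : Fin (m + 1) → ℝ} {D : ℝ × ℝ}
    {B : Matrix (Fin (m + 1)) (Fin 3) ℝ} {u : ℝ}

/-- A stationary state has stationary `angleCos`, `angleSin` and `frame`, which are smooth functions
of it. The first two are `cos (u + t ξ₁)` and `sin (u + t ξ₁)`, forcing `ξ₁ = 0`; then the frame
turns with velocity `ξ₂`. -/
theorem eq_zero_of_hasDerivAt_flow (h : IsState b v Γ D B u) {ξ₁ ξ₂ : ℝ}
    (hv : HasDerivAt (fun t : ℝ => flowVel b v Γ (t * ξ₁) (t * ξ₂)) 0 0)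
    (hΓ : HasDerivAt (fun t : ℝ => flowDir b v Γ (t * ξ₁) (t * ξ₂)) 0 0) : ξ₁ = 0 ∧ ξ₂ = 0 := by
  have hreg : IsRegular b (flowVel b v Γ (0 * ξ₁) (0 * ξ₂)) (flowDir b v Γ (0 * ξ₁) (0 * ξ₂)) :=
    (h.flow _ _).isRegular
  have hc := hasDerivAt_comp_zero (f := fun p : (Fin (m + 1) → ℝ) × (Fin (m + 1) → ℝ) =>
    angleCos b p.1 p.2) (contDiffAt_angleCos contDiffAt_fst contDiffAt_snd hreg) hv hΓ
  have hs := hasDerivAt_comp_zero (f := fun p : (Fin (m + 1) → ℝ) × (Fin (m + 1) → ℝ) =>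
    angleSin b p.1 p.2) (contDiffAt_angleSin contDiffAt_fst contDiffAt_snd hreg) hv hΓ
  have hB := hasDerivAt_comp_zero (f := fun p : (Fin (m + 1) → ℝ) × (Fin (m + 1) → ℝ) =>
    frame b p.1 p.2) (contDiffAt_frame contDiffAt_fst contDiffAt_snd hreg) hv hΓ
  simp only [(h.flow _ _).angleCos_eq] at hc
  simp only [(h.flow _ _).angleSin_eq] at hs
  simp only [(h.flow _ _).frame_eq] at hB
  have hlin : HasDerivAt (fun t : ℝ => u + t * ξ₁) ξ₁ 0 := by
    simpa using ((hasDerivAt_id (0 : ℝ)).mul_const ξ₁).const_add u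
  have e1 := hlin.cos.unique hc
  have e2 := hlin.sin.unique hs
  simp only [zero_mul, add_zero] at e1 e2
  have h1 : ξ₁ = 0 := by
    linear_combination Real.cos u * e2 - Real.sin u * e1 - ξ₁ * Real.sin_sq_add_cos_sq u
  refine ⟨h1, ?_⟩
  subst h1
  simp only [mul_zero, h.flowFrame_eq, increment_zero, add_zero] at hB
  have h2 := hasDerivAt_const_mul_matrix Bᵀ hB
  simp only [← Matrix.mul_assoc, h.orthonormal, Matrix.one_mul, Matrix.mul_zero] at h2
  exact eq_zero_of_hasDerivAt_rotZ h2

/-- Multiplying by constant matrices on both sides isolates the rotation by `t ξ` inside `flowAtt`.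
-/
theorem eq_zero_of_hasDerivAt_flowAtt (h : IsState b v Γ D B u)
    {g : Matrix (Fin (m + 1)) (Fin (m + 1)) ℝ} (hg : gᵀ * g = 1) {ξ : ℝ}
    (hd : HasDerivAt (fun t : ℝ => flowAtt b v Γ g 0 0 (t * ξ)) 0 0) : ξ = 0 := by
  have h1 := hasDerivAt_matrix_mul_const (hasDerivAt_const_mul_matrix
    ((tilt (levelHeight b D (Real.cos u)))ᵀ * Bᵀ * gᵀ) hd) (B * tilt (levelHeight b D (Real.cos u)))
  rw [Matrix.mul_zero, Matrix.zero_mul] at h1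
  refine eq_zero_of_hasDerivAt_rotZ (h1.congr_of_eventuallyEq (Eventually.of_forall fun t => ?_))
  have e1 : flowAtt b v Γ g 0 0 (t * ξ) * B = g * B * (tilt (levelHeight b D (Real.cos u)) *
      rotZ (t * ξ) * (tilt (levelHeight b D (Real.cos u)))ᵀ) := by
    have := h.flowAtt_mul_frame g 0 0 (t * ξ)
    rwa [h.flowFrame_zero, increment_zero, add_zero, add_zero] at this
  have hT := tilt_transpose_mul (h.level_mem u)
  simp only
  generalize tilt (levelHeight b D (Real.cos u)) = T at *
  have e2 : ∀ M : Matrix (Fin 3) (Fin 3) ℝ, Tᵀ * (T * M) = M := fun M => by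
    rw [← Matrix.mul_assoc, hT, Matrix.one_mul]
  have e3 : ∀ M : Matrix (Fin 3) (Fin 3) ℝ, Bᵀ * (B * M) = M := fun M => by
    rw [← Matrix.mul_assoc, h.orthonormal, Matrix.one_mul]
  have e4 : ∀ M : Matrix (Fin (m + 1)) (Fin 3) ℝ, gᵀ * (g * M) = M := fun M => by
    rw [← Matrix.mul_assoc, hg, Matrix.one_mul]
  rw [Matrix.mul_assoc _ _ (B * T), ← Matrix.mul_assoc _ B, e1]
  simp only [Matrix.mul_assoc, e4, e3, e2, hT, Matrix.mul_one]

end IsState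

/-! ## The constraints and the momentum equation -/

section momentum

variable {m : ℕ}

/-- The velocity `v`, where `Ω = v ∧ eₙ`. -/
def lastCol (Ω : Matrix (Fin (m + 1)) (Fin (m + 1)) ℝ) : Fin (m + 1) → ℝ :=
  fun i => Ω i (Fin.last m)

theorem scalar_constraint (q : ConstraintIndex m) (Ω : Matrix (Fin (m + 1)) (Fin (m + 1)) ℝ) :
    scalar (constraint m q) Ω = -(1 / 2) * (Ω q.1.2 q.1.1 - Ω q.1.1 q.1.2) := by
  simp only [scalar, constraint, Matrix.sub_mul, Matrix.trace_sub]
  congr 2 <;> simp [Matrix.trace_single_mul]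

theorem apply_eq_zero_of_admissible {Ω : Matrix (Fin (m + 1)) (Fin (m + 1)) ℝ}
    (h : Ω ∈ admissible (constraint m)) {i j : Fin (m + 1)} (hi : i ≠ Fin.last m)
    (hj : j ≠ Fin.last m) : Ω i j = 0 := by
  have hskew : ∀ i j, Ω j i = -Ω i j := fun i j => congrFun (congrFun h.1 i) j
  have hlt : ∀ i j : Fin (m + 1), i < j → j ≠ Fin.last m → Ω i j = 0 := fun i j hij hj => by
    have h1 := h.2 ⟨(i, j), hij, hj⟩
    rw [scalar_constraint] at h1
    simp only at h1
    have := hskew i j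
    linarith
  rcases lt_trichotomy i j with hij | rfl | hij
  · exact hlt i j hij hj
  · have := hskew i i; linarith
  · rw [hskew j i, hlt j i hij hi, neg_zero]

theorem lastCol_last {Ω : Matrix (Fin (m + 1)) (Fin (m + 1)) ℝ}
    (h : Ω ∈ admissible (constraint m)) : lastCol Ω (Fin.last m) = 0 := by
  have : Ω (Fin.last m) (Fin.last m) = -Ω (Fin.last m) (Fin.last m) :=
    congrFun (congrFun h.1 _) _
  simp only [lastCol]; linarith

/-- The constraints leave only the last row and column of `Ω`, which skew symmetry ties together; so
`D` is parametrized by the vectors `v` with `vₙ = 0`. -/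
theorem wedge_lastCol {Ω : Matrix (Fin (m + 1)) (Fin (m + 1)) ℝ}
    (h : Ω ∈ admissible (constraint m)) : wedge (lastCol Ω) (axis m) = Ω := by
  have hskew : ∀ i j, Ω j i = -Ω i j := fun i j => congrFun (congrFun h.1 i) j
  have hll := lastCol_last h
  simp only [lastCol] at hll
  ext i j
  simp only [wedge, lastCol, axis, Matrix.sub_apply, Matrix.vecMulVec_apply, Pi.single_apply]
  by_cases hi : i = Fin.last m <;> by_cases hj : j = Fin.last m
  · subst hi; subst hj; simp [hll]
  · subst hi; simp [hj, hskew (Fin.last m) j]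
  · subst hj; simp [hi]
  · simp [hi, hj, apply_eq_zero_of_admissible h hi hj]

theorem wedge_axis_mem {v : Fin (m + 1) → ℝ} :
    wedge v (axis m) ∈ admissible (constraint m) := by
  refine ⟨?_, fun q => ?_⟩
  · simp [wedge, Matrix.transpose_sub, Matrix.transpose_vecMulVec]
  · have h2 := q.2.2
    have h1 : q.1.1 ≠ Fin.last m := (q.2.1.trans_le (Fin.le_last _)).ne
    rw [scalar_constraint]
    simp [wedge, axis, Matrix.vecMulVec_apply, h1, h2]

theorem lastCol_wedge {v : Fin (m + 1) → ℝ} (hv : v (Fin.last m) = 0) :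
    lastCol (wedge v (axis m)) = v := by
  ext i
  simp [lastCol, wedge, axis, Matrix.vecMulVec_apply, hv]

theorem wedge_mulVec (x y z : Fin (m + 1) → ℝ) :
    wedge x y *ᵥ z = (y ⬝ᵥ z) • x - (x ⬝ᵥ z) • y := by
  ext i
  simp [wedge, Matrix.sub_mulVec, Matrix.vecMulVec_mulVec, mul_comm]

/-- The entry `(i, j)` of `J(Ω)` is `(Iᵢ + Iⱼ) Ωᵢⱼ`, and on `D` only entries with exactly one of
`i`, `j` equal to `n` survive. This is why the gyroscopic term `[M, Ω]` vanishes. -/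
theorem inertia_eq_smul {I₁ Iₙ : ℝ} {Ω : Matrix (Fin (m + 1)) (Fin (m + 1)) ℝ}
    (h : Ω ∈ admissible (constraint m)) :
    inertia (massTensor m I₁ Iₙ) Ω = (I₁ + Iₙ) • Ω := by
  have hll := lastCol_last h
  simp only [lastCol] at hll
  ext i j
  simp only [inertia, massTensor, Matrix.add_apply, Matrix.diagonal_mul, Matrix.mul_diagonal,
    Matrix.smul_apply, smul_eq_mul]
  by_cases hi : i = Fin.last m <;> by_cases hj : j = Fin.last m
  · subst hi; subst hj; simp [hll]
  · simp only [hi, hj, if_true, if_false]; ring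
  · simp only [hi, hj, if_true, if_false]; ring
  · simp [hi, hj, apply_eq_zero_of_admissible h hi hj]

theorem grad_potential (Bₙ : ℝ) (Γ : Fin (m + 1) → ℝ) :
    grad (potential m Bₙ) Γ = Bₙ • axis m := by
  have h : HasFDerivAt (potential m Bₙ)
      (Bₙ • (ContinuousLinearMap.proj (Fin.last m) : (Fin (m + 1) → ℝ) →L[ℝ] ℝ)) Γ :=
    ((ContinuousLinearMap.proj (R := ℝ) (φ := fun _ : Fin (m + 1) => ℝ)
      (Fin.last m)).hasFDerivAt (x := Γ)).const_smul Bₙ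
  ext i
  rw [grad, h.fderiv]
  simp [axis, Pi.single_apply, eq_comm]

theorem sum_constraint_apply (c : ConstraintIndex m → ℝ) {i j : Fin (m + 1)}
    (h : i = Fin.last m ∨ j = Fin.last m) : (∑ q, c q • constraint m q) i j = 0 := by
  rw [Matrix.sum_apply]
  refine Finset.sum_eq_zero fun q _ => ?_
  have h2 := q.2.2
  have h1 : q.1.1 ≠ Fin.last m := (q.2.1.trans_le (Fin.le_last _)).ne
  rcases h with rfl | rfl <;> simp [constraint, h1, h2]

/-- The momentum equation without multipliers. -/
theorem momentumEquation_iff {I₁ Iₙ Bₙ : ℝ} (hI : 0 < I₁ + Iₙ) {T : Set ℝ} (hT : IsOpen T)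
    {Ω : ℝ → Matrix (Fin (m + 1)) (Fin (m + 1)) ℝ} {Γ : ℝ → Fin (m + 1) → ℝ}
    (hΩ : ∀ t ∈ T, Ω t ∈ admissible (constraint m)) :
    MomentumEquation (massTensor m I₁ Iₙ) (potential m Bₙ) (constraint m) T Ω Γ ↔
      ∀ t ∈ T, HasDerivAt Ω ((Bₙ / (I₁ + Iₙ)) • wedge (axis m) (Γ t)) t := by
  have hw : ∀ (x y : Fin (m + 1) → ℝ), wedge (Bₙ • x) y = Bₙ • wedge x y := fun x y => by
    simp [wedge, Matrix.smul_vecMulVec, Matrix.vecMulVec_smul, smul_sub]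
  have hbr : ∀ t ∈ T, ⁅inertia (massTensor m I₁ Iₙ) (Ω t), Ω t⁆ = 0 := fun t ht => by
    rw [inertia_eq_smul (hΩ t ht), Ring.lie_def]; simp
  have hev : ∀ t ∈ T, (fun s => inertia (massTensor m I₁ Iₙ) (Ω s)) =ᶠ[𝓝 t]
      fun s => (I₁ + Iₙ) • Ω s := fun t ht => by
    filter_upwards [hT.mem_nhds ht] with s hs using inertia_eq_smul (hΩ s hs)
  constructor
  · rintro ⟨c, hc⟩ t ht
    have h1 := (hc t ht).congr_of_eventuallyEq (hev t ht).symm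
    rw [hbr t ht, grad_potential, hw, zero_add] at h1
    have h2 := h1.const_smul (I₁ + Iₙ)⁻¹
    simp only [smul_smul, inv_mul_cancel₀ hI.ne', one_smul, Pi.smul_def] at h2
    have h3 := hasDerivAt_matrix.1 h2
    refine hasDerivAt_matrix.2 fun i j => ?_
    -- The reaction forces do not act on the last row and column; in the remaining block both `Ω`
    -- and the torque `eₙ ∧ Γ` vanish.
    by_cases hij : i = Fin.last m ∨ j = Fin.last m
    · convert! h3 i j using 1
      simp only [Matrix.smul_apply, Matrix.add_apply, sum_constraint_apply _ hij, smul_eq_mul]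
      field_simp
      ring
    · push Not at hij
      have h4 : (fun s => Ω s i j) =ᶠ[𝓝 t] fun _ => 0 := by
        filter_upwards [hT.mem_nhds ht] with s hs
        exact apply_eq_zero_of_admissible (hΩ s hs) hij.1 hij.2
      have h5 := (hasDerivAt_const t (0 : ℝ)).congr_of_eventuallyEq h4
      convert! h5 using 1
      simp [wedge, axis, Matrix.vecMulVec_apply, hij.1, hij.2]
  · intro h
    -- The torque is itself admissible, so zero multipliers suffice.
    refine ⟨fun _ _ => 0, fun t ht => ?_⟩
    refine HasDerivAt.congr_of_eventuallyEq ?_ (hev t ht)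
    rw [hbr t ht, grad_potential, hw]
    convert! (h t ht).const_smul (I₁ + Iₙ) using 1
    simp only [zero_smul, Finset.sum_const_zero, add_zero, zero_add, smul_smul]
    congr 1
    field_simp

end momentum

/-! ### The correspondence between velocities and admissible matrices as linear maps. -/

section linear

variable (m : ℕ)

/-- `v ↦ v ∧ eₙ`. -/
def wedgeAxis : (Fin (m + 1) → ℝ) →L[ℝ] Matrix (Fin (m + 1)) (Fin (m + 1)) ℝ :=
  LinearMap.toContinuousLinearMap
    { toFun := fun v => wedge v (axis m)
      map_add' := fun x y => by
        simp only [wedge, Matrix.add_vecMulVec, Matrix.vecMulVec_add]; abel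
      map_smul' := fun c x => by
        simp [wedge, Matrix.smul_vecMulVec, Matrix.vecMulVec_smul, smul_sub] }

def lastColMap : Matrix (Fin (m + 1)) (Fin (m + 1)) ℝ →L[ℝ] (Fin (m + 1) → ℝ) :=
  LinearMap.toContinuousLinearMap
    { toFun := lastCol
      map_add' := fun _ _ => rfl
      map_smul' := fun _ _ => rfl }

variable {m}

theorem wedgeAxis_apply (v : Fin (m + 1) → ℝ) : wedgeAxis m v = wedge v (axis m) := rfl

theorem hasDerivAt_lastCol {Ω : ℝ → Matrix (Fin (m + 1)) (Fin (m + 1)) ℝ} {t : ℝ}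
    (h : HasDerivAt Ω 0 t) : HasDerivAt (fun s => lastCol (Ω s)) 0 t :=
  hasDerivAt_pi.2 fun i => hasDerivAt_matrix.1 h i (Fin.last m)

/-- The component of `Γ` along `eₙ` is killed by the wedge with `eₙ`; removing it keeps `v`
horizontal. -/
theorem wedgeAxis_torque (b : ℝ) (Γ : Fin (m + 1) → ℝ) :
    wedgeAxis m (b • (height Γ • axis m - Γ)) = b • wedge (axis m) Γ := by
  have : wedgeAxis m (axis m) = 0 := sub_self _
  rw [map_smul, map_sub, map_smul, this, smul_zero, zero_sub, wedgeAxis_apply, wedge, wedge, neg_sub]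

theorem hasDerivAt_wedge_axis {f : ℝ → Fin (m + 1) → ℝ} {b t : ℝ} {Γ : Fin (m + 1) → ℝ}
    (h : HasDerivAt f (b • (height Γ • axis m - Γ)) t) :
    HasDerivAt (fun s => wedge (f s) (axis m)) (b • wedge (axis m) Γ) t := by
  rw [← wedgeAxis_torque]
  exact (wedgeAxis m).hasFDerivAt.comp_hasDerivAt t h

theorem contDiff_wedge_axis {W : Type*} [NormedAddCommGroup W] [NormedSpace ℝ W]
    {f : W → Fin (m + 1) → ℝ} {n : WithTop ℕ∞} (hf : ContDiff ℝ n f) :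
    ContDiff ℝ n fun x => wedge (axis m) (f x) := by
  have h : (fun x => wedge (axis m) (f x)) = fun x => -wedgeAxis m (f x) := by
    ext1 x; rw [wedgeAxis_apply, wedge, wedge, neg_sub]
  rw [h]
  exact ((wedgeAxis m).contDiff.comp hf).neg

end linear

namespace IsState

variable {m : ℕ} {b : ℝ} {v Γ : Fin (m + 1) → ℝ} {D : ℝ × ℝ}
    {B : Matrix (Fin (m + 1)) (Fin 3) ℝ} {u : ℝ}

theorem lastCol_flow (h : IsState b v Γ D B u) (φ₁ φ₂ : ℝ) :
    lastCol (wedge (flowVel b v Γ φ₁ φ₂) (axis m)) = flowVel b v Γ φ₁ φ₂ :=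
  lastCol_wedge (h.flow φ₁ φ₂).vel_last

end IsState

/-- The inverse of the time derivative of the reduced angle. -/
def density {m : ℕ} (b : ℝ) (v Γ : Fin (m + 1) → ℝ) : ℝ :=
  (Real.sqrt (linFactor b (integrals b v Γ) (height Γ)))⁻¹

theorem IsRegular.density_pos {m : ℕ} {b : ℝ} {v Γ : Fin (m + 1) → ℝ} (h : IsRegular b v Γ) :
    0 < density b v Γ := inv_pos.2 (Real.sqrt_pos.2 h.linFactor_pos)

theorem contDiffAt_density {m : ℕ} {W : Type*} [NormedAddCommGroup W] [NormedSpace ℝ W] {w : W}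
    {b : ℝ} {v Γ : W → Fin (m + 1) → ℝ} (hv : ContDiffAt ℝ ∞ v w) (hΓ : ContDiffAt ℝ ∞ Γ w)
    (hw : IsRegular b (v w) (Γ w)) : ContDiffAt ℝ ∞ (fun p => density b (v p) (Γ p)) w :=
  (contDiffAt_sqrt_linFactor hv hΓ hw).inv (Real.sqrt_pos.2 hw.linFactor_pos).ne'

theorem IsState.div_density {m : ℕ} {b : ℝ} {v Γ : Fin (m + 1) → ℝ} {D : ℝ × ℝ}
    {B : Matrix (Fin (m + 1)) (Fin 3) ℝ} {u : ℝ} (h : IsState b v Γ D B u) (c φ₁ φ₂ : ℝ) :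
    c / density b (flowVel b v Γ φ₁ φ₂) (flowDir b v Γ φ₁ φ₂) =
      c * levelRate b D (Real.cos (u + φ₁)) := by
  rw [density, (h.flow φ₁ φ₂).integrals_eq, (h.flow φ₁ φ₂).height_eq, div_inv_eq_mul, levelRate]

/-! ## The torus action on the reduced phase space -/

section reduced

variable {m : ℕ} (b : ℝ)

/-- The regular part of `ℳ`. -/
def regularPart (m : ℕ) : Set (Matrix (Fin (m + 1)) (Fin (m + 1)) ℝ × (Fin (m + 1) → ℝ)) :=
  phaseSpace (constraint m) ∩ {x | integrals b (lastCol x.1) x.2 ∈ regularValues b}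

def torusAction (φ : Fin 2 → ℝ) (x : Matrix (Fin (m + 1)) (Fin (m + 1)) ℝ × (Fin (m + 1) → ℝ)) :
    Matrix (Fin (m + 1)) (Fin (m + 1)) ℝ × (Fin (m + 1) → ℝ) :=
  (wedge (flowVel b (lastCol x.1) x.2 (φ 0) (φ 1)) (axis m),
    flowDir b (lastCol x.1) x.2 (φ 0) (φ 1))

variable {b} {x : Matrix (Fin (m + 1)) (Fin (m + 1)) ℝ × (Fin (m + 1) → ℝ)}

theorem isRegular_of_mem_regularPart (hx : x ∈ regularPart b m) :
    IsRegular b (lastCol x.1) x.2 :=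
  ⟨lastCol_last hx.1.1, hx.1.2, hx.2⟩

theorem contDiff_lastCol_fst : ContDiff ℝ ∞
    fun x : Matrix (Fin (m + 1)) (Fin (m + 1)) ℝ × (Fin (m + 1) → ℝ) => lastCol x.1 :=
  (lastColMap m).contDiff.comp contDiff_fst

theorem isFreeTorusAction_torusAction :
    IsFreeTorusAction (phaseSpace (constraint m)) (regularPart b m) (torusAction b) where
  isOpen := by
    refine ⟨_, (isOpen_regularValues b).preimage ?_, rfl⟩
    exact continuous_iff_continuousAt.2 fun x => (contDiffAt_integrals (b := b)
      contDiff_lastCol_fst.contDiffAt contDiffAt_snd).continuousAt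
  mapsTo φ x hx := by
    obtain ⟨u, h⟩ := (isRegular_of_mem_regularPart hx).exists_isState
    refine ⟨⟨wedge_axis_mem, (h.flow _ _).dir_sq⟩, ?_⟩
    change integrals b (lastCol (torusAction b φ x).1) _ ∈ regularValues b
    rw [torusAction]
    rw [h.lastCol_flow, (h.flow _ _).integrals_eq]
    exact hx.2
  zero x hx := by
    obtain ⟨u, h⟩ := (isRegular_of_mem_regularPart hx).exists_isState
    simp only [torusAction, Pi.zero_apply, h.flowVel_zero, h.flowDir_zero, wedge_lastCol hx.1.1]
  add φ ψ x hx := by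
    obtain ⟨u, h⟩ := (isRegular_of_mem_regularPart hx).exists_isState
    simp only [torusAction, h.lastCol_flow, h.flowVel_flow, h.flowDir_flow, Pi.add_apply]
  fixed_iff φ x hx := by
    obtain ⟨u, h⟩ := (isRegular_of_mem_regularPart hx).exists_isState
    have key : torusAction b φ x = x ↔ flowVel b (lastCol x.1) x.2 (φ 0) (φ 1) = lastCol x.1 ∧
        flowDir b (lastCol x.1) x.2 (φ 0) (φ 1) = x.2 := by
      rw [Prod.ext_iff]
      refine and_congr ⟨fun e => ?_, fun e => ?_⟩ Iff.rfl
      · rw [← h.lastCol_flow]; exact congrArg lastCol e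
      · simp only [torusAction, e, wedge_lastCol hx.1.1]
    rw [key, h.flow_eq_self_iff]
    constructor
    · rintro ⟨⟨N₁, e₁⟩, N₂, e₂⟩
      refine ⟨![N₁, N₂], ?_⟩
      ext i; fin_cases i <;> simp [e₁, e₂]
    · rintro ⟨N, rfl⟩
      exact ⟨⟨N 0, rfl⟩, N 1, rfl⟩
  smooth φ x hx := by
    have hr := isRegular_of_mem_regularPart hx
    have hv : ContDiffAt ℝ ∞ (fun p : (Fin 2 → ℝ) ×
        (Matrix (Fin (m + 1)) (Fin (m + 1)) ℝ × (Fin (m + 1) → ℝ)) => lastCol p.2.1) (φ, x) :=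
      contDiff_lastCol_fst.contDiffAt.comp _ contDiffAt_snd
    have hΓ : ContDiffAt ℝ ∞ (fun p : (Fin 2 → ℝ) ×
        (Matrix (Fin (m + 1)) (Fin (m + 1)) ℝ × (Fin (m + 1) → ℝ)) => p.2.2) (φ, x) :=
      contDiffAt_snd.snd
    have hφ : ∀ i, ContDiffAt ℝ ∞ (fun p : (Fin 2 → ℝ) ×
        (Matrix (Fin (m + 1)) (Fin (m + 1)) ℝ × (Fin (m + 1) → ℝ)) => p.1 i) (φ, x) :=
      contDiffAt_pi.1 contDiffAt_fst
    exact ((wedgeAxis m).contDiff.contDiffAt.comp _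
      (contDiffAt_flowVel hv hΓ hr (hφ 0) (hφ 1))).prodMk
      (contDiffAt_flowDir hv hΓ hr (hφ 0) (hφ 1))
  infinitesimal x hx ξ hξ := by
    obtain ⟨u, h⟩ := (isRegular_of_mem_regularPart hx).exists_isState
    have hv := hasDerivAt_lastCol hξ.fst
    have hΓ : HasDerivAt (fun t : ℝ => flowDir b (lastCol x.1) x.2 (t * ξ 0) (t * ξ 1)) 0 0 :=
      hξ.snd
    have hv' : HasDerivAt (fun t : ℝ => flowVel b (lastCol x.1) x.2 (t * ξ 0) (t * ξ 1)) 0 0 := by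
      refine hv.congr_of_eventuallyEq (Eventually.of_forall fun t => ?_)
      exact (h.lastCol_flow _ _).symm
    obtain ⟨h1, h2⟩ := h.eq_zero_of_hasDerivAt_flow hv' hΓ
    ext i; fin_cases i
    · exact h1
    · exact h2

theorem isSolution_torusAction {I₁ Iₙ Bₙ : ℝ} (hI : 0 < I₁ + Iₙ) (hb : Bₙ / (I₁ + Iₙ) = b)
    (hx : x ∈ regularPart b m) {J : Set ℝ} (hJ : IsOpen J) {φ : ℝ → Fin 2 → ℝ}
    (hφ : IsTorusMotion
      ![1, meanRate (precession b) (integrals b (lastCol x.1) x.2)]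
      (fun ψ => density b (lastCol (torusAction b ψ x).1) (torusAction b ψ x).2) J φ) :
    IsSolution (massTensor m I₁ Iₙ) (potential m Bₙ) (constraint m) J
      (fun t => torusAction b (φ t) x) := by
  obtain ⟨u, h⟩ := (isRegular_of_mem_regularPart hx).exists_isState
  have hrate : ∀ t ∈ J, ∀ i, HasDerivAt (fun s => φ s i)
      ((![1, meanRate (precession b) (integrals b (lastCol x.1) x.2)] : Fin 2 → ℝ) i *
        levelRate b (integrals b (lastCol x.1) x.2) (Real.cos (u + φ t 0))) t := fun t ht i => by
    have := hasDerivAt_pi.1 (hφ t ht) i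
    simpa only [torusAction, h.lastCol_flow, h.div_density] using this
  have h1 : ∀ t ∈ J, HasDerivAt (fun s => φ s 0)
      (levelRate b (integrals b (lastCol x.1) x.2) (Real.cos (u + φ t 0))) t := fun t ht => by
    simpa using hrate t ht 0
  have h2 := fun t ht => hrate t ht 1
  refine ⟨fun t _ => (isFreeTorusAction_torusAction.mapsTo _ _ hx).1, ?_, fun t ht => ?_⟩
  · refine (momentumEquation_iff hI hJ fun t _ => wedge_axis_mem).2 fun t ht => ?_
    rw [hb]
    exact hasDerivAt_wedge_axis (h.hasDerivAt_flowVel (h1 t ht) (h2 t ht))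
  · convert! h.hasDerivAt_flowDir (h1 t ht) (h2 t ht) using 1
    simp only [torusAction]
    rw [wedge_mulVec, axis_dotProduct, neg_sub, neg_smul]
    abel

/-- Without multipliers the system is given by a polynomial vector field on the ambient space, to
which the uniqueness theorem applies. -/
theorem hasDerivAt_of_isSolution {I₁ Iₙ Bₙ : ℝ} (hI : 0 < I₁ + Iₙ)
    {J : Set ℝ} (hJ : IsOpen J)
    {x : ℝ → Matrix (Fin (m + 1)) (Fin (m + 1)) ℝ × (Fin (m + 1) → ℝ)}
    (hx : IsSolution (massTensor m I₁ Iₙ) (potential m Bₙ) (constraint m) J x) :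
    ∀ t ∈ J, HasDerivAt x ((Bₙ / (I₁ + Iₙ)) • wedge (axis m) (x t).2,
      -((x t).1 *ᵥ (x t).2)) t := fun t ht =>
  ((momentumEquation_iff hI hJ fun t ht => (hx.1 t ht).1).1 hx.2.1 t ht).prodMk (hx.2.2 t ht)

theorem contDiff_reducedField (b : ℝ) :
    ContDiff ℝ 1 fun x : Matrix (Fin (m + 1)) (Fin (m + 1)) ℝ × (Fin (m + 1) → ℝ) =>
      (b • wedge (axis m) x.2, -(x.1 *ᵥ x.2)) := by
  have h : ContDiff ℝ ∞ fun x : Matrix (Fin (m + 1)) (Fin (m + 1)) ℝ × (Fin (m + 1) → ℝ) =>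
      (b • wedge (axis m) x.2, -(x.1 *ᵥ x.2)) :=
    ((contDiff_wedge_axis contDiff_snd).const_smul b).prodMk
      (contDiff_iff_contDiffAt.2 fun x => contDiffAt_mulVec contDiffAt_fst contDiffAt_snd).neg
  exact h.of_le (by simp)

theorem contDiffAt_reducedFreq (hx : x ∈ regularPart b m) : ContDiffAt ℝ ∞
    (fun y : Matrix (Fin (m + 1)) (Fin (m + 1)) ℝ × (Fin (m + 1) → ℝ) =>
      (![1, meanRate (precession b) (integrals b (lastCol y.1) y.2)] : Fin 2 → ℝ)) x := by
  rw [contDiffAt_pi]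
  intro i; fin_cases i
  · exact contDiffAt_const
  · exact contDiffAt_meanRate_integrals contDiff_lastCol_fst.contDiffAt contDiffAt_snd
      fun C hC => contDiffAt_precession hx.2 hC

end reduced

/-! ## The torus action on the whole phase space -/

section full

variable {m : ℕ} (b : ℝ) (Γ₀ : Fin (m + 1) → ℝ)

/-- The regular part of `𝒟`. -/
def fullRegularPart :
    Set (Matrix (Fin (m + 1)) (Fin (m + 1)) ℝ × Matrix (Fin (m + 1)) (Fin (m + 1)) ℝ) :=
  fullPhaseSpace (constraint m) ∩
    {x | integrals b (lastCol x.2) (x.1ᵀ *ᵥ Γ₀) ∈ regularValues b}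

/-- The three angles shift the reduced angle, turn the body frame about `eₙ`, and turn the attitude
about `Γ₀` in space. The vertical is not stored but recovered as `gᵀΓ₀`. -/
def fullTorusAction (φ : Fin 3 → ℝ)
    (x : Matrix (Fin (m + 1)) (Fin (m + 1)) ℝ × Matrix (Fin (m + 1)) (Fin (m + 1)) ℝ) :
    Matrix (Fin (m + 1)) (Fin (m + 1)) ℝ × Matrix (Fin (m + 1)) (Fin (m + 1)) ℝ :=
  (flowAtt b (lastCol x.2) (x.1ᵀ *ᵥ Γ₀) x.1 (φ 0) (φ 1) (φ 2),
    wedge (flowVel b (lastCol x.2) (x.1ᵀ *ᵥ Γ₀) (φ 0) (φ 1)) (axis m))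

def fullFreq (x : Matrix (Fin (m + 1)) (Fin (m + 1)) ℝ × Matrix (Fin (m + 1)) (Fin (m + 1)) ℝ) :
    Fin 3 → ℝ :=
  ![1, meanRate (precession b) (integrals b (lastCol x.2) (x.1ᵀ *ᵥ Γ₀)),
    meanRate (nodal b) (integrals b (lastCol x.2) (x.1ᵀ *ᵥ Γ₀))]

variable {b Γ₀}
  {x : Matrix (Fin (m + 1)) (Fin (m + 1)) ℝ × Matrix (Fin (m + 1)) (Fin (m + 1)) ℝ}

theorem transpose_mul_of_mem {n : ℕ} {g : Matrix (Fin n) (Fin n) ℝ}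
    (hg : g ∈ Matrix.specialOrthogonalGroup (Fin n) ℝ) : gᵀ * g = 1 :=
  (Matrix.mem_orthogonalGroup_iff' _ _).1 (Matrix.mem_specialOrthogonalGroup_iff.1 hg).1

theorem mul_transpose_of_mem {n : ℕ} {g : Matrix (Fin n) (Fin n) ℝ}
    (hg : g ∈ Matrix.specialOrthogonalGroup (Fin n) ℝ) : g * gᵀ = 1 :=
  (Matrix.mem_orthogonalGroup_iff _ _).1 (Matrix.mem_specialOrthogonalGroup_iff.1 hg).1

theorem transpose_mulVec_sq {n : ℕ} {g : Matrix (Fin n) (Fin n) ℝ}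
    (hg : g ∈ Matrix.specialOrthogonalGroup (Fin n) ℝ) (y : Fin n → ℝ) :
    (gᵀ *ᵥ y) ⬝ᵥ (gᵀ *ᵥ y) = y ⬝ᵥ y := by
  rw [Matrix.dotProduct_mulVec, ← Matrix.mulVec_transpose, Matrix.mulVec_mulVec,
    Matrix.transpose_transpose, mul_transpose_of_mem hg, Matrix.one_mulVec]

theorem isRegular_of_mem_fullRegularPart (hΓ₀ : Γ₀ ⬝ᵥ Γ₀ = 1) (hx : x ∈ fullRegularPart b Γ₀) :
    IsRegular b (lastCol x.2) (x.1ᵀ *ᵥ Γ₀) :=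
  ⟨lastCol_last hx.1.2, by rw [transpose_mulVec_sq hx.1.1, hΓ₀], hx.2⟩

theorem contDiff_lastCol_snd : ContDiff ℝ ∞
    fun x : Matrix (Fin (m + 1)) (Fin (m + 1)) ℝ × Matrix (Fin (m + 1)) (Fin (m + 1)) ℝ =>
      lastCol x.2 :=
  (lastColMap m).contDiff.comp contDiff_snd

theorem contDiff_transpose_mulVec (Γ₀ : Fin (m + 1) → ℝ) : ContDiff ℝ ∞
    fun x : Matrix (Fin (m + 1)) (Fin (m + 1)) ℝ × Matrix (Fin (m + 1)) (Fin (m + 1)) ℝ =>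
      x.1ᵀ *ᵥ Γ₀ :=
  contDiff_iff_contDiffAt.2 fun _ =>
    contDiffAt_mulVec (contDiffAt_matrix_transpose contDiffAt_fst) contDiffAt_const

theorem hasDerivAt_transpose_mulVec {g : ℝ → Matrix (Fin (m + 1)) (Fin (m + 1)) ℝ} {t : ℝ}
    (h : HasDerivAt g 0 t) (y : Fin (m + 1) → ℝ) : HasDerivAt (fun s => (g s)ᵀ *ᵥ y) 0 t := by
  rw [hasDerivAt_pi]
  intro i
  have := HasDerivAt.fun_sum (u := Finset.univ) fun j _ =>
    (hasDerivAt_matrix.1 h j i).mul_const (y j)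
  simpa [Matrix.mulVec, dotProduct] using! this

theorem isFreeTorusAction_fullTorusAction (hΓ₀ : Γ₀ ⬝ᵥ Γ₀ = 1) :
    IsFreeTorusAction (fullPhaseSpace (constraint m)) (fullRegularPart b Γ₀)
      (fullTorusAction b Γ₀) where
  isOpen := by
    refine ⟨_, (isOpen_regularValues b).preimage ?_, rfl⟩
    exact continuous_iff_continuousAt.2 fun x => (contDiffAt_integrals (b := b)
      contDiff_lastCol_snd.contDiffAt (contDiff_transpose_mulVec Γ₀).contDiffAt).continuousAt
  mapsTo φ x hx := by
    obtain ⟨u, h⟩ := (isRegular_of_mem_fullRegularPart hΓ₀ hx).exists_isState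
    refine ⟨⟨h.flowAtt_mem hx.1.1 _ _ _, wedge_axis_mem⟩, ?_⟩
    change integrals b (lastCol (fullTorusAction b Γ₀ φ x).2)
      ((fullTorusAction b Γ₀ φ x).1ᵀ *ᵥ Γ₀) ∈ regularValues b
    rw [fullTorusAction]
    rw [h.lastCol_flow, h.flowAtt_transpose_mulVec rfl, (h.flow _ _).integrals_eq]
    exact hx.2
  zero x hx := by
    obtain ⟨u, h⟩ := (isRegular_of_mem_fullRegularPart hΓ₀ hx).exists_isState
    simp only [fullTorusAction, Pi.zero_apply, h.flowVel_zero, h.flowAtt_zero,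
      wedge_lastCol hx.1.2]
  add φ ψ x hx := by
    obtain ⟨u, h⟩ := (isRegular_of_mem_fullRegularPart hΓ₀ hx).exists_isState
    simp only [fullTorusAction, h.lastCol_flow, h.flowAtt_transpose_mulVec rfl, h.flowVel_flow,
      h.flowAtt_flow, Pi.add_apply]
  fixed_iff φ x hx := by
    obtain ⟨u, h⟩ := (isRegular_of_mem_fullRegularPart hΓ₀ hx).exists_isState
    have hg := transpose_mul_of_mem hx.1.1
    have key : fullTorusAction b Γ₀ φ x = x ↔
        flowAtt b (lastCol x.2) (x.1ᵀ *ᵥ Γ₀) x.1 (φ 0) (φ 1) (φ 2) = x.1 ∧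
        flowVel b (lastCol x.2) (x.1ᵀ *ᵥ Γ₀) (φ 0) (φ 1) = lastCol x.2 := by
      rw [Prod.ext_iff]
      refine and_congr Iff.rfl ⟨fun e => ?_, fun e => ?_⟩
      · rw [← h.lastCol_flow]; exact congrArg lastCol e
      · simp only [fullTorusAction, e, wedge_lastCol hx.1.2]
    rw [key]
    constructor
    · rintro ⟨e1, e2⟩
      have e3 := h.flowAtt_transpose_mulVec rfl (φ 0) (φ 1) (φ 2)
      rw [e1] at e3
      obtain ⟨⟨N₁, k₁⟩, N₂, k₂⟩ := (h.flow_eq_self_iff _ _).1 ⟨e2, e3.symm⟩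
      rw [k₁, k₂] at e1
      obtain ⟨N₃, k₃⟩ := (h.flowAtt_period_iff hg _ _ _).1 e1
      refine ⟨![N₁, N₂, N₃], ?_⟩
      ext i; fin_cases i <;> simp [k₁, k₂, k₃]
    · rintro ⟨N, rfl⟩
      exact ⟨(h.flowAtt_period_iff hg _ _ _).2 ⟨N 2, rfl⟩,
        ((h.flow_eq_self_iff _ _).2 ⟨⟨N 0, rfl⟩, N 1, rfl⟩).1⟩
  smooth φ x hx := by
    have hr := isRegular_of_mem_fullRegularPart hΓ₀ hx
    have hv : ContDiffAt ℝ ∞ (fun p : (Fin 3 → ℝ) × (Matrix (Fin (m + 1)) (Fin (m + 1)) ℝ ×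
        Matrix (Fin (m + 1)) (Fin (m + 1)) ℝ) => lastCol p.2.2) (φ, x) :=
      contDiff_lastCol_snd.contDiffAt.comp _ contDiffAt_snd
    have hΓ : ContDiffAt ℝ ∞ (fun p : (Fin 3 → ℝ) × (Matrix (Fin (m + 1)) (Fin (m + 1)) ℝ ×
        Matrix (Fin (m + 1)) (Fin (m + 1)) ℝ) => p.2.1ᵀ *ᵥ Γ₀) (φ, x) :=
      (contDiff_transpose_mulVec Γ₀).contDiffAt.comp _ contDiffAt_snd
    have hφ : ∀ i, ContDiffAt ℝ ∞ (fun p : (Fin 3 → ℝ) × (Matrix (Fin (m + 1)) (Fin (m + 1)) ℝ ×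
        Matrix (Fin (m + 1)) (Fin (m + 1)) ℝ) => p.1 i) (φ, x) :=
      contDiffAt_pi.1 contDiffAt_fst
    exact (contDiffAt_flowAtt hv hΓ hr (hφ 0) (hφ 1) (hφ 2) contDiffAt_snd.fst).prodMk
      ((wedgeAxis m).contDiff.contDiffAt.comp _ (contDiffAt_flowVel hv hΓ hr (hφ 0) (hφ 1)))
  infinitesimal x hx ξ hξ := by
    obtain ⟨u, h⟩ := (isRegular_of_mem_fullRegularPart hΓ₀ hx).exists_isState
    have hg : HasDerivAt (fun t : ℝ => flowAtt b (lastCol x.2) (x.1ᵀ *ᵥ Γ₀) x.1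
        (t * ξ 0) (t * ξ 1) (t * ξ 2)) 0 0 := hξ.fst
    have hv := hasDerivAt_lastCol hξ.snd
    have hΓ := hasDerivAt_transpose_mulVec hg Γ₀
    simp only [h.flowAtt_transpose_mulVec rfl] at hΓ
    have hv' : HasDerivAt (fun t : ℝ => flowVel b (lastCol x.2) (x.1ᵀ *ᵥ Γ₀)
        (t * ξ 0) (t * ξ 1)) 0 0 := by
      refine hv.congr_of_eventuallyEq (Eventually.of_forall fun t => ?_)
      exact (h.lastCol_flow _ _).symm
    obtain ⟨h1, h2⟩ := h.eq_zero_of_hasDerivAt_flow hv' hΓ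
    simp only [h1, h2, mul_zero] at hg
    have h3 := h.eq_zero_of_hasDerivAt_flowAtt (transpose_mul_of_mem hx.1.1) hg
    ext i; fin_cases i
    · exact h1
    · exact h2
    · exact h3

theorem isFullSolution_fullTorusAction {I₁ Iₙ Bₙ : ℝ} (hI : 0 < I₁ + Iₙ)
    (hb : Bₙ / (I₁ + Iₙ) = b) (hΓ₀ : Γ₀ ⬝ᵥ Γ₀ = 1) (hx : x ∈ fullRegularPart b Γ₀)
    {J : Set ℝ} (hJ : IsOpen J) {φ : ℝ → Fin 3 → ℝ}
    (hφ : IsTorusMotion (fullFreq b Γ₀ x)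
      (fun ψ => density b (lastCol (fullTorusAction b Γ₀ ψ x).2)
        ((fullTorusAction b Γ₀ ψ x).1ᵀ *ᵥ Γ₀)) J φ) :
    IsFullSolution (massTensor m I₁ Iₙ) (potential m Bₙ) (constraint m) Γ₀ J
      (fun t => fullTorusAction b Γ₀ (φ t) x) := by
  obtain ⟨u, h⟩ := (isRegular_of_mem_fullRegularPart hΓ₀ hx).exists_isState
  have hrate : ∀ t ∈ J, ∀ i, HasDerivAt (fun s => φ s i) (fullFreq b Γ₀ x i *
      levelRate b (integrals b (lastCol x.2) (x.1ᵀ *ᵥ Γ₀)) (Real.cos (u + φ t 0))) t :=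
    fun t ht i => by
      have := hasDerivAt_pi.1 (hφ t ht) i
      simpa only [fullTorusAction, h.lastCol_flow, h.flowAtt_transpose_mulVec rfl,
        h.div_density] using this
  have h1 : ∀ t ∈ J, HasDerivAt (fun s => φ s 0) (levelRate b
      (integrals b (lastCol x.2) (x.1ᵀ *ᵥ Γ₀)) (Real.cos (u + φ t 0))) t := fun t ht => by
    simpa [fullFreq] using hrate t ht 0
  have h2 := fun t ht => hrate t ht 1
  have h3 := fun t ht => hrate t ht 2
  refine ⟨fun t _ => ((isFreeTorusAction_fullTorusAction hΓ₀).mapsTo _ _ hx).1, ?_,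
    fun t ht => ?_⟩
  · refine (momentumEquation_iff hI hJ fun t _ => wedge_axis_mem).2 fun t ht => ?_
    rw [hb]
    have := hasDerivAt_wedge_axis (h.hasDerivAt_flowVel (h1 t ht) (h2 t ht))
    rw [← h.flowAtt_transpose_mulVec rfl (φ t 0) (φ t 1) (φ t 2)] at this
    exact this
  · exact h.hasDerivAt_flowAtt x.1 (h1 t ht) (h2 t ht) (h3 t ht)

theorem hasDerivAt_of_isFullSolution {I₁ Iₙ Bₙ : ℝ} (hI : 0 < I₁ + Iₙ)
    {J : Set ℝ} (hJ : IsOpen J)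
    {x : ℝ → Matrix (Fin (m + 1)) (Fin (m + 1)) ℝ × Matrix (Fin (m + 1)) (Fin (m + 1)) ℝ}
    (hx : IsFullSolution (massTensor m I₁ Iₙ) (potential m Bₙ) (constraint m) Γ₀ J x) :
    ∀ t ∈ J, HasDerivAt x ((x t).1 * (x t).2,
      (Bₙ / (I₁ + Iₙ)) • wedge (axis m) ((x t).1ᵀ *ᵥ Γ₀)) t := fun t ht =>
  (hx.2.2 t ht).prodMk ((momentumEquation_iff hI hJ fun t ht => (hx.1 t ht).2).1 hx.2.1 t ht)

theorem contDiff_fullField (b : ℝ) (Γ₀ : Fin (m + 1) → ℝ) : ContDiff ℝ 1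
    fun x : Matrix (Fin (m + 1)) (Fin (m + 1)) ℝ × Matrix (Fin (m + 1)) (Fin (m + 1)) ℝ =>
      (x.1 * x.2, b • wedge (axis m) (x.1ᵀ *ᵥ Γ₀)) := by
  have h : ContDiff ℝ ∞
      fun x : Matrix (Fin (m + 1)) (Fin (m + 1)) ℝ × Matrix (Fin (m + 1)) (Fin (m + 1)) ℝ =>
        (x.1 * x.2, b • wedge (axis m) (x.1ᵀ *ᵥ Γ₀)) :=
    (contDiff_iff_contDiffAt.2 fun x => contDiffAt_matrix_mul contDiffAt_fst contDiffAt_snd).prodMk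
      ((contDiff_wedge_axis (contDiff_transpose_mulVec Γ₀)).const_smul b)
  exact h.of_le (by simp)

theorem contDiffAt_fullFreq (hx : x ∈ fullRegularPart b Γ₀) :
    ContDiffAt ℝ ∞ (fullFreq b Γ₀) x := by
  unfold fullFreq
  rw [contDiffAt_pi]
  intro i; fin_cases i
  · exact contDiffAt_const
  · exact contDiffAt_meanRate_integrals contDiff_lastCol_snd.contDiffAt
      (contDiff_transpose_mulVec Γ₀).contDiffAt fun C hC => contDiffAt_precession hx.2 hC
  · exact contDiffAt_meanRate_integrals contDiff_lastCol_snd.contDiffAt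
      (contDiff_transpose_mulVec Γ₀).contDiffAt fun C hC => contDiffAt_nodal hx.2 hC

end full

/-! ## Almost all states are regular -/

/-- The level set is a translate of a proper subspace. All null sets of singular states will be
reduced to such hyperplanes. -/
theorem addHaar_hyperplane_eq_zero {F : Type*} [NormedAddCommGroup F] [NormedSpace ℝ F]
    [FiniteDimensional ℝ F] [MeasurableSpace F] [BorelSpace F] (μ : Measure F)
    [μ.IsAddHaarMeasure] (ℓ : F →ₗ[ℝ] ℝ) {e : F} (he : ℓ e ≠ 0) (c : ℝ) :
    μ {x | ℓ x = c} = 0 := by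
  have hker : LinearMap.ker ℓ ≠ ⊤ := fun h => he (by
    have : e ∈ LinearMap.ker ℓ := h ▸ Submodule.mem_top
    exact this)
  have hset : {x | ℓ x = c} = (fun x => x + -((c / ℓ e) • e)) ⁻¹' (LinearMap.ker ℓ : Set F) := by
    ext x
    simp [he, ← sub_eq_add_neg, sub_eq_zero]
  rw [hset, measure_preimage_add_right]
  exact Measure.addHaar_submodule μ _ hker

section regular

variable {m : ℕ} {b : ℝ}

theorem snoc_dotProduct (w : Fin m → ℝ) (Γ : Fin (m + 1) → ℝ) :
    (Fin.snoc w 0 : Fin (m + 1) → ℝ) ⬝ᵥ Γ = w ⬝ᵥ Fin.init Γ := by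
  simp [dotProduct, Fin.sum_univ_castSucc, Fin.init]

theorem init_dotProduct_init {Γ : Fin (m + 1) → ℝ} (hΓ : Γ ⬝ᵥ Γ = 1) :
    Fin.init Γ ⬝ᵥ Fin.init Γ = 1 - height Γ ^ 2 := by
  rw [← hΓ]
  simp [dotProduct, Fin.sum_univ_castSucc, Fin.init, height]
  ring

/-- The cubic takes the value `(v ⬝ Γ)²` at the current height, so a state that is not at a turning
point exhibits a point of positivity. -/
theorem integrals_mem_regularValues {v Γ : Fin (m + 1) → ℝ} (hΓ : Γ ⬝ᵥ Γ = 1)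
    (hP : 0 < (integrals b v Γ).2) (hy : v ⬝ᵥ Γ ≠ 0) : integrals b v Γ ∈ regularValues b := by
  refine ⟨hP, height Γ, height_mem_Ioo hΓ hP, ?_⟩
  rw [← IsRegular.sq_eq_cubic]
  positivity

/-- `P` is the Gram determinant of `w` and `γ`: the vector `γ² w - (w ⬝ γ) γ` has squared length `γ²
P`. If it vanished, every `2 × 2` minor of the pair would vanish. -/
theorem integrals_snoc_snd_pos {w : Fin m → ℝ} {Γ : Fin (m + 1) → ℝ} (hΓ : Γ ⬝ᵥ Γ = 1)
    {i k : Fin m} (hne : Fin.init Γ k * w i - Fin.init Γ i * w k ≠ 0) :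
    0 < (integrals b (Fin.snoc w 0) Γ).2 := by
  simp only [integrals, ← init_dotProduct_init hΓ, snoc_dotProduct, Fin.init_snoc]
  set γ : Fin m → ℝ := Fin.init Γ
  have hγ : 0 < γ ⬝ᵥ γ := by
    refine lt_of_le_of_ne (dotProduct_self_star_nonneg γ) fun h => hne ?_
    have : γ = 0 := dotProduct_self_eq_zero.1 h.symm
    simp [this]
  have key : ((γ ⬝ᵥ γ) • w - (w ⬝ᵥ γ) • γ) ⬝ᵥ ((γ ⬝ᵥ γ) • w - (w ⬝ᵥ γ) • γ) =
      (γ ⬝ᵥ γ) * ((w ⬝ᵥ w) * (γ ⬝ᵥ γ) - (w ⬝ᵥ γ) ^ 2) := by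
    simp only [sub_dotProduct, dotProduct_sub, smul_dotProduct, dotProduct_smul, smul_eq_mul,
      dotProduct_comm γ w]
    ring
  have hnn : 0 ≤ ((γ ⬝ᵥ γ) • w - (w ⬝ᵥ γ) • γ) ⬝ᵥ ((γ ⬝ᵥ γ) • w - (w ⬝ᵥ γ) • γ) :=
    dotProduct_self_star_nonneg _
  rw [key] at hnn
  refine lt_of_le_of_ne (nonneg_of_mul_nonneg_right hnn hγ) fun h => hne ?_
  rw [← h, mul_zero] at key
  have h0 := dotProduct_self_eq_zero.1 key
  have hi := congrFun h0 i
  have hk := congrFun h0 k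
  simp only [Pi.sub_apply, Pi.smul_apply, smul_eq_mul, Pi.zero_apply] at hi hk
  have : (γ ⬝ᵥ γ) * (γ k * w i - γ i * w k) = 0 := by linear_combination γ k * hi - γ i * hk
  exact (mul_eq_zero.1 this).resolve_left hγ.ne'

/-- For a fixed non-vertical axis almost all velocities are regular. -/
theorem volume_irregular_eq_zero (hm : 2 ≤ m) {Γ : Fin (m + 1) → ℝ} (hΓ : Γ ⬝ᵥ Γ = 1)
    (hγ : Fin.init Γ ≠ (0 : Fin m → ℝ)) :
    volume {w : Fin m → ℝ | integrals b (Fin.snoc w 0) Γ ∉ regularValues b} = 0 := by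
  obtain ⟨k, hk⟩ := Function.ne_iff.1 hγ
  obtain ⟨i, hik⟩ : ∃ i : Fin m, i ≠ k := by
    have : Nontrivial (Fin m) := Fin.nontrivial_iff_two_le.2 hm
    exact exists_ne k
  have hk' : Fin.init Γ k ≠ 0 := hk
  -- Off the two hyperplanes `w ⬝ γ ≠ 0` and one minor of `(γ, w)` is nonzero, which suffices for
  -- regularity. A second index `i ≠ k` exists because `m ≥ 2`.
  let ℓ₁ : (Fin m → ℝ) →ₗ[ℝ] ℝ := Fintype.linearCombination ℝ (Fin.init Γ : Fin m → ℝ)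
  let ℓ₂ : (Fin m → ℝ) →ₗ[ℝ] ℝ :=
    (Fin.init Γ k : ℝ) • LinearMap.proj i - (Fin.init Γ i : ℝ) • LinearMap.proj k
  have h1 := addHaar_hyperplane_eq_zero volume ℓ₁ (e := Pi.single k 1)
    (by simpa [ℓ₁, Fintype.linearCombination_apply, Pi.single_apply] using hk') 0
  have h2 := addHaar_hyperplane_eq_zero volume ℓ₂ (e := Pi.single i 1)
    (by simpa [ℓ₂, hik.symm] using hk') 0
  refine measure_mono_null (fun w hw => ?_) (measure_union_null h1 h2)
  by_contra hcon
  simp only [mem_union, mem_ofPred_eq, not_or] at hcon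
  refine hw (integrals_mem_regularValues hΓ (integrals_snoc_snd_pos hΓ (i := i) (k := k) ?_) ?_)
  · simpa [ℓ₂] using hcon.2
  · rw [snoc_dotProduct]
    simpa [ℓ₁, Fintype.linearCombination_apply, dotProduct] using hcon.1

theorem eq_axis_of_init_eq_zero {Γ : Fin (m + 1) → ℝ} (hΓ : Γ ⬝ᵥ Γ = 1)
    (hγ : Fin.init Γ = (0 : Fin m → ℝ)) : Γ = axis m ∨ Γ = -axis m := by
  have h1 := init_dotProduct_init hΓ
  rw [hγ, zero_dotProduct] at h1
  have hc : ∀ i : Fin m, Γ i.castSucc = 0 := fun i => congrFun hγ i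
  have h2 : (Γ (Fin.last m) - 1) * (Γ (Fin.last m) + 1) = 0 := by
    simp only [height] at h1; linear_combination h1
  rcases mul_eq_zero.1 h2 with h | h
  · left; ext i
    refine Fin.lastCases ?_ (fun i => ?_) i
    · simp [axis]; linarith
    · simp [axis, hc]
  · right; ext i
    refine Fin.lastCases ?_ (fun i => ?_) i
    · simp [axis]; linarith
    · simp [axis, hc]

end regular

/-! ## Local parametrizations -/

section param

variable {E E' F F' : Type*} [NormedAddCommGroup E] [NormedSpace ℝ E]
  [NormedAddCommGroup E'] [NormedSpace ℝ E'] [NormedAddCommGroup F] [NormedSpace ℝ F]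
  [NormedAddCommGroup F'] [NormedSpace ℝ F']

theorem IsLocalParam.prod {S : Set E} {S' : Set E'} {σ : F → E} {σ' : F' → E'} {τ : E → F}
    {τ' : E' → F'} {U : Set F} {U' : Set F'} {O : Set E} {O' : Set E'}
    (h : IsLocalParam S σ τ U O) (h' : IsLocalParam S' σ' τ' U' O') :
    IsLocalParam (S ×ˢ S') (Prod.map σ σ') (Prod.map τ τ') (U ×ˢ U') (O ×ˢ O') where
  isOpen_source := h.isOpen_source.prod h'.isOpen_source
  isOpen_target := h.isOpen_target.prod h'.isOpen_target
  contDiffAt _ hy := (h.contDiffAt _ hy.1).prodMap' (h'.contDiffAt _ hy.2)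
  contDiffAt_inv _ hx := (h.contDiffAt_inv _ ⟨hx.1.1, hx.2.1⟩).prodMap'
    (h'.contDiffAt_inv _ ⟨hx.1.2, hx.2.2⟩)
  mapsTo _ hy := ⟨⟨(h.mapsTo _ hy.1).1, (h'.mapsTo _ hy.2).1⟩,
    (h.mapsTo _ hy.1).2, (h'.mapsTo _ hy.2).2⟩
  mapsTo_inv _ hx := ⟨h.mapsTo_inv _ ⟨hx.1.1, hx.2.1⟩, h'.mapsTo_inv _ ⟨hx.1.2, hx.2.2⟩⟩
  left_inv _ hy := Prod.ext (h.left_inv _ hy.1) (h'.left_inv _ hy.2)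
  right_inv _ hx := Prod.ext (h.right_inv _ ⟨hx.1.1, hx.2.1⟩) (h'.right_inv _ ⟨hx.1.2, hx.2.2⟩)

/-- Fubini's theorem needs a measurable set; the exceptional set is one because the regular part is
relatively open. -/
theorem IsLocalParam.measurableSet_preimage_compl [MeasurableSpace F] [BorelSpace F]
    {S Q : Set E} {σ : F → E} {τ : E → F} {U : Set F} {O : Set E} (h : IsLocalParam S σ τ U O)
    (hQ : ∃ O', IsOpen O' ∧ Q = S ∩ O') : MeasurableSet (U ∩ σ ⁻¹' Qᶜ) := by
  obtain ⟨O', hO', rfl⟩ := hQ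
  have hc : ContinuousOn σ U := fun y hy => (h.contDiffAt y hy).continuousAt.continuousWithinAt
  have : U ∩ σ ⁻¹' (S ∩ O')ᶜ = U \ (U ∩ σ ⁻¹' O') := by
    ext y
    simp only [mem_inter_iff, mem_preimage, mem_compl_iff, Set.mem_sdiff, not_and]
    exact ⟨fun hy => ⟨hy.1, fun hU => hy.2 (h.mapsTo y hU).1⟩, fun hy => ⟨hy.1, fun _ => hy.2 hy.1⟩⟩
  rw [this]
  exact h.isOpen_source.measurableSet.diff
    (hc.isOpen_inter_preimage h.isOpen_source hO').measurableSet

end param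

/-! ### A global chart of the admissible velocities. -/

section velocity

variable {m : ℕ}

theorem isLocalParam_admissible : IsLocalParam (admissible (constraint m))
    (fun w : Fin m → ℝ => wedge (Fin.snoc w 0 : Fin (m + 1) → ℝ) (axis m))
    (fun Ω => Fin.init (lastCol Ω)) univ univ where
  isOpen_source := isOpen_univ
  isOpen_target := isOpen_univ
  contDiffAt w _ := by
    have h : ContDiffAt ℝ ∞ (fun w : Fin m → ℝ => (Fin.snoc w 0 : Fin (m + 1) → ℝ)) w := by
      refine contDiffAt_pi.2 fun i => ?_
      refine Fin.lastCases ?_ (fun i => ?_) i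
      · simpa only [Fin.snoc_last] using contDiffAt_const
      · simpa only [Fin.snoc_castSucc, id] using contDiffAt_pi.1 contDiffAt_id i
    exact (wedgeAxis m).contDiff.contDiffAt.comp w h
  contDiffAt_inv Ω _ := contDiffAt_pi.2 fun i =>
    contDiffAt_pi.1 (lastColMap m).contDiff.contDiffAt i.castSucc
  mapsTo w _ := ⟨wedge_axis_mem, mem_univ _⟩
  mapsTo_inv _ _ := mem_univ _
  left_inv w _ := by
    rw [lastCol_wedge (by simp), Fin.init_snoc]
  right_inv Ω hΩ := by
    have h : (Fin.snoc (Fin.init (lastCol Ω)) 0 : Fin (m + 1) → ℝ) = lastCol Ω := by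
      rw [← lastCol_last hΩ.1]; exact Fin.snoc_init_self _
    simp only [h, wedge_lastCol hΩ.1]

end velocity

/-! ## The sphere -/

section sphere

variable {m : ℕ}

/-- The graph parametrization of a hemisphere. -/
def hemisphere (j : Fin (m + 1)) (s : ℝ) (p : Fin m → ℝ) : Fin (m + 1) → ℝ :=
  j.insertNth (s * Real.sqrt (1 - p ⬝ᵥ p)) p

/-- The sphere as a graph over the coordinates other than the `j`-th; `s = ±1` selects the
hemisphere. -/
theorem isLocalParam_sphere (j : Fin (m + 1)) {s : ℝ} (hs : s * s = 1) :
    IsLocalParam {Γ : Fin (m + 1) → ℝ | Γ ⬝ᵥ Γ = 1} (hemisphere j s) (fun Γ => j.removeNth Γ)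
      {p : Fin m → ℝ | p ⬝ᵥ p < 1} {Γ | 0 < s * Γ j} := by
  have hsq : ∀ Γ : Fin (m + 1) → ℝ, Γ ⬝ᵥ Γ = Γ j ^ 2 + j.removeNth Γ ⬝ᵥ j.removeNth Γ :=
    fun Γ => by
      simp only [dotProduct]
      rw [Fin.sum_univ_succAbove _ j, pow_two]; rfl
  have hcont : Continuous fun p : Fin m → ℝ => p ⬝ᵥ p := by
    simp only [dotProduct]; fun_prop
  refine ⟨isOpen_lt hcont continuous_const,
    isOpen_lt continuous_const (continuous_const.mul (continuous_apply j)), fun p hp => ?_,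
    fun Γ _ => contDiffAt_pi.2 fun i => contDiffAt_pi.1 contDiffAt_id (j.succAbove i),
    fun p hp => ⟨?_, ?_⟩, fun Γ hΓ => ?_, fun p _ => ?_, fun Γ hΓ => ?_⟩
  · have hp' : 0 < 1 - p ⬝ᵥ p := sub_pos.2 hp
    refine contDiffAt_pi.2 ((Fin.forall_iff_succAbove j).2 ⟨?_, fun i => ?_⟩)
    · simp only [hemisphere, Fin.insertNth_apply_same]
      exact contDiffAt_const.mul ((contDiffAt_const.sub
        (contDiffAt_dotProduct contDiffAt_id contDiffAt_id)).sqrt hp'.ne')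
    · simp only [hemisphere, Fin.insertNth_apply_succAbove]
      exact contDiffAt_pi.1 contDiffAt_id i
  · have hp' : 0 < 1 - p ⬝ᵥ p := sub_pos.2 hp
    change hemisphere j s p ⬝ᵥ hemisphere j s p = 1
    rw [hsq, hemisphere, Fin.insertNth_apply_same, Fin.removeNth_insertNth, mul_pow,
      Real.sq_sqrt hp'.le, pow_two, hs]
    ring
  · have hp' : 0 < 1 - p ⬝ᵥ p := sub_pos.2 hp
    change 0 < s * hemisphere j s p j
    rw [hemisphere, Fin.insertNth_apply_same, ← mul_assoc, hs, one_mul]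
    exact Real.sqrt_pos.2 hp'
  · have h1 : Γ ⬝ᵥ Γ = 1 := hΓ.1
    have h2 : 0 < s * Γ j := hΓ.2
    rw [hsq] at h1
    have h3 : Γ j ≠ 0 := fun h => by simp [h] at h2
    have h4 : 0 < Γ j ^ 2 := by positivity
    change j.removeNth Γ ⬝ᵥ j.removeNth Γ < 1
    linarith
  · simp only [hemisphere, Fin.removeNth_insertNth]
  · have h1 : Γ ⬝ᵥ Γ = 1 := hΓ.1
    have h2 : 0 < s * Γ j := hΓ.2
    rw [hsq] at h1
    have h3 : 1 - j.removeNth Γ ⬝ᵥ j.removeNth Γ = (s * Γ j) ^ 2 := by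
      rw [mul_pow, pow_two s, hs]; linarith
    simp only [hemisphere]
    rw [h3, Real.sqrt_sq h2.le, ← mul_assoc, hs, one_mul, Fin.insertNth_self_removeNth]

theorem exists_isLocalParam_sphere {Γ : Fin (m + 1) → ℝ} (hΓ : Γ ⬝ᵥ Γ = 1) :
    ∃ (j : Fin (m + 1)) (s : ℝ), s * s = 1 ∧ 0 < s * Γ j := by
  obtain ⟨j, hj⟩ : ∃ j, Γ j ≠ 0 := by
    by_contra! h
    have : Γ = 0 := funext h
    simp [this] at hΓ
  rcases lt_or_gt_of_ne hj with h | h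
  · exact ⟨j, -1, by norm_num, by linarith⟩
  · exact ⟨j, 1, by norm_num, by linarith⟩

/-- The vertical axis is attained on a null set of parameters. -/
theorem volume_hemisphere_vertical (hm : 2 ≤ m) (j : Fin (m + 1)) {s : ℝ} (hs : s * s = 1) :
    volume {p : Fin m → ℝ | p ⬝ᵥ p < 1 ∧ Fin.init (hemisphere j s p) = (0 : Fin m → ℝ)} = 0 := by
  -- A vertical `Γ` is `±eₙ`, so every coordinate of the parameter has one of two fixed values; a
  -- single coordinate already gives two hyperplanes.
  let i : Fin m := ⟨0, by omega⟩
  let ℓ : (Fin m → ℝ) →ₗ[ℝ] ℝ := LinearMap.proj i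
  have h1 := addHaar_hyperplane_eq_zero volume ℓ (e := Pi.single i 1) (by simp [ℓ])
    (axis m (j.succAbove i))
  have h2 := addHaar_hyperplane_eq_zero volume ℓ (e := Pi.single i 1) (by simp [ℓ])
    (-axis m (j.succAbove i))
  refine measure_mono_null (fun p hp => ?_) (measure_union_null h1 h2)
  have hu := ((isLocalParam_sphere j hs).mapsTo p hp.1).1
  have hpi : p i = hemisphere j s p (j.succAbove i) := by
    simp only [hemisphere, Fin.insertNth_apply_succAbove]
  rcases eq_axis_of_init_eq_zero hu hp.2 with h | h
  · left
    change p i = _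
    rw [hpi, h]
  · right
    change p i = _
    rw [hpi, h]; rfl

end sphere

/-! ## The rotation group -/

section rotation

variable {n : ℕ}

/-- Coordinates of skew-symmetric matrices: the pairs `i < j`. -/
abbrev UpperIndex (n : ℕ) : Type := {q : Fin n × Fin n // q.1 < q.2}

def skew (a : UpperIndex n → ℝ) : Matrix (Fin n) (Fin n) ℝ :=
  Matrix.of fun i j => if h : i < j then a ⟨(i, j), h⟩ else
    if h : j < i then -a ⟨(j, i), h⟩ else 0

def upper (M : Matrix (Fin n) (Fin n) ℝ) : UpperIndex n → ℝ := fun q => M q.1.1 q.1.2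

theorem card_upperIndex (n : ℕ) : Fintype.card (UpperIndex n) = n.choose 2 := by
  rw [Fintype.card_subtype, Finset.card_filter, Fintype.sum_prod_type_right]
  have : ∀ j : Fin n, (∑ i : Fin n, if i < j then 1 else 0) = (j : ℕ) := fun j => by
    rw [← Finset.card_filter, show Finset.univ.filter (· < j) = Finset.Iio j by ext; simp,
      Fin.card_Iio]
  simp only [this]
  rw [Fin.sum_univ_eq_sum_range (fun i => i), Finset.sum_range_id, Nat.choose_two_right]

theorem upper_skew (a : UpperIndex n → ℝ) : upper (skew a) = a := by
  ext q
  simp [upper, skew, q.2]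

theorem skew_upper {M : Matrix (Fin n) (Fin n) ℝ} (hM : Mᵀ = -M) : skew (upper M) = M := by
  have h : ∀ i j, M j i = -M i j := fun i j => congrFun (congrFun hM i) j
  ext i j
  rcases lt_trichotomy i j with hij | rfl | hij
  · simp [skew, upper, hij]
  · have := h i i
    simp only [skew, Matrix.of_apply, lt_irrefl, dite_false]
    linarith
  · simp [skew, upper, hij, not_lt.2 hij.le, h j i]

theorem skew_transpose (a : UpperIndex n → ℝ) : (skew a)ᵀ = -skew a := by
  ext i j
  rcases lt_trichotomy i j with hij | rfl | hij
  · simp [skew, hij, not_lt.2 hij.le]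
  · simp [skew]
  · simp [skew, hij, not_lt.2 hij.le]

/-- For skew `X` one has `v ⬝ Xv = 0`, so `Xv = v` forces `v = 0`. -/
theorem det_one_sub_ne_zero {X : Matrix (Fin n) (Fin n) ℝ} (hX : Xᵀ = -X) : (1 - X).det ≠ 0 := by
  intro h
  obtain ⟨v, hv0, hv⟩ := Matrix.exists_mulVec_eq_zero_iff.2 h
  have h1 : X *ᵥ v = v := by
    rw [Matrix.sub_mulVec, Matrix.one_mulVec, sub_eq_zero] at hv
    exact hv.symm
  have h2 : v ⬝ᵥ (X *ᵥ v) = -(v ⬝ᵥ (X *ᵥ v)) := by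
    conv_lhs => rw [Matrix.dotProduct_mulVec, ← Matrix.mulVec_transpose, hX, Matrix.neg_mulVec,
      neg_dotProduct, dotProduct_comm]
  rw [h1] at h2
  exact hv0 (dotProduct_self_eq_zero.1 (by linarith))

/-- The Cayley transform. -/
def cayley (X : Matrix (Fin n) (Fin n) ℝ) : Matrix (Fin n) (Fin n) ℝ := (1 - X)⁻¹ * (1 + X)

theorem one_sub_mul_cayley {X : Matrix (Fin n) (Fin n) ℝ} (hX : Xᵀ = -X) :
    (1 - X) * cayley X = 1 + X :=
  Matrix.mul_nonsing_inv_cancel_left _ _ (isUnit_iff_ne_zero.2 (det_one_sub_ne_zero hX))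

theorem one_add_mul_cayley_transpose {X : Matrix (Fin n) (Fin n) ℝ} (hX : Xᵀ = -X) :
    (cayley X)ᵀ * (1 + X) = 1 - X := by
  have := congrArg Matrix.transpose (one_sub_mul_cayley hX)
  simpa [Matrix.transpose_mul, hX, ← sub_eq_add_neg] using this

/-- Transposition exchanges `1 - X` and `1 + X`, which commute and have equal determinants. -/
theorem cayley_mem {X : Matrix (Fin n) (Fin n) ℝ} (hX : Xᵀ = -X) :
    cayley X ∈ Matrix.specialOrthogonalGroup (Fin n) ℝ := by
  have hd := det_one_sub_ne_zero hX
  have hdet : (1 + X).det = (1 - X).det := by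
    rw [← Matrix.det_transpose (1 - X)]
    simp [hX]
  have hU : IsUnit (1 - X).det := isUnit_iff_ne_zero.2 hd
  have hU' : IsUnit (1 + X).det := by rw [hdet]; exact hU
  rw [Matrix.mem_specialOrthogonalGroup_iff, Matrix.mem_orthogonalGroup_iff']
  refine ⟨?_, ?_⟩
  · have h1 : (cayley X)ᵀ = (1 - X) * (1 + X)⁻¹ := by
      rw [← one_add_mul_cayley_transpose hX, Matrix.mul_nonsing_inv_cancel_right _ _ hU']
    have hc : (1 + X)⁻¹ * ((1 - X)⁻¹ * (1 + X)) = (1 - X)⁻¹ := by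
      have : (1 - X)⁻¹ * (1 + X) = (1 + X) * (1 - X)⁻¹ := by
        have e : (1 + X) * (1 - X) = (1 - X) * (1 + X) := by noncomm_ring
        calc (1 - X)⁻¹ * (1 + X) = (1 - X)⁻¹ * ((1 + X) * (1 - X)) * (1 - X)⁻¹ := by
              rw [← Matrix.mul_assoc, Matrix.mul_nonsing_inv_cancel_right _ _ hU]
          _ = _ := by rw [e, Matrix.nonsing_inv_mul_cancel_left _ _ hU]
      rw [this, Matrix.nonsing_inv_mul_cancel_left _ _ hU']
    change (cayley X)ᵀ * cayley X = 1
    rw [h1, Matrix.mul_assoc, cayley, hc, Matrix.mul_nonsing_inv _ hU]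
  · have := congrArg Matrix.det (one_sub_mul_cayley hX)
    rw [Matrix.det_mul, hdet] at this
    exact mul_left_cancel₀ hd (by rw [this, mul_one])

/-- The inverse of the Cayley transform. -/
def invCayley (Y : Matrix (Fin n) (Fin n) ℝ) : Matrix (Fin n) (Fin n) ℝ := (Y - 1) * (1 + Y)⁻¹

theorem invCayley_mul {Y : Matrix (Fin n) (Fin n) ℝ} (hY : (1 + Y).det ≠ 0) :
    invCayley Y * (1 + Y) = Y - 1 :=
  Matrix.nonsing_inv_mul_cancel_right _ _ (isUnit_iff_ne_zero.2 hY)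

theorem invCayley_transpose {Y : Matrix (Fin n) (Fin n) ℝ} (hY : (1 + Y).det ≠ 0)
    (hYY : Yᵀ * Y = 1) : (invCayley Y)ᵀ = -invCayley Y := by
  have hU : IsUnit (1 + Y).det := isUnit_iff_ne_zero.2 hY
  have hU' : IsUnit (1 + Y)ᵀ.det := by rwa [Matrix.det_transpose]
  have h1 := invCayley_mul hY
  have h2 := congrArg Matrix.transpose h1
  rw [Matrix.transpose_mul] at h2
  -- Conjugating by the invertible `1 + Y` turns the claim into `(Y - 1)ᵀ(1 + Y) + (1 + Y)ᵀ(Y - 1) =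
  -- 2 (YᵀY - 1) = 0`.
  have h3 : (1 + Y)ᵀ * ((invCayley Y)ᵀ + invCayley Y) * (1 + Y) = 0 := by
    rw [Matrix.mul_add (1 + Y)ᵀ, Matrix.add_mul _ _ (1 + Y), h2, Matrix.mul_assoc, h1]
    simp only [Matrix.transpose_add, Matrix.transpose_sub, Matrix.transpose_one, Matrix.add_mul,
      Matrix.sub_mul, Matrix.mul_add, Matrix.mul_sub, Matrix.one_mul, Matrix.mul_one, hYY]
    abel
  have h4 : (1 + Y)ᵀ * ((invCayley Y)ᵀ + invCayley Y) = 0 := by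
    rw [← Matrix.mul_nonsing_inv_cancel_right _ ((1 + Y)ᵀ * _) hU, h3, Matrix.zero_mul]
  rw [eq_neg_iff_add_eq_zero, ← Matrix.nonsing_inv_mul_cancel_left _ ((invCayley Y)ᵀ + _) hU', h4,
    Matrix.mul_zero]

theorem cayley_invCayley {Y : Matrix (Fin n) (Fin n) ℝ} (hY : (1 + Y).det ≠ 0)
    (hYY : Yᵀ * Y = 1) : cayley (invCayley Y) = Y := by
  have hX := invCayley_transpose hY hYY
  have h1 := invCayley_mul hY
  have h2 : (1 - invCayley Y) * Y = 1 + invCayley Y := by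
    rw [Matrix.mul_add, Matrix.mul_one] at h1
    rw [Matrix.sub_mul, Matrix.one_mul, sub_eq_iff_eq_add, add_assoc, h1]
    abel
  rw [cayley, ← h2, Matrix.nonsing_inv_mul_cancel_left _ _
    (isUnit_iff_ne_zero.2 (det_one_sub_ne_zero hX))]

theorem det_one_add_cayley_ne_zero {X : Matrix (Fin n) (Fin n) ℝ} (hX : Xᵀ = -X) :
    (1 + cayley X).det ≠ 0 := by
  have h : (1 - X) * (1 + cayley X) = (2 : ℝ) • 1 := by
    rw [Matrix.mul_add, one_sub_mul_cayley hX, two_smul]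
    noncomm_ring
  intro h0
  have := congrArg Matrix.det h
  rw [Matrix.det_mul, h0, mul_zero, Matrix.det_smul, Matrix.det_one, mul_one] at this
  exact (pow_ne_zero _ two_ne_zero) this.symm

theorem invCayley_cayley {X : Matrix (Fin n) (Fin n) ℝ} (hX : Xᵀ = -X) :
    invCayley (cayley X) = X := by
  have h : X * (1 + cayley X) = cayley X - 1 := by
    have := one_sub_mul_cayley hX
    rw [Matrix.sub_mul, Matrix.one_mul, sub_eq_iff_eq_add] at this
    rw [Matrix.mul_add, Matrix.mul_one, eq_sub_iff_add_eq]
    conv_rhs => rw [this]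
    abel
  rw [invCayley, ← h, Matrix.mul_nonsing_inv_cancel_right _ _
    (isUnit_iff_ne_zero.2 (det_one_add_cayley_ne_zero hX))]

section smooth

variable {W : Type*} [NormedAddCommGroup W] [NormedSpace ℝ W] {w : W}
  {M : W → Matrix (Fin n) (Fin n) ℝ}

theorem contDiffAt_det (hM : ContDiffAt ℝ ∞ M w) : ContDiffAt ℝ ∞ (fun p => (M p).det) w := by
  simp only [Matrix.det_apply]
  refine ContDiffAt.sum fun π _ => ContDiffAt.const_smul _ ?_
  exact contDiffAt_prod fun i _ => contDiffAt_matrix.1 hM _ _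

theorem contDiffAt_matrix_inv (hM : ContDiffAt ℝ ∞ M w) (hw : (M w).det ≠ 0) :
    ContDiffAt ℝ ∞ (fun p => (M p)⁻¹) w := by
  rw [contDiffAt_matrix]
  intro i j
  simp only [Matrix.inv_def, Ring.inverse_eq_inv', Matrix.smul_apply, smul_eq_mul,
    Matrix.adjugate_apply]
  refine ((contDiffAt_det hM).inv hw).mul (contDiffAt_det (contDiffAt_matrix.2 fun a c => ?_))
  by_cases h : a = j
  · subst h
    simpa only [Matrix.updateRow_self] using contDiffAt_const
  · simpa only [Matrix.updateRow_ne h] using contDiffAt_matrix.1 hM a c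

theorem contDiffAt_skew (a : UpperIndex n → ℝ) : ContDiffAt ℝ ∞ (skew (n := n)) a := by
  refine contDiffAt_matrix.2 fun i j => ?_
  rcases lt_trichotomy i j with hij | rfl | hij
  · simpa [skew, hij] using contDiffAt_pi.1 contDiffAt_id _
  · simpa [skew] using contDiffAt_const
  · simpa [skew, hij, not_lt.2 hij.le] using (contDiffAt_pi.1 contDiffAt_id _).neg

end smooth

/-- The Cayley chart translated to `g₀`. Its source is the whole space of skew matrices, so no
domain has to be tracked, and the equations of the exceptional set become linear in it. -/
theorem isLocalParam_rotation {g₀ : Matrix (Fin n) (Fin n) ℝ}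
    (hg₀ : g₀ ∈ Matrix.specialOrthogonalGroup (Fin n) ℝ) :
    IsLocalParam (Matrix.specialOrthogonalGroup (Fin n) ℝ : Set (Matrix (Fin n) (Fin n) ℝ))
      (fun a => g₀ * cayley (skew a)) (fun g => upper (invCayley (g₀ᵀ * g))) univ
      {g | (1 + g₀ᵀ * g).det ≠ 0} := by
  have h1 : ∀ g, g ∈ Matrix.specialOrthogonalGroup (Fin n) ℝ →
      (g₀ᵀ * g)ᵀ * (g₀ᵀ * g) = 1 := fun g hg => by
    rw [Matrix.transpose_mul, Matrix.transpose_transpose, Matrix.mul_assoc, ← Matrix.mul_assoc g₀,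
      mul_transpose_of_mem hg₀, Matrix.one_mul, transpose_mul_of_mem hg]
  have h2 : ∀ M : Matrix (Fin n) (Fin n) ℝ, g₀ᵀ * (g₀ * M) = M := fun M => by
    rw [← Matrix.mul_assoc, transpose_mul_of_mem hg₀, Matrix.one_mul]
  have h3 : ∀ M : Matrix (Fin n) (Fin n) ℝ, g₀ * (g₀ᵀ * M) = M := fun M => by
    rw [← Matrix.mul_assoc, mul_transpose_of_mem hg₀, Matrix.one_mul]
  have h4 : ∀ g, ContDiffAt ℝ ∞ (fun g : Matrix (Fin n) (Fin n) ℝ => g₀ᵀ * g) g := fun g =>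
    contDiffAt_matrix_mul contDiffAt_const contDiffAt_id
  refine ⟨isOpen_univ, ?_, fun a _ => ?_, fun g hg => ?_, fun a _ => ⟨?_, ?_⟩,
    fun _ _ => mem_univ _, fun a _ => ?_, fun g hg => ?_⟩
  · refine isOpen_ne_fun ?_ continuous_const
    exact continuous_iff_continuousAt.2 fun g =>
      (contDiffAt_det (contDiffAt_const.add (h4 g))).continuousAt
  · exact contDiffAt_matrix_mul contDiffAt_const (contDiffAt_matrix_mul
      (contDiffAt_matrix_inv (contDiffAt_const.sub (contDiffAt_skew a))
        (det_one_sub_ne_zero (skew_transpose a)))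
      (contDiffAt_const.add (contDiffAt_skew a)))
  · refine contDiffAt_pi.2 fun q => ?_
    exact contDiffAt_matrix.1 (contDiffAt_matrix_mul ((h4 g).sub contDiffAt_const)
      (contDiffAt_matrix_inv (contDiffAt_const.add (h4 g)) hg.2)) _ _
  · exact mul_mem hg₀ (cayley_mem (skew_transpose a))
  · simp only [mem_ofPred_eq, h2]
    exact det_one_add_cayley_ne_zero (skew_transpose a)
  · simp only [h2, invCayley_cayley (skew_transpose a), upper_skew]
  · have h5 := h1 g hg.1
    simp only [skew_upper (invCayley_transpose hg.2 h5), cayley_invCayley hg.2 h5, h3]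

theorem mem_rotation_chart {g₀ : Matrix (Fin n) (Fin n) ℝ}
    (hg₀ : g₀ ∈ Matrix.specialOrthogonalGroup (Fin n) ℝ) : (1 + g₀ᵀ * g₀).det ≠ 0 := by
  rw [transpose_mul_of_mem hg₀, ← two_smul ℝ (1 : Matrix (Fin n) (Fin n) ℝ), Matrix.det_smul,
    Matrix.det_one]
  simp

end rotation

/-! ## Singular attitudes -/

section attitude

variable {n : ℕ}

theorem skew_add (a c : UpperIndex n → ℝ) : skew (a + c) = skew a + skew c := by
  ext i j
  simp only [skew, Matrix.of_apply, Matrix.add_apply, Pi.add_apply]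
  split_ifs <;> ring

theorem skew_smul (r : ℝ) (a : UpperIndex n → ℝ) : skew (r • a) = r • skew a := by
  ext i j
  simp only [skew, Matrix.of_apply, Matrix.smul_apply, Pi.smul_apply, smul_eq_mul]
  split_ifs <;> ring

/-- For `p ≠ 0` one component of `Xp`, taken at an index other than that of a nonzero entry of `p`,
is a nonzero linear form in `X`; for `p = 0` there is no solution. -/
theorem volume_skew_mulVec_eq (hn : 2 ≤ n) {p q : Fin n → ℝ} (hpq : p = 0 → q ≠ 0) :
    volume {a : UpperIndex n → ℝ | skew a *ᵥ p = q} = 0 := by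
  by_cases hp : p = 0
  · have : {a : UpperIndex n → ℝ | skew a *ᵥ p = q} = ∅ := by
      ext a
      simp [hp, (hpq hp).symm]
    rw [this, measure_empty]
  obtain ⟨k, hk⟩ := Function.ne_iff.1 hp
  obtain ⟨i, hik⟩ : ∃ i : Fin n, i ≠ k := by
    have : Nontrivial (Fin n) := Fin.nontrivial_iff_two_le.2 hn
    exact exists_ne k
  let ℓ : (UpperIndex n → ℝ) →ₗ[ℝ] ℝ :=
    { toFun := fun a => (skew a *ᵥ p) i
      map_add' := fun a c => by rw [skew_add, Matrix.add_mulVec, Pi.add_apply]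
      map_smul' := fun r a => by
        rw [skew_smul, Matrix.smul_mulVec, Pi.smul_apply, RingHom.id_apply] }
  refine measure_mono_null (fun a (ha : skew a *ᵥ p = q) => ?_)
    (addHaar_hyperplane_eq_zero volume ℓ
      (e := upper (Matrix.single i k 1 - Matrix.single k i 1)) ?_ (q i))
  · exact congrFun ha i
  · change (skew (upper _) *ᵥ p) i ≠ 0
    rw [skew_upper (by simp)]
    simpa [Matrix.sub_mulVec, Matrix.single_mulVec, hik, hik.symm] using hk

/-- The Cayley transform turns `gᵀw = y`, that is `w = gy`, into `(1 - X) w = (1 + X) y`, a linear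
condition on `X`. -/
theorem skew_mulVec_of_cayley {X : Matrix (Fin n) (Fin n) ℝ} (hX : Xᵀ = -X) {w y : Fin n → ℝ}
    (h : (cayley X)ᵀ *ᵥ w = y) : X *ᵥ (w + y) = w - y := by
  have h1 : w = cayley X *ᵥ y := by
    rw [← h, Matrix.mulVec_mulVec, mul_transpose_of_mem (cayley_mem hX), Matrix.one_mulVec]
  have h2 : (1 - X) *ᵥ w = (1 + X) *ᵥ y := by
    rw [← one_sub_mul_cayley hX, ← Matrix.mulVec_mulVec, ← h1]
  rw [Matrix.sub_mulVec, Matrix.add_mulVec, Matrix.one_mulVec, Matrix.one_mulVec] at h2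
  rw [Matrix.mulVec_add, eq_sub_iff_add_eq, add_assoc, add_comm (X *ᵥ y), ← h2,
    add_sub_cancel]

theorem volume_rotation_vertical {m : ℕ} (hm : 2 ≤ m)
    {g₀ : Matrix (Fin (m + 1)) (Fin (m + 1)) ℝ}
    (hg₀ : g₀ ∈ Matrix.specialOrthogonalGroup (Fin (m + 1)) ℝ) {Γ₀ : Fin (m + 1) → ℝ}
    (hΓ₀ : Γ₀ ⬝ᵥ Γ₀ = 1) :
    volume {a : UpperIndex (m + 1) → ℝ |
      Fin.init ((g₀ * cayley (skew a))ᵀ *ᵥ Γ₀) = (0 : Fin m → ℝ)} = 0 := by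
  have hax : axis m ≠ 0 := fun h => by
    have := congrFun h (Fin.last m)
    simp [axis] at this
  -- Used with `y = ±eₙ`. If the sum `g₀ᵀΓ₀ + y` vanishes, the difference is `-2y ≠ 0`, so the
  -- linear equation is never trivial.
  have key : ∀ y : Fin (m + 1) → ℝ, y ≠ 0 →
      volume {a | skew a *ᵥ (g₀ᵀ *ᵥ Γ₀ + y) = g₀ᵀ *ᵥ Γ₀ - y} = 0 := fun y hy =>
    volume_skew_mulVec_eq (by omega) fun h1 h2 => hy (by
      have h3 : (2 : ℝ) • y = (g₀ᵀ *ᵥ Γ₀ + y) - (g₀ᵀ *ᵥ Γ₀ - y) := by rw [two_smul]; abel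
      rw [h1, h2, sub_zero] at h3
      exact (smul_eq_zero.1 h3).resolve_left two_ne_zero)
  refine measure_mono_null (fun a ha => ?_)
    (measure_union_null (key _ hax) (key _ (neg_ne_zero.2 hax)))
  have hu : ((g₀ * cayley (skew a))ᵀ *ᵥ Γ₀) ⬝ᵥ ((g₀ * cayley (skew a))ᵀ *ᵥ Γ₀) = 1 := by
    rw [transpose_mulVec_sq (mul_mem hg₀ (cayley_mem (skew_transpose a))), hΓ₀]
  have hmul : (g₀ * cayley (skew a))ᵀ *ᵥ Γ₀ = (cayley (skew a))ᵀ *ᵥ (g₀ᵀ *ᵥ Γ₀) := by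
    rw [Matrix.transpose_mul, Matrix.mulVec_mulVec]
  rcases eq_axis_of_init_eq_zero hu ha with h | h <;> rw [hmul] at h
  · exact Or.inl (skew_mulVec_of_cayley (skew_transpose a) h)
  · exact Or.inr (skew_mulVec_of_cayley (skew_transpose a) h)

end attitude

/-! ## Complete integrability -/

theorem prod_eq_zero_of_ae_fst {α β : Type*} [MeasurableSpace α] [MeasurableSpace β]
    {μ : Measure α} {ν : Measure β} [SFinite ν] {s : Set (α × β)} (hs : MeasurableSet s)
    {N : Set α} (hN : μ N = 0) (h : ∀ x ∉ N, ν {y | (x, y) ∈ s} = 0) : μ.prod ν s = 0 := by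
  rw [Measure.measure_prod_null hs]
  filter_upwards [measure_eq_zero_iff_ae_notMem.1 hN] with x hx using h x hx

theorem prod_eq_zero_of_ae_snd {α β : Type*} [MeasurableSpace α] [MeasurableSpace β]
    {μ : Measure α} {ν : Measure β} [SFinite μ] [SFinite ν] {s : Set (α × β)}
    (hs : MeasurableSet s) {N : Set β} (hN : ν N = 0) (h : ∀ y ∉ N, μ {x | (x, y) ∈ s} = 0) :
    μ.prod ν s = 0 := by
  rw [← Measure.prod_swap, Measure.map_apply measurable_swap hs]
  exact prod_eq_zero_of_ae_fst (measurable_swap hs) hN h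

section integrability

variable {m : ℕ} {I₁ Iₙ Bₙ : ℝ}

theorem isCompletelyIntegrable_reduced (hm : 2 ≤ m) (hI : 0 < I₁ + Iₙ) :
    IsCompletelyIntegrable (phaseSpace (constraint m)) (2 * m)
      (IsSolution (massTensor m I₁ Iₙ) (potential m Bₙ) (constraint m)) := by
  have hA := isFreeTorusAction_torusAction (m := m) (b := Bₙ / (I₁ + Iₙ))
  have hcharts : ∀ x ∈ phaseSpace (constraint m), ∃ (σ : (Fin m → ℝ) × (Fin m → ℝ) → _)
      (τ : _ → (Fin m → ℝ) × (Fin m → ℝ)) (U : Set ((Fin m → ℝ) × (Fin m → ℝ))) (O : Set _),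
      IsLocalParam (phaseSpace (constraint m)) σ τ U O ∧ x ∈ O ∧
        volume (U ∩ σ ⁻¹' (regularPart (Bₙ / (I₁ + Iₙ)) m)ᶜ) = 0 := by
    intro x hx
    obtain ⟨j, s, hs, hxj⟩ := exists_isLocalParam_sphere hx.2
    have hprod : IsLocalParam (phaseSpace (constraint m)) _ _ _ _ :=
      isLocalParam_admissible.prod (isLocalParam_sphere j hs)
    refine ⟨_, _, _, _, hprod, ⟨mem_univ _, hxj⟩, ?_⟩
    -- Fubini over `Γ`: vertical directions form a null set, and over every other direction almost
    -- all velocities are regular.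
    refine prod_eq_zero_of_ae_snd (hprod.measurableSet_preimage_compl hA.isOpen)
      (volume_hemisphere_vertical hm j hs) fun p hp => ?_
    by_cases hp1 : p ⬝ᵥ p < 1
    · have hunit := ((isLocalParam_sphere j hs).mapsTo p hp1).1
      refine measure_mono_null (fun w hw => ?_)
        (volume_irregular_eq_zero (b := Bₙ / (I₁ + Iₙ)) hm hunit fun h => hp ⟨hp1, h⟩)
      intro hreg
      refine hw.2 ⟨⟨wedge_axis_mem, hunit⟩, ?_⟩
      change integrals _ (lastCol (wedge (Fin.snoc w 0 : Fin (m + 1) → ℝ) (axis m)))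
        (hemisphere j s p) ∈ regularValues _
      rwa [lastCol_wedge (by simp)]
    · refine measure_mono_null (fun w hw => ?_) measure_empty
      exact hp1 hw.1.2
  have hμ : ((volume : Measure (Fin m → ℝ)).prod
      (volume : Measure (Fin m → ℝ))).IsAddHaarMeasure := Measure.prod.instIsAddHaarMeasure _ _
  -- The tori are two-dimensional; the remaining `2m - 2` coordinates label them.
  exact isCompletelyIntegrable_of_action (k := 2) (l := 2 * m - 2)
    ((volume : Measure (Fin m → ℝ)).prod (volume : Measure (Fin m → ℝ)))
    (by simp [two_mul]) (by omega) hA hcharts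
    (fun x hx => contDiffAt_reducedFreq hx)
    (fun x hx => contDiffAt_density contDiff_lastCol_fst.contDiffAt contDiffAt_snd
      (isRegular_of_mem_regularPart hx))
    (fun x hx => (isRegular_of_mem_regularPart hx).density_pos)
    (contDiff_reducedField (Bₙ / (I₁ + Iₙ)))
    (fun J hJ x hx => hasDerivAt_of_isSolution hI hJ hx)
    (fun x hx J hJ φ hφ => isSolution_torusAction hI rfl hx hJ hφ)

theorem isCompletelyIntegrable_full (hm : 2 ≤ m) (hI : 0 < I₁ + Iₙ) {Γ₀ : Fin (m + 1) → ℝ}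
    (hΓ₀ : Γ₀ ⬝ᵥ Γ₀ = 1) :
    IsCompletelyIntegrable (fullPhaseSpace (constraint m)) ((m + 1).choose 2 + m)
      (IsFullSolution (massTensor m I₁ Iₙ) (potential m Bₙ) (constraint m) Γ₀) := by
  have hA := isFreeTorusAction_fullTorusAction (b := Bₙ / (I₁ + Iₙ)) hΓ₀
  have hcharts : ∀ x ∈ fullPhaseSpace (constraint m),
      ∃ (σ : (UpperIndex (m + 1) → ℝ) × (Fin m → ℝ) → _)
      (τ : _ → (UpperIndex (m + 1) → ℝ) × (Fin m → ℝ))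
      (U : Set ((UpperIndex (m + 1) → ℝ) × (Fin m → ℝ))) (O : Set _),
      IsLocalParam (fullPhaseSpace (constraint m)) σ τ U O ∧ x ∈ O ∧
        volume (U ∩ σ ⁻¹' (fullRegularPart (Bₙ / (I₁ + Iₙ)) Γ₀)ᶜ) = 0 := by
    intro x hx
    have hprod : IsLocalParam (fullPhaseSpace (constraint m)) _ _ _ _ :=
      (isLocalParam_rotation hx.1).prod isLocalParam_admissible
    refine ⟨_, _, _, _, hprod, ⟨mem_rotation_chart hx.1, mem_univ _⟩, ?_⟩
    -- Now Fubini over the attitude: `gᵀΓ₀` is vertical only on a null set of Cayley coordinates.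
    refine prod_eq_zero_of_ae_fst (hprod.measurableSet_preimage_compl hA.isOpen)
      (volume_rotation_vertical hm hx.1 hΓ₀) fun a ha => ?_
    have hg := mul_mem hx.1 (cayley_mem (skew_transpose a))
    refine measure_mono_null (fun w hw => ?_)
      (volume_irregular_eq_zero (b := Bₙ / (I₁ + Iₙ)) hm
        (by rw [transpose_mulVec_sq hg, hΓ₀]) ha)
    intro hreg
    refine hw.2 ⟨⟨hg, wedge_axis_mem⟩, ?_⟩
    change integrals _ (lastCol (wedge (Fin.snoc w 0 : Fin (m + 1) → ℝ) (axis m)))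
      ((x.1 * cayley (skew a))ᵀ *ᵥ Γ₀) ∈ regularValues _
    rwa [lastCol_wedge (by simp)]
  -- The subtraction of natural numbers is exact, since `m ≥ 2` makes the dimension at least `3`.
  have hd : 3 + ((m + 1).choose 2 + m - 3) = (m + 1).choose 2 + m := by
    have : 1 ≤ (m + 1).choose 2 := Nat.choose_pos (by omega)
    omega
  have hμ : ((volume : Measure (UpperIndex (m + 1) → ℝ)).prod
      (volume : Measure (Fin m → ℝ))).IsAddHaarMeasure := Measure.prod.instIsAddHaarMeasure _ _
  exact isCompletelyIntegrable_of_action (k := 3) (l := (m + 1).choose 2 + m - 3)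
    ((volume : Measure (UpperIndex (m + 1) → ℝ)).prod (volume : Measure (Fin m → ℝ)))
    (by rw [Module.finrank_prod, Module.finrank_fintype_fun_eq_card,
      Module.finrank_fintype_fun_eq_card, card_upperIndex, Fintype.card_fin]) hd hA hcharts
    (fun x hx => contDiffAt_fullFreq hx)
    (fun x hx => contDiffAt_density contDiff_lastCol_snd.contDiffAt
      (contDiff_transpose_mulVec Γ₀).contDiffAt (isRegular_of_mem_fullRegularPart hΓ₀ hx))
    (fun x hx => (isRegular_of_mem_fullRegularPart hΓ₀ hx).density_pos)
    (contDiff_fullField (Bₙ / (I₁ + Iₙ)) Γ₀)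
    (fun J hJ x hx => hasDerivAt_of_isFullSolution hI hJ hx)
    (fun x hx J hJ φ hφ => isFullSolution_fullTorusAction hI rfl hΓ₀ hx hJ hφ)

end integrability

end Suslov

end

theorem theorem1 (m : ℕ) (hm : 2 ≤ m) (I₁ Iₙ Bₙ : ℝ) (hI : 0 < I₁ + Iₙ) :
    Suslov.IsCompletelyIntegrable
      (Suslov.phaseSpace (Suslov.constraint m)) (2 * m)
      (Suslov.IsSolution (Suslov.massTensor m I₁ Iₙ) (Suslov.potential m Bₙ)
        (Suslov.constraint m)) ∧
    ∀ Γ₀ : Fin (m + 1) → ℝ, Γ₀ ⬝ᵥ Γ₀ = 1 →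
      Suslov.IsCompletelyIntegrable
        (Suslov.fullPhaseSpace (Suslov.constraint m)) ((m + 1).choose 2 + m)
        (Suslov.IsFullSolution (Suslov.massTensor m I₁ Iₙ) (Suslov.potential m Bₙ)
          (Suslov.constraint m) Γ₀) := by
  exact ⟨Suslov.isCompletelyIntegrable_reduced hm hI,
    fun _ hΓ₀ => Suslov.isCompletelyIntegrable_full hm hI hΓ₀⟩
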